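/- **Setting.** Let $H$ and $G$ be (real or complex) Hilbert spaces, $|\cdot|$ and $\langle\cdot,\cdot\rangle$ the norm and scalar product of $H$ ($G$ is identified with its dual), and let $A:D(A)\subset H\to H$ be self-adjoint and nonnegative, with compact resolvent and $|Au|\ge\omega|u|$ for all $u\in D(A)$, for some $\omega>0$. For $s\in\mathbb Z$ let $H_s$ be the Hilbert space with norm $|x|_s=|A^{s/2}x|$ ($H_s=D(A^{s/2})$ if $s\ge0$, $H_0=H$, and $H_{s}$ is the dual of $H_{-s}$ with pivot space $H$ if $s<0$). For a pair $W=(w,w')$ with values in $H_s\times H_{s-1}$ put $e_s(W)=\frac12\left(|w|_s^2+|w'|_{s-1}^2\right)$. Let $k\in\mathbb Z$, let $C_{21}$ be a bounded linear operator of $H_k$, with adjoint $C_{21}^*$ relative to the pivot space $H$, let $\Pi\in\mathcal L(H)$, and let $T_0>0$. Put $\overline C=A^{k/2}C_{21}A^{-k/2}\in\mathcal L(H)$. Assume: * $C_{21}^*\in\mathcal L(H_p)$ for $p\in\{-k,1-k\}$ (so $C_{21}$ extends to a bounded operator of $H_{k-1}$), $\|\overline C\|=\beta$, and, for some $\alpha>0$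 and all $w\in H$, $|\overline Cw|^2\le\beta\,\mathrm{Re}\langle\overline Cw,w\rangle$ and $\alpha|\Pi w|^2\le\mathrm{Re}\langle\overline Cw,w\rangle$; * for every $T>T_0$ there is $c>0$ such that $\int_0^T|\Pi w'|^2dt\ge c\,e_1(W)(0)$ for all solutions $W=(w,w')\in C([0,T];H_1\times H)$ of $w''+Aw=0$. For $\mathbf B^*\in\mathcal L(H_{k+2}\times H_k;G)$ consider the conditions * (admissibility) for every $T>0$ there is $c>0$ such that for all $f\in L^2((0,T);H_k)$ and all solutions $W=(w,w')\in C([0,T];H_{k+1}\times H_k)$ of $w''+Aw=f$ one has $\mathbf B^*(w,w')\in L^2((0,T);G)$ and $$\int_0^T\|\mathbf B^*(w,w')\|_G^2dt\le c\Big(e_{k+1}(W)(0)+e_{k+1}(W)(T)+\int_0^Te_{k+1}(W)dt+\int_0^T|A^{k/2}f|^2dt\Big);$$ * (observability) for every $T>T_0$ there is $c>0$ such that $\int_0^T\|\mathbf B^*(w,w')\|_G^2dt\ge c\,e_{k+1}(W)(0)$ for all such solutions with $f=0$. Here $\mathbf B^*(w,w')$ is understood in the sense of distributions in time: it equals $\varphi\in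 L^2((0,T);G)$ if, for every $\psi\in C_c^\infty(0,T)$, $\big(\int_0^T\psi w\,dt,\int_0^T\psi w'\,dt\big)\in H_{k+2}\times H_k$ and $\mathbf B^*$ maps it to $\int_0^T\psi\varphi\,dt$. (By density this is the usual extension from regular solutions.) **Minimal time.** Call $(\tau,\gamma_0,\alpha_0)$, with $\tau,\gamma_0,\alpha_0>0$, *uniform constants* for $(\Pi,\mathbf B^*)$ if, for all $T>\tau$, $T e_1(V)(0)\le\gamma_0\int_0^T|\Pi v'|^2dt$ for all solutions $V=(v,v')\in C([0,T];H_1\times H)$ of $v''+Av=0$, and, for some $\eta_0>0$ independent of $T>\tau$, $$\eta_0\int_0^T\|\mathbf B^*(p,p')\|_G^2dt\ge\int_0^Te_{k+1}(p,p')dt-\alpha_0\int_0^T|A^{k/2}f|^2dt$$ for all $f\in L^2((0,T);H_k)$ and all solutions $(p,p')\in C([0,T];H_{k+1}\times H_k)$ of $p''+Ap=f$ with $\mathbf B^*(p,p')\in L^2((0,T);G)$. Put $c_3=32$, $c_4=128$, $a=\frac{c_3\beta\gamma_0}{2\alpha}$, $b=\frac{c_4\beta^2\gamma_0^2}{2\alpha^2}$,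 $\sigma=\sqrt{a^2+a+b}$, $M=\frac{\sigma}{(2a+1)(a+\sigma)+a+2b}$ and $$T_3=\max(\tau,T_1,T_2),\qquad T_1=\frac{\sqrt{2c_4\alpha_0}\,\beta\gamma_0}{\alpha},\qquad T_2=\frac{\sqrt{2c_3\alpha_0\beta\gamma_0}}{\sqrt{\alpha M}}$$ (a quotient with zero denominator is read as $0$; this occurs only when $\beta=0$, which forces $H=\{0\}$). **Control system.** Consider $$y_1''+Ay_1+C_{21}^*y_2=0,\qquad y_2''+Ay_2=Bv,\qquad (y_1,y_2,y_1',y_2')(0)=Y_0,$$ and the spaces $$X^*_{-1,k}=H_{2-k}\times H_{1-k}\times H_{1-k}\times H_{-k},\qquad X^*_{1,k}=H_{1-k}\times H_{-k}\times H_{-k}\times H_{-k-1},$$ the duals of $X_{-1,k}=H_{k-1}\times H_k\times H_{k-2}\times H_{k-1}$ and $X_{1,k}=H_k\times H_{k+1}\times H_{k-1}\times H_k$ for the pairing $$[Y,W]=\langle y_1',w_1\rangle-\langle y_1,w_1'\rangle+\langle y_2',w_2\rangle-\langle y_2,w_2'\rangle .$$ With $X^*=X^*_{-1,k}$, $X=X_{-1,k}$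 in case (i), and $X^*=X^*_{1,k}$, $X=X_{1,k}$ in case (ii), $Y=(y_1,y_2,y_1',y_2')\in C([0,\infty);X^*)$ is a solution (by transposition) if $$\int_0^\theta\langle v,B^*w_2\rangle_G\,dt=[Y(\theta),W(\theta)]-[Y_0,W(0)]$$ for all $\theta>0$ and all solutions $W=(w_1,w_2,w_1',w_2')\in C([0,\theta];X)$ of $w_1''+Aw_1=0$, $w_2''+Aw_2+C_{21}w_1=0$, with arbitrary final data $W(\theta)\in X$. **Theorem 2.33.** Suppose that either * (i) $\mathbf B^*(w,w')=B^*w'$ with $B\in\mathcal L(G;H_k')$ and $X^*=X^*_{-1,k}$, or * (ii) $\mathbf B^*(w,w')=B^*w$ with $B\in\mathcal L(G;H_{k+2}')$ and $X^*=X^*_{1,k}$, and that $\mathbf B^*$ is admissible and observable in the above sense. Then for every $\tau>T_0$ there are $\gamma_0,\alpha_0>0$ such that $(\tau,\gamma_0,\alpha_0)$ are uniform constants; and for any uniform constants $(\tau,\gamma_0,\alpha_0)$ (with arbitrary $\tau>0$), with $T_3$ as above, for all $T>T_3$ and all $Y_0\in X^*$ there is a control $v\in L^2((0,T);G)$, extended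 by $0$ after time $T$, such that the control system has a solution $Y$ in $C([0,\infty);X^*)$ and every such solution satisfies $Y(T)=0$. -/

import Mathlib

namespace Cascade

open MeasureTheory
open scoped ContDiff

section Abstract

variable {𝕜 H : Type*} [RCLike 𝕜] [NormedAddCommGroup H] [InnerProductSpace 𝕜 H] [CompleteSpace H]

/-- The standing assumption on the (unbounded) operator `A : D(A) ⊂ H → H`: it is self-adjoint,
nonnegative (so that the powers `A ^ (k / 2)` make sense), satisfies `|A u| ≥ δ |u|` for some
`δ > 0`, and its resolvent `R = (A - z)⁻¹` is compact at some point `z` of the resolvent set. -/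
structure WaveOperator (A : H →ₗ.[𝕜] H) : Prop where
  selfAdjoint : IsSelfAdjoint A
  nonneg : ∀ u : A.domain, 0 ≤ RCLike.re (inner 𝕜 (A u) (u : H))
  bounded_below : ∃ δ : ℝ, 0 < δ ∧ ∀ u : A.domain, δ * ‖(u : H)‖ ≤ ‖A u‖
  compact_resolvent : ∃ (z : 𝕜) (R : H →L[𝕜] H), IsCompactOperator R ∧
    (∀ x : H, ∃ h : R x ∈ A.domain, A ⟨R x, h⟩ - z • R x = x) ∧
    ∀ u : A.domain, R (A u - z • (u : H)) = u

theorem WaveOperator.exists_inverse {A : H →ₗ.[𝕜] H} (hA : WaveOperator A) :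
    ∃ K : H →L[𝕜] H, IsCompactOperator K ∧ ∀ y : H, ∃ h : K y ∈ A.domain, A ⟨K y, h⟩ = y := by
  obtain ⟨δ, hδ, hbd⟩ := hA.bounded_below
  have hinj : ∀ u : A.domain, A u = 0 → (u : H) = 0 := fun u hu => by
    have := hbd u
    rw [hu, norm_zero] at this
    exact norm_eq_zero.mp (le_antisymm (by nlinarith [norm_nonneg (u : H)]) (norm_nonneg _))
  obtain ⟨z, R, hR, hR1, -⟩ := hA.compact_resolvent
  by_cases hz : z = 0
  · subst hz
    refine ⟨R, hR, fun y => ?_⟩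
    obtain ⟨h, e⟩ := hR1 y
    exact ⟨h, by simpa using e⟩
  · have hμ : -z⁻¹ ≠ 0 := neg_ne_zero.mpr (inv_ne_zero hz)
    rcases hR.hasEigenvalue_or_mem_resolventSet hμ with hev | hres
    · exfalso
      obtain ⟨v, hv⟩ := hev.exists_hasEigenvector
      have hv1 : R v = (-z⁻¹) • v := hv.apply_eq_smul
      obtain ⟨h, e⟩ := hR1 v
      have h0 : A ⟨R v, h⟩ = 0 := by
        have : z • R v = -v := by rw [hv1, smul_smul]; simp [hz]
        rw [this] at e
        simpa using e
      have h1 := hinj _ h0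
      rw [show ((⟨R v, h⟩ : A.domain) : H) = R v from rfl, hv1] at h1
      exact hv.2 ((smul_eq_zero.mp h1).resolve_left hμ)
    · rw [spectrum.mem_resolventSet_iff] at hres
      obtain ⟨S, hS⟩ := hres.exists_right_inv
      refine ⟨(R ∘L S) ∘L ((-z⁻¹) • ContinuousLinearMap.id 𝕜 H), ?_, fun y => ?_⟩
      · exact (hR.comp_clm S).comp_clm _
      · obtain ⟨h, e⟩ := hR1 (S ((-z⁻¹) • y))
        refine ⟨h, ?_⟩
        have hSy : (-z⁻¹) • S ((-z⁻¹) • y) - R (S ((-z⁻¹) • y)) = (-z⁻¹) • y := by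
          have := congrArg (fun L : H →L[𝕜] H => L ((-z⁻¹) • y)) hS
          simpa [Algebra.algebraMap_eq_smul_one] using this
        set x := S ((-z⁻¹) • y)
        have h2 : x + z • R x = y := by
          have := congrArg (fun t => (-z) • t) hSy
          simp only [smul_sub, smul_smul] at this
          rw [show -z * -z⁻¹ = 1 by field_simp] at this
          simpa using this
        calc A ⟨R x, h⟩ = (A ⟨R x, h⟩ - z • R x) + z • R x := by abel
          _ = y := by rw [e, h2]

theorem WaveOperator.exists_eigenbasis {A : H →ₗ.[𝕜] H} (hA : WaveOperator A) :
    ∃ (w : Set H) (b : HilbertBasis w 𝕜 H) (l : w → ℝ),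
      ∀ i, 0 < l i ∧ ∃ h : b i ∈ A.domain, A ⟨b i, h⟩ = (l i : 𝕜) • b i := by
  obtain ⟨K, hK, hKA⟩ := hA.exists_inverse
  have hfa := LinearPMap.adjoint_isFormalAdjoint hA.selfAdjoint.dense_domain
  rw [LinearPMap.isSelfAdjoint_def.mp hA.selfAdjoint] at hfa
  have hsymm : (K : H →ₗ[𝕜] H).IsSymmetric := fun x y => by
    obtain ⟨hx, ex⟩ := hKA x
    obtain ⟨hy, ey⟩ := hKA y
    have := hfa ⟨K x, hx⟩ ⟨K y, hy⟩
    rw [ex, ey] at this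
    exact this.symm
  -- every eigenvector of `K` is an eigenvector of `A` with a positive eigenvalue
  have hpos : ∀ (μ : 𝕜) (v : H), v ≠ 0 → K v = μ • v →
      ∃ l : ℝ, 0 < l ∧ ∃ h : v ∈ A.domain, A ⟨v, h⟩ = (l : 𝕜) • v := by
    intro μ v hv hKv
    obtain ⟨h, e⟩ := hKA v
    have hμ : μ ≠ 0 := by
      rintro rfl
      have h0 : (⟨K v, h⟩ : A.domain) = 0 := by ext; simp [hKv]
      rw [h0, A.map_zero] at e
      exact hv e.symm
    have hreal : (starRingEnd 𝕜) μ = μ := hsymm.conj_eigenvalue_eq_self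
      (Module.End.hasEigenvalue_of_hasEigenvector
        ⟨Module.End.mem_eigenspace_iff.mpr hKv, hv⟩)
    obtain ⟨r, hr⟩ := RCLike.conj_eq_iff_real.mp hreal
    have hr0 : r ≠ 0 := by rintro rfl; exact hμ (by simp [hr])
    have hvd : v ∈ A.domain := by
      have := A.domain.smul_mem μ⁻¹ h
      rwa [hKv, smul_smul, inv_mul_cancel₀ hμ, one_smul] at this
    have hAv : A ⟨v, hvd⟩ = ((r⁻¹ : ℝ) : 𝕜) • v := by
      have h1 : (⟨K v, h⟩ : A.domain) = μ • ⟨v, hvd⟩ := by ext; simp [hKv]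
      rw [h1, A.map_smul] at e
      calc A ⟨v, hvd⟩ = μ⁻¹ • μ • A ⟨v, hvd⟩ := by
            rw [smul_smul, inv_mul_cancel₀ hμ, one_smul]
        _ = ((r⁻¹ : ℝ) : 𝕜) • v := by rw [e, hr]; simp
    refine ⟨r⁻¹, ?_, hvd, hAv⟩
    have h2 := hA.nonneg ⟨v, hvd⟩
    rw [hAv] at h2
    simp only [inner_smul_left, RCLike.conj_ofReal, RCLike.re_ofReal_mul, inner_self_eq_norm_sq]
      at h2
    have h3 : 0 < ‖v‖ ^ 2 := by positivity
    exact lt_of_le_of_ne (nonneg_of_mul_nonneg_left h2 h3) (Ne.symm (inv_ne_zero hr0))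
  have hcl : ∀ μ : 𝕜, CompleteSpace (Module.End.eigenspace (K : H →ₗ[𝕜] H) μ) := fun μ => by
    have : IsClosed (Module.End.eigenspace (K : H →ₗ[𝕜] H) μ : Set H) := by
      have h1 : (Module.End.eigenspace (K : H →ₗ[𝕜] H) μ : Set H) = {v | K v = μ • v} := by
        ext v; simp
      rw [h1]
      exact isClosed_eq K.continuous (continuous_const_smul μ)
    exact this.completeSpace_coe
  choose S bS hbS using fun μ : 𝕜 =>
    exists_hilbertBasis 𝕜 (Module.End.eigenspace (K : H →ₗ[𝕜] H) μ)
  have hon := hsymm.orthogonalFamily_eigenspaces.orthonormal_sigma_orthonormal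
    (v_family := fun μ => (bS μ)) (fun μ => (bS μ).orthonormal)
  set v : (Σ μ, S μ) → H := fun a => ((bS a.1 a.2 : _) : H) with hvdef
  have hon' : Orthonormal 𝕜 v := hon
  have hbot : (Submodule.span 𝕜 (Set.range ((↑) : Set.range v → H)))ᗮ = ⊥ := by
    rw [Subtype.range_coe, eq_bot_iff,
      ← ContinuousLinearMap.orthogonalComplement_iSup_eigenspaces_eq_bot hK hsymm]
    rw [← Submodule.iInf_orthogonal]
    intro x hx
    rw [Submodule.mem_iInf]
    intro μ
    rw [Submodule.mem_orthogonal] at hx ⊢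
    intro u hu
    have h1 : HasSum (fun i => (bS μ).repr ⟨u, hu⟩ i • (bS μ i)) ⟨u, hu⟩ :=
      (bS μ).hasSum_repr ⟨u, hu⟩
    have h2 : HasSum (fun i => (bS μ).repr ⟨u, hu⟩ i • ((bS μ i : _) : H)) u :=
      h1.mapL (Submodule.subtypeL _)
    have h3 : HasSum (fun i => inner 𝕜 x ((bS μ).repr ⟨u, hu⟩ i • ((bS μ i : _) : H)))
        (inner 𝕜 x u) := h2.mapL (innerSL 𝕜 x)
    have h4 : ∀ i, inner 𝕜 x ((bS μ).repr ⟨u, hu⟩ i • ((bS μ i : _) : H)) = 0 := fun i => by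
      rw [inner_smul_right, inner_eq_zero_symm.mp (hx _ (Submodule.subset_span ⟨⟨μ, i⟩, rfl⟩)),
        mul_zero]
    simp only [h4] at h3
    exact inner_eq_zero_symm.mp (h3.unique hasSum_zero)
  let b := HilbertBasis.mkOfOrthogonalEqBot hon'.toSubtypeRange hbot
  have hb : ∀ i, b i = (i : H) := fun i => by simp [b]
  have key : ∀ i : Set.range v, ∃ l : ℝ, 0 < l ∧ ∃ h : b i ∈ A.domain,
      A ⟨b i, h⟩ = (l : 𝕜) • b i := by
    rintro ⟨_, ⟨⟨μ, i⟩, rfl⟩⟩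
    rw [hb]
    refine hpos μ _ (hon'.ne_zero ⟨μ, i⟩) ?_
    exact Module.End.mem_eigenspace_iff.mp (bS μ i).2
  choose l hl using key
  exact ⟨_, b, l, hl⟩

/-! ### The scale of spaces -/

/-- Index set of an orthonormal basis of eigenvectors of `A`. -/
def Idx {A : H →ₗ.[𝕜] H} (hA : WaveOperator A) : Type _ :=
  ↥hA.exists_eigenbasis.choose

section Scale

variable {A : H →ₗ.[𝕜] H} (hA : WaveOperator A)

/-- An orthonormal (Hilbert) basis `(e i)` of `H` made of eigenvectors of `A`. -/
noncomputable def eigenbasis : HilbertBasis (Idx hA) 𝕜 H :=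
  hA.exists_eigenbasis.choose_spec.choose

/-- The eigenvalues of `A`: `A (e i) = l i • e i`. -/
noncomputable def eigenval : Idx hA → ℝ :=
  hA.exists_eigenbasis.choose_spec.choose_spec.choose

theorem eigenbasis_spec (i : Idx hA) : 0 < eigenval hA i ∧
    ∃ h : eigenbasis hA i ∈ A.domain,
      A ⟨eigenbasis hA i, h⟩ = (eigenval hA i : 𝕜) • eigenbasis hA i :=
  hA.exists_eigenbasis.choose_spec.choose_spec.choose_spec i

/-- The weight `l i ^ (s / 2)`, by which `A ^ (s / 2)` acts on the eigenvector `e i`. -/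
noncomputable def weight (s : ℤ) (i : Idx hA) : ℝ := eigenval hA i ^ ((s : ℝ) / 2)

theorem weight_pos (s : ℤ) (i : Idx hA) : 0 < weight hA s i :=
  Real.rpow_pos_of_pos (eigenbasis_spec hA i).1 _

theorem weight_ne_zero (s : ℤ) (i : Idx hA) : (weight hA s i : 𝕜) ≠ 0 :=
  RCLike.ofReal_ne_zero.mpr (weight_pos hA s i).ne'

/-- The formal eigenfunction expansions `∑ x i • e i` (represented by their coefficients) with
`∑ |l i ^ (s / 2) x i| ^ 2 < ∞`. -/
noncomputable def HsSubmodule (s : ℤ) : Submodule 𝕜 (Idx hA → 𝕜) where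
  carrier := {x | Memℓp (fun i => (weight hA s i : 𝕜) * x i) 2}
  zero_mem' := by
    simp only [Set.mem_ofPred_eq, Pi.zero_apply, mul_zero]
    exact zero_memℓp
  add_mem' {x y} hx hy := by
    have := hx.add hy
    simp only [Set.mem_ofPred_eq]
    convert this using 1
    ext i
    simp [mul_add]
  smul_mem' c x hx := by
    have := hx.const_smul c
    simp only [Set.mem_ofPred_eq]
    convert this using 1
    ext i
    simp [mul_left_comm]

/-- The space `H_s`, `s ∈ ℤ`. For `s = 0` it is `H`; for `s ≥ 0` it is the domain
`D(A ^ (s / 2))`; for `s < 0` it is the dual of `H_{-s}` with pivot space `H`, i.e. the completion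
of `H` for the norm `|A ^ (s / 2) ·|`. Since an element is represented by its coefficients in
the eigenbasis, an element of `H_s` and an element of `H_r` are "the same" when
their coefficients coincide. -/
def Hs (s : ℤ) : Type _ := ↥(HsSubmodule hA s)

noncomputable instance (s : ℤ) : AddCommGroup (Hs hA s) :=
  inferInstanceAs (AddCommGroup ↥(HsSubmodule hA s))

noncomputable instance (s : ℤ) : Module 𝕜 (Hs hA s) :=
  inferInstanceAs (Module 𝕜 ↥(HsSubmodule hA s))

variable {hA} in
/-- The coefficients in the eigenbasis of an element of `H_s`. -/
def Hs.coeff {s : ℤ} (x : Hs hA s) : Idx hA → 𝕜 := x.1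

/-- `x ↦ (l i ^ (s / 2) x i)`, as a linear bijection of `H_s` onto `ℓ²`. -/
noncomputable def Hs.toLp (s : ℤ) : Hs hA s ≃ₗ[𝕜] lp (fun _ : Idx hA => 𝕜) 2 where
  toFun x := ⟨fun i => (weight hA s i : 𝕜) * x.coeff i, x.2⟩
  map_add' x y := by
    ext i
    exact mul_add _ _ _
  map_smul' c x := by
    ext i
    exact mul_left_comm _ _ _
  invFun f := ⟨fun i => (weight hA s i : 𝕜)⁻¹ * f i, by
    change Memℓp (fun i => (weight hA s i : 𝕜) * ((weight hA s i : 𝕜)⁻¹ * f i)) 2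
    simp only [mul_inv_cancel_left₀ (weight_ne_zero hA s _)]
    exact lp.memℓp f⟩
  left_inv x := Subtype.ext <| funext fun i =>
    inv_mul_cancel_left₀ (weight_ne_zero hA s i) _
  right_inv f := by
    ext i
    exact mul_inv_cancel_left₀ (weight_ne_zero hA s i) _

/-- The norm `|x|_s = |A ^ (s / 2) x|` of `H_s`. -/
noncomputable instance (s : ℤ) : NormedAddCommGroup (Hs hA s) :=
  NormedAddCommGroup.induced _ _ (Hs.toLp hA s) (Hs.toLp hA s).injective

noncomputable instance (s : ℤ) : InnerProductSpace 𝕜 (Hs hA s) :=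
  InnerProductSpace.induced (Hs.toLp hA s)

/-- The isometric isomorphism `A ^ (s / 2) : H_s → H`. -/
noncomputable def Apow (s : ℤ) : Hs hA s ≃ₗᵢ[𝕜] H :=
  LinearIsometryEquiv.trans ⟨Hs.toLp hA s, fun _ => rfl⟩ (eigenbasis hA).repr.symm

instance (s : ℤ) : CompleteSpace (Hs hA s) :=
  (Apow hA s).toIsometryEquiv.completeSpace

theorem repr_Apow (s : ℤ) (x : Hs hA s) (i : Idx hA) :
    (eigenbasis hA).repr (Apow hA s x) i = (weight hA s i : 𝕜) * x.coeff i := by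
  change (eigenbasis hA).repr ((eigenbasis hA).repr.symm (Hs.toLp hA s x)) i = _
  rw [LinearIsometryEquiv.apply_symm_apply]
  rfl

/-- The eigenvector `e i`, as an element of `H_s`. -/
noncomputable def eigenvec (s : ℤ) (i : Idx hA) : Hs hA s :=
  (Apow hA s).symm ((weight hA s i : 𝕜) • eigenbasis hA i)

open scoped Classical in
theorem coeff_eigenvec (s : ℤ) (i : Idx hA) : (eigenvec hA s i).coeff = Pi.single i 1 := by
  ext j
  have h := repr_Apow hA s (eigenvec hA s i) j
  rw [eigenvec, LinearIsometryEquiv.apply_symm_apply, map_smul, HilbertBasis.repr_self] at h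
  refine mul_left_cancel₀ (weight_ne_zero (𝕜 := 𝕜) hA s j) ?_
  rw [eigenvec, ← h]
  by_cases hj : j = i
  · subst hj; simp [RCLike.real_smul_eq_coe_mul]
  · simp [hj]

variable {hA} in
/-- The duality pairing `⟨x, y⟩` between `H_s` and `H_{-s}` with pivot space `H`, conjugate-linear
in `x` and linear in `y`. -/
noncomputable def pairing (x y : Idx hA → 𝕜) : 𝕜 := ∑' i, inner 𝕜 (x i) (y i)

theorem weight_neg_mul (s : ℤ) (i : Idx hA) : weight hA (-s) i * weight hA s i = 1 := by
  unfold weight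
  rw [← Real.rpow_add (eigenbasis_spec hA i).1]
  simp [neg_div]

theorem pairing_eq_inner (s : ℤ) (x : Hs hA (-s)) (y : Hs hA s) :
    pairing x.coeff y.coeff = inner 𝕜 (Apow hA (-s) x) (Apow hA s y) := by
  rw [← (eigenbasis hA).repr.inner_map_map, lp.inner_eq_tsum]
  refine tsum_congr fun i => ?_
  rw [repr_Apow, repr_Apow, ← smul_eq_mul, ← smul_eq_mul, inner_smul_left, inner_smul_right,
    RCLike.conj_ofReal, ← mul_assoc, ← RCLike.ofReal_mul, weight_neg_mul, RCLike.ofReal_one,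
    one_mul]

variable {G : Type*} [NormedAddCommGroup G] [InnerProductSpace 𝕜 G] [CompleteSpace G]

/-- The adjoint `B* ∈ L(H_m; G)` of a control operator `B ∈ L(G; H_m')`, where `H_m' = H_{-m}` and
`G` is identified with its dual: `⟨B v, x⟩ = ⟨v, B* x⟩_G`. -/
noncomputable def adjB {m : ℤ} (B : G →L[𝕜] Hs hA (-m)) : Hs hA m →L[𝕜] G :=
  (ContinuousLinearMap.adjoint
      (((Apow hA (-m)).toContinuousLinearEquiv : Hs hA (-m) →L[𝕜] H) ∘L B)) ∘L
    ((Apow hA m).toContinuousLinearEquiv : Hs hA m →L[𝕜] H)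

theorem inner_adjB {m : ℤ} (B : G →L[𝕜] Hs hA (-m)) (v : G) (x : Hs hA m) :
    inner 𝕜 v (adjB hA B x) = pairing (B v).coeff x.coeff := by
  rw [pairing_eq_inner, adjB, ContinuousLinearMap.comp_apply,
    ContinuousLinearMap.adjoint_inner_right]
  rfl

/-! ### The coupling operator -/

variable {hA}

/-- The adjoint `C*` of `C ∈ L(H_k)` with respect to the pivot space `H`:
`⟨e i, C* x⟩ = ⟨C (e i), x⟩`. -/
noncomputable def adjC {k : ℤ} (C : Hs hA k →L[𝕜] Hs hA k) (x : Idx hA → 𝕜) : Idx hA → 𝕜 :=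
  fun i => pairing (C (eigenvec hA k i)).coeff x

/-- `C x` for `x` in a space on which `C` is defined by transposition of `C*`:
`⟨e i, C x⟩ = ⟨C* (e i), x⟩`. It extends `C` from `H_k` to `H_{k-1}`
if `C* ∈ L(H_{1-k})`. -/
noncomputable def extC {k : ℤ} (C : Hs hA k →L[𝕜] Hs hA k) (x : Idx hA → 𝕜) : Idx hA → 𝕜 :=
  fun i => pairing (adjC C (eigenvec hA (-k) i).coeff) x

/-- A transformation of formal expansions is a bounded linear operator of `H_p` into itself. -/
def BoundedOn (F : (Idx hA → 𝕜) → (Idx hA → 𝕜)) (p : ℤ) : Prop :=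
  ∃ L : Hs hA p →L[𝕜] Hs hA p, ∀ x : Hs hA p, (L x).coeff = F x.coeff

/-- The bounded operator `A ^ (k / 2) C A ^ (-k / 2)` of `H`. -/
noncomputable def conjC {k : ℤ} (C : Hs hA k →L[𝕜] Hs hA k) : H →L[𝕜] H :=
  ((Apow hA k).toContinuousLinearEquiv : Hs hA k →L[𝕜] H) ∘L C ∘L
    ((Apow hA k).symm.toContinuousLinearEquiv : H →L[𝕜] Hs hA k)

/-- The assumption on the coupling operator `C = C₂₁`, with the constants `α`, `β`. -/
structure PartiallyCoercive {k : ℤ} (C : Hs hA k →L[𝕜] Hs hA k) (P : H →L[𝕜] H) (α β : ℝ) :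
    Prop where
  adjoint_bounded : BoundedOn (adjC C) (-k)
  adjoint_bounded_one : BoundedOn (adjC C) (1 - k)
  norm_eq : ‖conjC C‖ = β
  sq_le : ∀ w : H, ‖conjC C w‖ ^ 2 ≤ β * RCLike.re (inner 𝕜 (conjC C w) w)
  pos : 0 < α
  partial_coercive : ∀ w : H, α * ‖P w‖ ^ 2 ≤ RCLike.re (inner 𝕜 (conjC C w) w)

/-! ### The wave equation -/

/-- `(w, z)`, `z = w'`, satisfies `w'' + A w = F` on `[0, T]`, tested against the
eigenvectors of `A` and integrated in time. -/
def SolvesWave (T : ℝ) (F w z : ℝ → Idx hA → 𝕜) : Prop :=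
  ∀ t ∈ Set.Icc (0 : ℝ) T, ∀ i,
    w t i = w 0 i + ∫ s in (0 : ℝ)..t, z s i ∧
    z t i = z 0 i + ∫ s in (0 : ℝ)..t, (F s i - (eigenval hA i : 𝕜) * w s i)

/-- `(w, z)`, `z = w'`, is the solution in `C([0, T]; H_{k+1} × H_k)` of `w'' + A w = f`,
`(w, w')(0) = (w0, w1)`. -/
structure IsWave (k : ℤ) (T : ℝ) (f : ℝ → Hs hA k) (w0 : Hs hA (k + 1)) (w1 : Hs hA k)
    (w : ℝ → Hs hA (k + 1)) (z : ℝ → Hs hA k) : Prop where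
  continuousOn : ContinuousOn w (Set.Icc 0 T)
  continuousOn_deriv : ContinuousOn z (Set.Icc 0 T)
  init : w 0 = w0
  init_deriv : z 0 = w1
  solves : SolvesWave T (fun t => (f t).coeff) (fun t => (w t).coeff) (fun t => (z t).coeff)

/-- The energy of level `k + 1`: `e_{k+1}(w, z) = (|A^{(k+1)/2} w|² + |A^{k/2} z|²) / 2`. -/
noncomputable def energy {k : ℤ} (w : Hs hA (k + 1)) (z : Hs hA k) : ℝ :=
  (‖w‖ ^ 2 + ‖z‖ ^ 2) / 2

/-- `f ∈ L²((0, T); E)`. -/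
def L2On {E : Type*} [NormedAddCommGroup E] (T : ℝ) (f : ℝ → E) : Prop :=
  MemLp f 2 (volume.restrict (Set.Ioo 0 T))

/-! ### Observation operators -/

/-- The observation `φ = 𝐁*(w, w') ∈ L²((0, T); G)` of a pair `(w, z)`, `z = w'`, where
`𝐁* ∈ L(H_{k+2} × H_k; G)`. Since `(w, z)` takes its values only in the larger space
`H_{k+1} × H_k`, the identity is understood in the sense of distributions in time: for every test
function `ψ` on `(0, T)`, `(∫ ψ w, ∫ ψ z)` belongs to `H_{k+2} × H_k` and its image by
`𝐁*` is `∫ ψ φ`. If `(w, z)` is continuous with values in `H_{k+2} × H_k` this means that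
`φ t = 𝐁*(w t, z t)` for almost every `t`; in general `φ` is the limit in `L²` of the observations
of regular solutions. -/
def IsObs {k : ℤ} (BB : Hs hA (k + 2) × Hs hA k →L[𝕜] G) (T : ℝ)
    (w z : ℝ → Idx hA → 𝕜) (φ : ℝ → G) : Prop :=
  L2On T φ ∧
  ∀ ψ : ℝ → ℝ, ContDiff ℝ ∞ ψ → HasCompactSupport ψ → tsupport ψ ⊆ Set.Ioo 0 T →
    ∃ (x : Hs hA (k + 2)) (y : Hs hA k),
      (∀ i, x.coeff i = ∫ t in (0 : ℝ)..T, (ψ t : 𝕜) * w t i) ∧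
      (∀ i, y.coeff i = ∫ t in (0 : ℝ)..T, (ψ t : 𝕜) * z t i) ∧
      ∀ g : G, inner 𝕜 g (BB (x, y)) = ∫ t in (0 : ℝ)..T, (ψ t : 𝕜) * inner 𝕜 g (φ t)

variable (hA) in
/-- Observability of the free wave equation through `P w'` in every time `T > T₀`. -/
def CouplingObservable (P : H →L[𝕜] H) (T₀ : ℝ) : Prop :=
  ∀ T : ℝ, T₀ < T → ∃ c : ℝ, 0 < c ∧ ∀ (w0 : Hs hA (0 + 1)) (w1 : Hs hA 0) (w : ℝ → Hs hA (0 + 1))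
    (z : ℝ → Hs hA 0), IsWave 0 T 0 w0 w1 w z →
      c * energy (w 0) (z 0) ≤ ∫ t in (0 : ℝ)..T, ‖P (Apow hA 0 (z t))‖ ^ 2

/-- Admissibility of the observation operator `𝐁*` for one wave equation. -/
def Admissible {k : ℤ} (BB : Hs hA (k + 2) × Hs hA k →L[𝕜] G) : Prop :=
  ∀ T : ℝ, 0 < T → ∃ c : ℝ, 0 < c ∧ ∀ (w0 : Hs hA (k + 1)) (w1 : Hs hA k) (f : ℝ → Hs hA k)
    (w : ℝ → Hs hA (k + 1)) (z : ℝ → Hs hA k), L2On T f → IsWave k T f w0 w1 w z →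
      ∃ φ : ℝ → G, IsObs BB T (fun t => (w t).coeff) (fun t => (z t).coeff) φ ∧
        ∫ t in (0 : ℝ)..T, ‖φ t‖ ^ 2 ≤ c * (energy (w 0) (z 0) + energy (w T) (z T) +
          (∫ t in (0 : ℝ)..T, energy (w t) (z t)) + ∫ t in (0 : ℝ)..T, ‖f t‖ ^ 2)

/-- Observability of the free wave equation through `𝐁*(w, w')` in every time `T > T₀`. -/
def Observable {k : ℤ} (BB : Hs hA (k + 2) × Hs hA k →L[𝕜] G) (T₀ : ℝ) : Prop :=
  ∀ T : ℝ, T₀ < T → ∃ c : ℝ, 0 < c ∧ ∀ (w0 : Hs hA (k + 1)) (w1 : Hs hA k)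
    (w : ℝ → Hs hA (k + 1)) (z : ℝ → Hs hA k) (φ : ℝ → G), IsWave k T 0 w0 w1 w z →
      IsObs BB T (fun t => (w t).coeff) (fun t => (z t).coeff) φ →
        c * energy (w 0) (z 0) ≤ ∫ t in (0 : ℝ)..T, ‖φ t‖ ^ 2

variable (hA) in
/-- `𝐁*(w, w') = B* w'` with `B ∈ L(G; H_k')`. -/
noncomputable def obsBounded (k : ℤ) (B : G →L[𝕜] Hs hA (-k)) :
    Hs hA (k + 2) × Hs hA k →L[𝕜] G :=
  adjB hA B ∘L ContinuousLinearMap.snd 𝕜 _ _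

variable (hA) in
/-- `𝐁*(w, w') = B* w` with `B ∈ L(G; H_{k+2}')`. -/
noncomputable def obsUnbounded (k : ℤ) (B : G →L[𝕜] Hs hA (-(k + 2))) :
    Hs hA (k + 2) × Hs hA k →L[𝕜] G :=
  adjB hA B ∘L ContinuousLinearMap.fst 𝕜 _ _

/-! ### The minimal time -/

/-- `T₀`, `γ`, `a₀` are admissible constants in the two observability inequalities which are uniform
with respect to `T > T₀`: `T e_1(V)(0) ≤ γ ∫ |P v'|²` for the solutions of `v'' + A v = 0`, and, for
some `η`, `η ∫ |𝐁*(p, p')|² ≥ ∫ e_{k+1}(p, p') - a₀ ∫ |A^{k/2} f|²`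
for the solutions of `p'' + A p = f`. -/
structure UniformConstants {k : ℤ} (BB : Hs hA (k + 2) × Hs hA k →L[𝕜] G) (P : H →L[𝕜] H)
    (T₀ γ a₀ : ℝ) : Prop where
  T₀_pos : 0 < T₀
  γ_pos : 0 < γ
  a₀_pos : 0 < a₀
  coupling : ∀ T : ℝ, T₀ < T → ∀ (w0 : Hs hA (0 + 1)) (w1 : Hs hA 0) (w : ℝ → Hs hA (0 + 1))
    (z : ℝ → Hs hA 0), IsWave 0 T 0 w0 w1 w z →
      T * energy (w 0) (z 0) ≤ γ * ∫ t in (0 : ℝ)..T, ‖P (Apow hA 0 (z t))‖ ^ 2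
  observation : ∃ η : ℝ, 0 < η ∧ ∀ T : ℝ, T₀ < T → ∀ (w0 : Hs hA (k + 1)) (w1 : Hs hA k) (f : ℝ → Hs hA k)
    (w : ℝ → Hs hA (k + 1)) (z : ℝ → Hs hA k) (φ : ℝ → G), L2On T f →
      IsWave k T f w0 w1 w z →
      IsObs BB T (fun t => (w t).coeff) (fun t => (z t).coeff) φ →
        (∫ t in (0 : ℝ)..T, energy (w t) (z t)) - a₀ * ∫ t in (0 : ℝ)..T, ‖f t‖ ^ 2 ≤
          η * ∫ t in (0 : ℝ)..T, ‖φ t‖ ^ 2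

/-! ### Cascade systems -/

/-- `W = (w₁, w₂, w₁', w₂')` is a solution, continuous on `[0, T]`, of the dual system
`w₁'' + A w₁ = 0`, `w₂'' + A w₂ + C w₁ = 0`. -/
structure IsDual {k a b c d : ℤ} (C : Hs hA k →L[𝕜] Hs hA k) (T : ℝ)
    (W : ℝ → Hs hA a × Hs hA b × Hs hA c × Hs hA d) : Prop where
  continuousOn : ContinuousOn W (Set.Icc 0 T)
  first : SolvesWave T 0 (fun t => (W t).1.coeff) (fun t => (W t).2.2.1.coeff)
  second : SolvesWave T (fun t => -extC C (W t).1.coeff) (fun t => (W t).2.1.coeff)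
    (fun t => (W t).2.2.2.coeff)

/-- `⟨y₁', w₁⟩ - ⟨y₁, w₁'⟩ + ⟨y₂', w₂⟩ - ⟨y₂, w₂'⟩` for `Y = (y₁, y₂, y₁', y₂')` and
`W = (w₁, w₂, w₁', w₂')`. -/
noncomputable def bracket {a b c d a' b' c' d' : ℤ}
    (Y : Hs hA a' × Hs hA b' × Hs hA c' × Hs hA d')
    (W : Hs hA a × Hs hA b × Hs hA c × Hs hA d) : 𝕜 :=
  pairing Y.2.2.1.coeff W.1.coeff - pairing Y.1.coeff W.2.2.1.coeff +
    pairing Y.2.2.2.coeff W.2.1.coeff - pairing Y.2.1.coeff W.2.2.2.coeff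

variable (hA)

/-- `X_{-1,k} = H_{k-1} × H_k × H_{k-2} × H_{k-1}`. -/
abbrev Xm (k : ℤ) : Type _ := Hs hA (k - 1) × Hs hA k × Hs hA (k - 2) × Hs hA (k - 1)

/-- `X*_{-1,k} = H_{2-k} × H_{1-k} × H_{1-k} × H_{-k}`. -/
abbrev XmStar (k : ℤ) : Type _ := Hs hA (2 - k) × Hs hA (1 - k) × Hs hA (1 - k) × Hs hA (-k)

/-- `X_{1,k} = H_k × H_{k+1} × H_{k-1} × H_k`. -/
abbrev Xp (k : ℤ) : Type _ := Hs hA k × Hs hA (k + 1) × Hs hA (k - 1) × Hs hA k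

/-- `X*_{1,k} = H_{1-k} × H_{-k} × H_{-k} × H_{-k-1}`. -/
abbrev XpStar (k : ℤ) : Type _ := Hs hA (1 - k) × Hs hA (-k) × Hs hA (-k) × Hs hA (-k - 1)

variable {hA}

/-- `Y = (y₁, y₂, y₁', y₂') ∈ C([0, ∞); X*_{-1,k})` is the solution by transposition of
`y₁'' + A y₁ + C* y₂ = 0`, `y₂'' + A y₂ = B v`, with initial data `Y₀`, where `B ∈ L(G; H_k')`. -/
structure IsTranspositionBounded {k : ℤ} (C : Hs hA k →L[𝕜] Hs hA k) (B : G →L[𝕜] Hs hA (-k))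
    (v : ℝ → G) (Y₀ : XmStar hA k) (Y : ℝ → XmStar hA k) : Prop where
  continuousOn : ContinuousOn Y (Set.Ici 0)
  identity : ∀ T : ℝ, 0 < T → ∀ (WT : Xm hA k) (W : ℝ → Xm hA k), IsDual C T W → W T = WT →
    ∫ t in (0 : ℝ)..T, inner 𝕜 (v t) (adjB hA B (W t).2.1) =
      bracket (Y T) WT - bracket Y₀ (W 0)

/-- `Y = (y₁, y₂, y₁', y₂') ∈ C([0, ∞); X*_{1,k})` is the solution by transposition of
`y₁'' + A y₁ + C* y₂ = 0`, `y₂'' + A y₂ = B v`, with initial data `Y₀`, where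
`B ∈ L(G; H_{k+2}')`. Here `φ` is the observation `B* w₂`. -/
structure IsTranspositionUnbounded {k : ℤ} (C : Hs hA k →L[𝕜] Hs hA k)
    (B : G →L[𝕜] Hs hA (-(k + 2))) (v : ℝ → G) (Y₀ : XpStar hA k) (Y : ℝ → XpStar hA k) :
    Prop where
  continuousOn : ContinuousOn Y (Set.Ici 0)
  identity : ∀ T : ℝ, 0 < T → ∀ (WT : Xp hA k) (W : ℝ → Xp hA k), IsDual C T W → W T = WT →
    ∀ φ : ℝ → G, IsObs (obsUnbounded hA k B) T (fun t => (W t).2.1.coeff)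
        (fun t => (W t).2.2.2.coeff) φ →
      ∫ t in (0 : ℝ)..T, inner 𝕜 (v t) (φ t) = bracket (Y T) WT - bracket Y₀ (W 0)

end Scale

end Abstract

/-- The minimal time `T₃ = max (T₀, T₁, T₂)`, with
`T₁ = √(2 c₄ a₀) β γ / α`, `T₂ = √(2 c₃ a₀ β γ) / √(α M)`,
`M = σ / ((2 a + 1) (a + σ) + a + 2 b)`, `σ = √(a² + a + b)`,
`a = c₃ β γ / (2 α)`, `b = c₄ β² γ² / (2 α²)`, `c₃ = 32`, `c₄ = 128`. -/
noncomputable def minimalTime (α β γ a₀ T₀ : ℝ) : ℝ :=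
  let c₃ : ℝ := 32
  let c₄ : ℝ := 128
  let a : ℝ := c₃ * β * γ / (2 * α)
  let b : ℝ := c₄ * β ^ 2 * γ ^ 2 / (2 * α ^ 2)
  let σ : ℝ := √(a ^ 2 + a + b)
  let M : ℝ := σ / ((2 * a + 1) * (a + σ) + a + 2 * b)
  let T₁ : ℝ := √(2 * c₄ * a₀) * β * γ / α
  let T₂ : ℝ := √(2 * c₃ * a₀ * β * γ) / √(α * M)
  max T₀ (max T₁ T₂)

end Cascade

/-! Put Λ = A^{1/2}. With x = A^{(s+1)/2} w and z = A^{s/2} w', the equation w'' + Aw = F becomes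
the system x' = Λz, z' = -Λx + f in H (`isRot_iff_solvesWave`). Λ is diagonal in the eigenbasis, so
the free flow is a rotation by cos(Λt), sin(Λt). Rotating a solution back to time 0 removes Λ and
leaves a Duhamel formula containing bounded operators only (`IsRot.eq_rot`). The dual system becomes
a cascade (x₁, z₁), (x₂, z₂) in which the second pair has the source -Dx₁ with D bounded; on
X_{1,k}, D is the conjugated coupling operator `conjC C`.

Observability of the cascade rests on X = Re(⟨x₁, z₂⟩ - ⟨z₁, x₂⟩), whose derivative is -i with i =
Re⟨Dx₁, x₁⟩ ≥ 0. Let E be the conserved energy of the first pair, e₂ the energy of the second, I = ∫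
i and S = ∫ e₂. Then i ≤ 2βE and X² ≤ 4E e₂. Since X(0) - X(T) = I, one has X(0)³ - X(T)³ ≥ I³/4,
while integrating 3X²X' bounds the same quantity by a multiple of βE²S. Hence I³ ≤ 96βE²S
(`coupling_cube_le`). Observability through Π and partial coercivity give αTE ≤ γI, and eliminating
E gives α²T²I ≤ 96βγ²S. The source term of the second observability inequality is at most α₀βI, so T
> T₁ allows it to be absorbed in S (`energy_le_of_cube_le`). The observation then controls S, next
E, and finally the initial data of the second pair (`cascade_observability`).

Controllability follows by the Hilbert uniqueness method. Admissibility makes the map Ψ from dual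
initial data to observation bounded and linear (`exists_observationMap`); observability bounds it
below, so its adjoint is onto (`exists_adjoint_apply_eq`). The controlled state at time θ is
obtained from Ψ* applied to the truncated control, moved forward by the uncontrolled flow, under
which the duality bracket is constant (`exists_cascade_control`).

This settles case (ii). In case (i) the dual solutions live one level lower and the observation is
B*w₂. A primitive in time brings them back to the first setting, where B*w₂ is B* of the velocity
(`IsCascade.primitive`). Uniform constants come from cutting [0, T] into windows of length τ
(`le_two_mul_of_window`). -/

set_option linter.unusedSectionVars false

namespace Cascade

open MeasureTheory

/-! ### Diagonal operators and the rotation group cos(Λt), sin(Λt) -/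

section Diagonal

variable {𝕜 H ι : Type*} [RCLike 𝕜] [NormedAddCommGroup H] [InnerProductSpace 𝕜 H]
  [CompleteSpace H] (b : HilbertBasis ι 𝕜 H)

theorem repr_ext {x y : H} (h : ∀ i, b.repr x i = b.repr y i) : x = y :=
  b.repr.injective (lp.ext (funext h))

theorem inner_eq_tsum_repr (x y : H) :
    inner 𝕜 x y = ∑' i, inner 𝕜 (b.repr x i) (b.repr y i) := by
  rw [← b.repr.inner_map_map, lp.inner_eq_tsum]

theorem inner_symm_of_repr {L : H → H} {m : ι → ℝ}
    (hL : ∀ x i, b.repr (L x) i = (m i : 𝕜) * b.repr x i) (x y : H) :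
    inner 𝕜 (L x) y = inner 𝕜 x (L y) := by
  rw [inner_eq_tsum_repr b, inner_eq_tsum_repr b]
  refine tsum_congr fun i => ?_
  rw [hL, hL, ← smul_eq_mul, ← smul_eq_mul, inner_smul_left, inner_smul_right, RCLike.conj_ofReal]

/-- Diagonal operators with bounded real entries. -/
theorem exists_diagonal (m : ι → ℝ) {M : ℝ} (hM : ∀ i, |m i| ≤ M) :
    ∃ L : H →L[𝕜] H, ∀ x i, b.repr (L x) i = (m i : 𝕜) * b.repr x i := by
  have hmem : ∀ x : H, Memℓp (fun i => (m i : 𝕜) * b.repr x i) 2 := fun x => by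
    have h1 := (lp.memℓp (b.repr x)).summable (by norm_num)
    refine memℓp_gen (Summable.of_nonneg_of_le (fun i => by positivity) (fun i => ?_)
      (h1.mul_left (M ^ 2)))
    simp only [ENNReal.toReal_ofNat, Real.rpow_ofNat, norm_mul, RCLike.norm_ofReal, mul_pow]
    have := hM i
    gcongr
  let L : H →ₗ[𝕜] H :=
    { toFun := fun x => b.repr.symm ⟨fun i => (m i : 𝕜) * b.repr x i, hmem x⟩
      map_add' := fun x y => repr_ext b fun i => by
        simp [mul_add]
        rfl
      map_smul' := fun c x => repr_ext b fun i => by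
        simp [mul_left_comm] }
  have hL : ∀ x i, b.repr (L x) i = (m i : 𝕜) * b.repr x i := fun x i => by simp [L]
  -- Hellinger–Toeplitz: a symmetric operator defined everywhere is continuous, so no norm bound has
  -- to be computed.
  have hsymm : L.IsSymmetric := fun x y => inner_symm_of_repr b hL x y
  exact ⟨⟨L, hsymm.continuous⟩, hL⟩

variable (μ : ι → ℝ)

/-- The operator acting on the `i`-th basis vector as multiplication by `cos (μ i * t)`. -/
noncomputable def cosOp (t : ℝ) : H →L[𝕜] H :=
  (exists_diagonal b (fun i => Real.cos (μ i * t)) (fun _ => Real.abs_cos_le_one _)).choose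

/-- The operator acting on the `i`-th basis vector as multiplication by `sin (μ i * t)`. -/
noncomputable def sinOp (t : ℝ) : H →L[𝕜] H :=
  (exists_diagonal b (fun i => Real.sin (μ i * t)) (fun _ => Real.abs_sin_le_one _)).choose

theorem repr_cosOp (t : ℝ) (x : H) (i : ι) :
    b.repr (cosOp b μ t x) i = (Real.cos (μ i * t) : 𝕜) * b.repr x i :=
  (exists_diagonal b (fun i => Real.cos (μ i * t)) (fun _ => Real.abs_cos_le_one _)).choose_spec x i

theorem repr_sinOp (t : ℝ) (x : H) (i : ι) :
    b.repr (sinOp b μ t x) i = (Real.sin (μ i * t) : 𝕜) * b.repr x i :=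
  (exists_diagonal b (fun i => Real.sin (μ i * t)) (fun _ => Real.abs_sin_le_one _)).choose_spec x i

theorem inner_cosOp (t : ℝ) (x y : H) :
    inner 𝕜 (cosOp b μ t x) y = inner 𝕜 x (cosOp b μ t y) :=
  inner_symm_of_repr b (repr_cosOp b μ t) x y

theorem inner_sinOp (t : ℝ) (x y : H) :
    inner 𝕜 (sinOp b μ t x) y = inner 𝕜 x (sinOp b μ t y) :=
  inner_symm_of_repr b (repr_sinOp b μ t) x y

theorem cos_sq_add_sin_sq_op (t : ℝ) (x : H) :
    cosOp b μ t (cosOp b μ t x) + sinOp b μ t (sinOp b μ t x) = x := by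
  refine repr_ext b fun i => ?_
  have h : (Real.cos (μ i * t) : 𝕜) ^ 2 + (Real.sin (μ i * t) : 𝕜) ^ 2 = 1 := by
    exact_mod_cast congrArg (RCLike.ofReal (K := 𝕜)) (Real.cos_sq_add_sin_sq (μ i * t))
  simp only [map_add, lp.coeFn_add, Pi.add_apply, repr_cosOp, repr_sinOp]
  linear_combination (b.repr x i) * h

theorem cosOp_sinOp_comm (t : ℝ) (x : H) :
    cosOp b μ t (sinOp b μ t x) = sinOp b μ t (cosOp b μ t x) :=
  repr_ext b fun i => by simp only [repr_cosOp, repr_sinOp]; ring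

@[simp] theorem cosOp_zero (x : H) : cosOp b μ 0 x = x :=
  repr_ext b fun i => by simp [repr_cosOp]

@[simp] theorem sinOp_zero (x : H) : sinOp b μ 0 x = 0 :=
  repr_ext b fun i => by simp [repr_sinOp]

/-- Rotations preserve the norm. -/
theorem norm_sq_rotation (t : ℝ) (x z : H) :
    ‖cosOp b μ t x + sinOp b μ t z‖ ^ 2 + ‖cosOp b μ t z - sinOp b μ t x‖ ^ 2 =
      ‖x‖ ^ 2 + ‖z‖ ^ 2 := by
  have key : ∀ x : H, ‖cosOp b μ t x‖ ^ 2 + ‖sinOp b μ t x‖ ^ 2 = ‖x‖ ^ 2 := fun x => by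
    rw [← inner_self_eq_norm_sq (𝕜 := 𝕜), ← inner_self_eq_norm_sq (𝕜 := 𝕜),
      ← inner_self_eq_norm_sq (𝕜 := 𝕜) x, inner_cosOp, inner_sinOp, ← map_add, ← inner_add_right,
      cos_sq_add_sin_sq_op]
  have h1 : inner 𝕜 (cosOp b μ t x) (sinOp b μ t z) = inner 𝕜 (sinOp b μ t x) (cosOp b μ t z) := by
    rw [inner_cosOp, inner_sinOp, cosOp_sinOp_comm]
  have h2 := congrArg RCLike.re h1
  rw [← inner_re_symm (𝕜 := 𝕜) (cosOp b μ t z) (sinOp b μ t x)] at h2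
  rw [norm_add_sq (𝕜 := 𝕜), norm_sub_sq (𝕜 := 𝕜), h2, ← key x, ← key z]
  ring

theorem norm_cosOp_le (t : ℝ) (x : H) : ‖cosOp b μ t x‖ ≤ ‖x‖ := by
  have := norm_sq_rotation b μ t x 0
  simp only [map_zero, add_zero, zero_sub, norm_neg, norm_zero] at this
  exact le_of_sq_le_sq (by nlinarith [sq_nonneg ‖sinOp b μ t x‖]) (norm_nonneg _)

theorem norm_sinOp_le (t : ℝ) (x : H) : ‖sinOp b μ t x‖ ≤ ‖x‖ := by
  have := norm_sq_rotation b μ t x 0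
  simp only [map_zero, add_zero, zero_sub, norm_neg, norm_zero] at this
  exact le_of_sq_le_sq (by nlinarith [sq_nonneg ‖cosOp b μ t x‖]) (norm_nonneg _)

/-- The operators are in general not norm continuous in t, since the entries μ i may be unbounded.
Joint continuity still holds: it is clear on finite combinations of basis vectors, and the uniform
Lipschitz bound extends it by density. -/
theorem continuous_of_diagonal {L : ℝ → H →L[𝕜] H} {m : ℝ → ι → ℝ}
    (hm : ∀ i, Continuous fun t => m t i)
    (hL : ∀ t x i, b.repr (L t x) i = (m t i : 𝕜) * b.repr x i) (hle : ∀ t x, ‖L t x‖ ≤ ‖x‖) :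
    Continuous fun p : ℝ × H => L p.1 p.2 := by
  refine continuous_prod_of_dense_continuous_lipschitzWith' (fun p : ℝ × H => L p.1 p.2) 1
    (t := (Submodule.span 𝕜 (Set.range b) : Set H)) ?_ ?_ ?_
  · rw [Submodule.dense_iff_topologicalClosure_eq_top]
    exact b.dense_span
  · intro t
    refine LipschitzWith.of_dist_le_mul fun x y => ?_
    rw [dist_eq_norm, dist_eq_norm, ← map_sub]
    simpa using hle t (x - y)
  · intro x hx
    induction hx using Submodule.span_induction with
    | mem x hx =>
      obtain ⟨i, rfl⟩ := hx
      have : ∀ t, L t (b i) = (m t i : 𝕜) • b i := fun t => repr_ext b fun j => by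
        classical
        rw [hL, map_smul, lp.coeFn_smul, Pi.smul_apply, smul_eq_mul, b.repr_self]
        by_cases hj : j = i
        · subst hj; rfl
        · simp [hj]
      simp only [this]
      exact (RCLike.continuous_ofReal.comp (hm i)).smul continuous_const
    | zero => simpa using continuous_const
    | add x y _ _ hx hy =>
      simp only [map_add]
      exact hx.add hy
    | smul c x _ hx =>
      simp only [map_smul]
      exact hx.const_smul c

theorem continuous_cosOp : Continuous fun p : ℝ × H => cosOp b μ p.1 p.2 :=
  continuous_of_diagonal b (m := fun t i => Real.cos (μ i * t)) (fun i => by fun_prop)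
    (repr_cosOp b μ) (norm_cosOp_le b μ)

theorem continuous_sinOp : Continuous fun p : ℝ × H => sinOp b μ p.1 p.2 :=
  continuous_of_diagonal b (m := fun t i => Real.sin (μ i * t)) (fun i => by fun_prop)
    (repr_sinOp b μ) (norm_sinOp_le b μ)

end Diagonal

end Cascade

/-! ### The first-order system x' = Λz, z' = -Λx + f: Duhamel formula, energy, Green's formula -/

namespace Cascade

open MeasureTheory

/-- Sources are only square integrable in time, so g is merely absolutely continuous and `h` is its
derivative almost everywhere; integration by parts is used in this generality. -/
theorem mul_sub_eq_integral_of_primitive_real {φ φ' : ℝ → ℝ} (hφ : ∀ t, HasDerivAt φ (φ' t) t)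
    (hφ' : Continuous φ') {h g : ℝ → ℝ} {T : ℝ} (hh : IntervalIntegrable h volume 0 T)
    (hg : ∀ t ∈ Set.Icc 0 T, g t = g 0 + ∫ s in (0 : ℝ)..t, h s) {t : ℝ}
    (ht : t ∈ Set.Icc 0 T) :
    φ t * g t - φ 0 * g 0 = ∫ s in (0 : ℝ)..t, (φ' s * g s + φ s * h s) := by
  have hsub : Set.uIcc 0 t ⊆ Set.uIcc 0 T := by
    rw [Set.uIcc_of_le ht.1, Set.uIcc_of_le (ht.1.trans ht.2)]
    exact Set.Icc_subset_Icc_right ht.2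
  have hh' := hh.mono_set hsub
  have hφd : deriv φ = φ' := funext fun t => (hφ t).deriv
  have hφ1 : ContDiff ℝ 1 φ := by
    rw [contDiff_one_iff_deriv, hφd]
    exact ⟨fun t => (hφ t).differentiableAt, hφ'⟩
  have hG : AbsolutelyContinuousOnInterval (fun s => g 0 + ∫ v in (0 : ℝ)..s, h v) 0 t :=
    (contDiff_const (n := 1) (c := g 0)).contDiffOn.absolutelyContinuousOnInterval.add
      (hh'.absolutelyContinuousOnInterval_intervalIntegral (by simp))
  have key := AbsolutelyContinuousOnInterval.integral_deriv_mul_eq_sub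
    (hφ1.contDiffOn.absolutelyContinuousOnInterval (a := 0) (b := t)) hG
  rw [← hg t ht] at key
  simp only [intervalIntegral.integral_same, add_zero] at key
  rw [← key]
  refine intervalIntegral.integral_congr_ae ?_
  filter_upwards [hh'.ae_hasDerivAt_integral] with s hs hs'
  have hs1 := Set.uIoc_subset_uIcc hs'
  have hs2 : s ∈ Set.Icc 0 T := by
    rw [Set.uIcc_of_le ht.1] at hs1
    exact ⟨hs1.1, hs1.2.trans ht.2⟩
  rw [hφd, ((hs hs1 0 (by simp)).const_add (g 0)).deriv, hg s hs2]

section Scalar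

variable {𝕜 : Type*} [RCLike 𝕜]

theorem mul_sub_eq_integral_of_primitive {φ φ' : ℝ → ℝ} (hφ : ∀ t, HasDerivAt φ (φ' t) t)
    (hφ' : Continuous φ') {h g : ℝ → 𝕜} {T : ℝ} (hh : IntervalIntegrable h volume 0 T)
    (hg : ∀ t ∈ Set.Icc 0 T, g t = g 0 + ∫ s in (0 : ℝ)..t, h s) {t : ℝ}
    (ht : t ∈ Set.Icc 0 T) :
    IntervalIntegrable (fun s => (φ' s : 𝕜) * g s + (φ s : 𝕜) * h s) volume 0 t ∧
    (φ t : 𝕜) * g t - (φ 0 : 𝕜) * g 0 =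
      ∫ s in (0 : ℝ)..t, ((φ' s : 𝕜) * g s + (φ s : 𝕜) * h s) := by
  have hsub : ∀ {r : ℝ}, r ∈ Set.Icc 0 T → Set.uIcc 0 r ⊆ Set.uIcc 0 T := fun {r} hr => by
    rw [Set.uIcc_of_le hr.1, Set.uIcc_of_le (hr.1.trans hr.2)]
    exact Set.Icc_subset_Icc_right hr.2
  have hφc : Continuous φ := continuous_iff_continuousAt.mpr fun t => (hφ t).continuousAt
  have hgc : ContinuousOn g (Set.uIcc 0 T) := by
    have h1 : ContinuousOn (fun t => g 0 + ∫ s in (0 : ℝ)..t, h s) (Set.uIcc 0 T) :=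
      continuousOn_const.add
        (intervalIntegral.continuousOn_primitive_interval' hh Set.left_mem_uIcc)
    refine h1.congr fun r hr => hg r ?_
    rwa [Set.uIcc_of_le (ht.1.trans ht.2)] at hr
  have hint : IntervalIntegrable (fun s => (φ' s : 𝕜) * g s + (φ s : 𝕜) * h s) volume 0 t := by
    refine IntervalIntegrable.add ?_ ?_
    · exact (((RCLike.continuous_ofReal.comp hφ').continuousOn).mul
        (hgc.mono (hsub ht))).intervalIntegrable
    · exact (hh.mono_set (hsub ht)).continuousOn_mul
        ((RCLike.continuous_ofReal.comp hφc).continuousOn)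
  refine ⟨hint, ?_⟩
  -- Real and imaginary parts commute with multiplication by real factors, which reduces the
  -- identity to the real-valued one.
  have hcomp : ∀ (L : 𝕜 →L[ℝ] ℝ), (∀ (r : ℝ) (x : 𝕜), L ((r : 𝕜) * x) = r * L x) →
      L ((φ t : 𝕜) * g t - (φ 0 : 𝕜) * g 0) =
        L (∫ s in (0 : ℝ)..t, ((φ' s : 𝕜) * g s + (φ s : 𝕜) * h s)) := fun L hL => by
    rw [← L.intervalIntegral_comp_comm hint]
    simp only [map_sub, map_add, hL]
    refine mul_sub_eq_integral_of_primitive_real (T := T) hφ hφ'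
      (h := fun s => L (h s)) (g := fun s => L (g s))
      ⟨L.integrable_comp hh.1, L.integrable_comp hh.2⟩ (fun r hr => ?_) ht
    rw [L.intervalIntegral_comp_comm (hh.mono_set (hsub hr)), ← map_add, ← hg r hr]
  refine RCLike.ext ?_ ?_
  · exact hcomp RCLike.reCLM fun r x => by simp
  · exact hcomp RCLike.imCLM fun r x => by simp

end Scalar

section Rotation

variable {𝕜 H ι : Type*} [RCLike 𝕜] [NormedAddCommGroup H] [InnerProductSpace 𝕜 H]
  [CompleteSpace H] (b : HilbertBasis ι 𝕜 H) (μ : ι → ℝ)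

/-- `(x, z)` is a solution, continuous on `[0, T]`, of the first order system `x' = Λ z`,
`z' = -Λ x + f`, where `Λ` is the diagonal operator with entries `μ i`. -/
structure IsRot (T : ℝ) (f x z : ℝ → H) : Prop where
  cont_fst : ContinuousOn x (Set.Icc 0 T)
  cont_snd : ContinuousOn z (Set.Icc 0 T)
  eq_fst : ∀ t ∈ Set.Icc 0 T, ∀ i,
    b.repr (x t) i = b.repr (x 0) i + ∫ s in (0 : ℝ)..t, (μ i : 𝕜) * b.repr (z s) i
  eq_snd : ∀ t ∈ Set.Icc 0 T, ∀ i,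
    b.repr (z t) i = b.repr (z 0) i +
      ∫ s in (0 : ℝ)..t, (b.repr (f s) i - (μ i : 𝕜) * b.repr (x s) i)

/-- The `i`-th coordinate, as a continuous linear form. -/
noncomputable def coordL (i : ι) : H →L[𝕜] 𝕜 := innerSL 𝕜 (b i)

theorem coordL_apply (i : ι) (x : H) : coordL b i x = b.repr x i := by
  rw [b.repr_apply_apply]; rfl

theorem continuous_repr (i : ι) : Continuous fun x : H => b.repr x i := by
  simp only [← coordL_apply]
  exact (coordL b i).continuous

variable [NormedSpace ℝ H]

theorem repr_intervalIntegral {f : ℝ → H} {s t : ℝ} (hf : IntervalIntegrable f volume s t) (i : ι) :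
    b.repr (∫ r in s..t, f r) i = ∫ r in s..t, b.repr (f r) i := by
  simp only [← coordL_apply]
  exact ((coordL b i).intervalIntegral_comp_comm hf).symm

/-- The first component of the solution, rotated back to time `0`. -/
noncomputable def rotP (f : ℝ → H) (x₀ : H) (t : ℝ) : H :=
  x₀ - ∫ s in (0 : ℝ)..t, sinOp b μ s (f s)

/-- The second component of the solution, rotated back to time `0`. -/
noncomputable def rotQ (f : ℝ → H) (z₀ : H) (t : ℝ) : H :=
  z₀ + ∫ s in (0 : ℝ)..t, cosOp b μ s (f s)

/-- The first component of the solution of `x' = Λ z`, `z' = -Λ x + f`. -/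
noncomputable def rotX (f : ℝ → H) (x₀ z₀ : H) (t : ℝ) : H :=
  cosOp b μ t (rotP b μ f x₀ t) + sinOp b μ t (rotQ b μ f z₀ t)

/-- The second component of the solution of `x' = Λ z`, `z' = -Λ x + f`. -/
noncomputable def rotZ (f : ℝ → H) (x₀ z₀ : H) (t : ℝ) : H :=
  cosOp b μ t (rotQ b μ f z₀ t) - sinOp b μ t (rotP b μ f x₀ t)

@[simp] theorem rotX_zero (f : ℝ → H) (x₀ z₀ : H) : rotX b μ f x₀ z₀ 0 = x₀ := by
  simp [rotX, rotP]

@[simp] theorem rotZ_zero (f : ℝ → H) (x₀ z₀ : H) : rotZ b μ f x₀ z₀ 0 = z₀ := by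
  simp [rotZ, rotQ]

theorem norm_sq_rotX_add (f : ℝ → H) (x₀ z₀ : H) (t : ℝ) :
    ‖rotX b μ f x₀ z₀ t‖ ^ 2 + ‖rotZ b μ f x₀ z₀ t‖ ^ 2 =
      ‖rotP b μ f x₀ t‖ ^ 2 + ‖rotQ b μ f z₀ t‖ ^ 2 :=
  norm_sq_rotation b μ t _ _

theorem intervalIntegrable_op {L : ℝ → H →L[𝕜] H} (hL : Continuous fun p : ℝ × H => L p.1 p.2)
    (hle : ∀ t x, ‖L t x‖ ≤ ‖x‖) {f : ℝ → H} {s t : ℝ} (hf : IntervalIntegrable f volume s t) :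
    IntervalIntegrable (fun r => L r (f r)) volume s t := by
  refine hf.mono_fun ?_ (Filter.Eventually.of_forall fun r => hle r (f r))
  exact hL.comp_aestronglyMeasurable
    (aestronglyMeasurable_id.prodMk hf.def'.aestronglyMeasurable)

theorem intervalIntegrable_sinOp {f : ℝ → H} {s t : ℝ} (hf : IntervalIntegrable f volume s t) :
    IntervalIntegrable (fun r => sinOp b μ r (f r)) volume s t :=
  intervalIntegrable_op (continuous_sinOp b μ) (norm_sinOp_le b μ) hf

theorem intervalIntegrable_cosOp {f : ℝ → H} {s t : ℝ} (hf : IntervalIntegrable f volume s t) :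
    IntervalIntegrable (fun r => cosOp b μ r (f r)) volume s t :=
  intervalIntegrable_op (continuous_cosOp b μ) (norm_cosOp_le b μ) hf

variable {b μ}

theorem uIcc_zero_subset {t T : ℝ} (ht : t ∈ Set.Icc 0 T) : Set.uIcc 0 t ⊆ Set.uIcc 0 T := by
  rw [Set.uIcc_of_le ht.1, Set.uIcc_of_le (ht.1.trans ht.2)]
  exact Set.Icc_subset_Icc_right ht.2

/-- Each coordinate equation is multiplied by cos(μt) or sin(μt) and integrated by parts. All terms
containing μ cancel and only the source survives, so unbounded multipliers never act on vectors of
H. -/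
theorem IsRot.rotated {T : ℝ} {f x z : ℝ → H} (h : IsRot b μ T f x z)
    (hf : IntervalIntegrable f volume 0 T) {t : ℝ} (ht : t ∈ Set.Icc 0 T) :
    cosOp b μ t (x t) - sinOp b μ t (z t) = rotP b μ f (x 0) t ∧
      sinOp b μ t (x t) + cosOp b μ t (z t) = rotQ b μ f (z 0) t := by
  have hT : (0 : ℝ) ≤ T := ht.1.trans ht.2
  have hcx : ∀ i, IntervalIntegrable (fun s => (μ i : 𝕜) * b.repr (x s) i) volume 0 T := fun i =>
    (ContinuousOn.mul continuousOn_const ((continuous_repr b i).comp_continuousOn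
      (by rw [Set.uIcc_of_le hT]; exact h.cont_fst))).intervalIntegrable
  have hcz : ∀ i, IntervalIntegrable (fun s => (μ i : 𝕜) * b.repr (z s) i) volume 0 T := fun i =>
    (ContinuousOn.mul continuousOn_const ((continuous_repr b i).comp_continuousOn
      (by rw [Set.uIcc_of_le hT]; exact h.cont_snd))).intervalIntegrable
  have hcf : ∀ i, IntervalIntegrable (fun s => b.repr (f s) i - (μ i : 𝕜) * b.repr (x s) i)
      volume 0 T := fun i => by
    refine IntervalIntegrable.sub ?_ (hcx i)
    simp only [← coordL_apply]
    exact ⟨(coordL b i).integrable_comp hf.1, (coordL b i).integrable_comp hf.2⟩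
  have dcos : ∀ i t, HasDerivAt (fun t => Real.cos (μ i * t)) (-(μ i * Real.sin (μ i * t))) t :=
    fun i t => by
      have := ((hasDerivAt_id t).const_mul (μ i)).cos
      simp only [id] at this
      convert this using 1; ring
  have dsin : ∀ i t, HasDerivAt (fun t => Real.sin (μ i * t)) (μ i * Real.cos (μ i * t)) t :=
    fun i t => by
      have := ((hasDerivAt_id t).const_mul (μ i)).sin
      simp only [id] at this
      convert this using 1; ring
  have ft := hf.mono_set (uIcc_zero_subset ht)
  constructor
  · refine repr_ext b fun i => ?_
    have e1 := mul_sub_eq_integral_of_primitive (dcos i) (by fun_prop) (hcz i)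
      (fun t ht => h.eq_fst t ht i) ht
    have e2 := mul_sub_eq_integral_of_primitive (dsin i) (by fun_prop) (hcf i)
      (fun t ht => h.eq_snd t ht i) ht
    have e3 := congrArg₂ (· - ·) e1.2 e2.2
    simp only [← intervalIntegral.integral_sub e1.1 e2.1] at e3
    rw [rotP, map_sub, map_sub, lp.coeFn_sub, lp.coeFn_sub, Pi.sub_apply, Pi.sub_apply, repr_cosOp,
      repr_sinOp, repr_intervalIntegral b (intervalIntegrable_sinOp b μ ft)]
    simp only [repr_sinOp]
    have e4 : (∫ s in (0 : ℝ)..t, (((-(μ i * Real.sin (μ i * s)) : ℝ) : 𝕜) * b.repr (x s) i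
          + (Real.cos (μ i * s) : 𝕜) * ((μ i : 𝕜) * b.repr (z s) i)
          - (((μ i * Real.cos (μ i * s) : ℝ) : 𝕜) * b.repr (z s) i +
            (Real.sin (μ i * s) : 𝕜) * (b.repr (f s) i - (μ i : 𝕜) * b.repr (x s) i)))) =
        - ∫ s in (0 : ℝ)..t, (Real.sin (μ i * s) : 𝕜) * b.repr (f s) i := by
      rw [← intervalIntegral.integral_neg]
      refine intervalIntegral.integral_congr fun s _ => ?_
      simp only [RCLike.ofReal_neg, RCLike.ofReal_mul]
      ring
    rw [e4] at e3
    simp only [mul_zero, Real.cos_zero, Real.sin_zero, RCLike.ofReal_one, RCLike.ofReal_zero,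
      zero_mul, one_mul] at e3
    linear_combination e3
  · refine repr_ext b fun i => ?_
    have e1 := mul_sub_eq_integral_of_primitive (dsin i) (by fun_prop) (hcz i)
      (fun t ht => h.eq_fst t ht i) ht
    have e2 := mul_sub_eq_integral_of_primitive (dcos i) (by fun_prop) (hcf i)
      (fun t ht => h.eq_snd t ht i) ht
    have e3 := congrArg₂ (· + ·) e1.2 e2.2
    simp only [← intervalIntegral.integral_add e1.1 e2.1] at e3
    rw [rotQ, map_add, map_add, lp.coeFn_add, lp.coeFn_add, Pi.add_apply, Pi.add_apply, repr_cosOp,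
      repr_sinOp, repr_intervalIntegral b (intervalIntegrable_cosOp b μ ft)]
    simp only [repr_cosOp]
    have e4 : (∫ s in (0 : ℝ)..t, (((μ i * Real.cos (μ i * s) : ℝ) : 𝕜) * b.repr (x s) i
          + (Real.sin (μ i * s) : 𝕜) * ((μ i : 𝕜) * b.repr (z s) i)
          + (((-(μ i * Real.sin (μ i * s)) : ℝ) : 𝕜) * b.repr (z s) i +
            (Real.cos (μ i * s) : 𝕜) * (b.repr (f s) i - (μ i : 𝕜) * b.repr (x s) i)))) =
        ∫ s in (0 : ℝ)..t, (Real.cos (μ i * s) : 𝕜) * b.repr (f s) i := by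
      refine intervalIntegral.integral_congr fun s _ => ?_
      simp only [RCLike.ofReal_neg, RCLike.ofReal_mul]
      ring
    rw [e4] at e3
    simp only [mul_zero, Real.cos_zero, Real.sin_zero, RCLike.ofReal_one, RCLike.ofReal_zero,
      zero_mul, one_mul] at e3
    linear_combination e3

/-- Duhamel's formula for every solution in the integrated sense, hence uniqueness. It follows by
inverting the rotation, using cos² + sin² = 1. -/
theorem IsRot.eq_rot {T : ℝ} {f x z : ℝ → H} (h : IsRot b μ T f x z)
    (hf : IntervalIntegrable f volume 0 T) {t : ℝ} (ht : t ∈ Set.Icc 0 T) :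
    x t = rotX b μ f (x 0) (z 0) t ∧ z t = rotZ b μ f (x 0) (z 0) t := by
  obtain ⟨hp, hq⟩ := h.rotated hf ht
  constructor
  · rw [rotX, ← hp, ← hq, map_sub, map_add, cosOp_sinOp_comm]
    nth_rewrite 1 [← cos_sq_add_sin_sq_op b μ t (x t)]
    abel
  · rw [rotZ, ← hp, ← hq, map_sub, map_add, cosOp_sinOp_comm]
    nth_rewrite 1 [← cos_sq_add_sin_sq_op b μ t (z t)]
    abel

theorem IsRot.norm_sq_eq {T : ℝ} {x z : ℝ → H} (h : IsRot b μ T 0 x z) {t : ℝ}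
    (ht : t ∈ Set.Icc 0 T) : ‖x t‖ ^ 2 + ‖z t‖ ^ 2 = ‖x 0‖ ^ 2 + ‖z 0‖ ^ 2 := by
  obtain ⟨h1, h2⟩ := h.eq_rot intervalIntegrable_const ht
  rw [h1, h2, norm_sq_rotX_add]
  simp [rotP, rotQ]

theorem norm_integral_op_le {L : ℝ → H →L[𝕜] H} (hle : ∀ t x, ‖L t x‖ ≤ ‖x‖) {f : ℝ → H} {T : ℝ}
    (hf : IntervalIntegrable f volume 0 T) {t : ℝ} (ht : t ∈ Set.Icc 0 T) :
    ‖∫ s in (0 : ℝ)..t, L s (f s)‖ ≤ ∫ s in (0 : ℝ)..T, ‖f s‖ := by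
  refine (intervalIntegral.norm_integral_le_of_norm_le ht.1
    (Filter.Eventually.of_forall fun s _ => hle s (f s))
    (hf.norm.mono_set (uIcc_zero_subset ht))).trans ?_
  exact intervalIntegral.integral_mono_interval le_rfl ht.1 ht.2
    (Filter.Eventually.of_forall fun s => norm_nonneg _) hf.norm

/-- The energy estimate. -/
theorem IsRot.norm_sq_le {T : ℝ} {f x z : ℝ → H} (h : IsRot b μ T f x z)
    (hf : IntervalIntegrable f volume 0 T) {t : ℝ} (ht : t ∈ Set.Icc 0 T) :
    ‖x t‖ ^ 2 + ‖z t‖ ^ 2 ≤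
      2 * (‖x 0‖ ^ 2 + ‖z 0‖ ^ 2) + 4 * (∫ s in (0 : ℝ)..T, ‖f s‖) ^ 2 := by
  obtain ⟨h1, h2⟩ := h.eq_rot hf ht
  rw [h1, h2, norm_sq_rotX_add, rotP, rotQ]
  have i1 := norm_integral_op_le (norm_sinOp_le b μ) hf ht
  have i2 := norm_integral_op_le (norm_cosOp_le b μ) hf ht
  have n1 := norm_sub_le (x 0) (∫ s in (0 : ℝ)..t, sinOp b μ s (f s))
  have n2 := norm_add_le (z 0) (∫ s in (0 : ℝ)..t, cosOp b μ s (f s))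
  have aux : ∀ u v w c : ℝ, 0 ≤ u → u ≤ v + w → 0 ≤ w → w ≤ c → u ^ 2 ≤ 2 * v ^ 2 + 2 * c ^ 2 := by
    intro u v w c hu huv hw hwc
    have hc : w ^ 2 ≤ c ^ 2 := pow_le_pow_left₀ hw hwc 2
    have hu2 : u ^ 2 ≤ (v + w) ^ 2 := pow_le_pow_left₀ hu huv 2
    nlinarith [sq_nonneg (v - w)]
  have a1 := aux _ _ _ _ (norm_nonneg _) n1 (norm_nonneg _) i1
  have a2 := aux _ _ _ _ (norm_nonneg _) n2 (norm_nonneg _) i2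
  linarith

/-- Existence, coordinate by coordinate. The source terms cancel in the first equation and combine
through cos² + sin² = 1 in the second. -/
theorem hasDerivAt_repr_rot {f : ℝ → H} (hf : Continuous f) (x₀ z₀ : H) (i : ι) (t : ℝ) :
    HasDerivAt (fun t => b.repr (rotX b μ f x₀ z₀ t) i)
        ((μ i : 𝕜) * b.repr (rotZ b μ f x₀ z₀ t) i) t ∧
      HasDerivAt (fun t => b.repr (rotZ b μ f x₀ z₀ t) i)
        (b.repr (f t) i - (μ i : 𝕜) * b.repr (rotX b μ f x₀ z₀ t) i) t := by
  have dcos : ∀ t, HasDerivAt (fun t => (Real.cos (μ i * t) : 𝕜))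
      ((-(μ i * Real.sin (μ i * t)) : ℝ) : 𝕜) t := fun t => by
    have := ((hasDerivAt_id t).const_mul (μ i)).cos
    simp only [id] at this
    have h2 := (RCLike.ofRealCLM (K := 𝕜)).hasFDerivAt.comp_hasDerivAt t this
    simp only [RCLike.ofRealCLM_apply] at h2
    convert! h2 using 2; ring
  have dsin : ∀ t, HasDerivAt (fun t => (Real.sin (μ i * t) : 𝕜))
      ((μ i * Real.cos (μ i * t) : ℝ) : 𝕜) t := fun t => by
    have := ((hasDerivAt_id t).const_mul (μ i)).sin
    simp only [id] at this
    have h2 := (RCLike.ofRealCLM (K := 𝕜)).hasFDerivAt.comp_hasDerivAt t this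
    simp only [RCLike.ofRealCLM_apply] at h2
    convert! h2 using 2; ring
  have hfi : Continuous fun s => b.repr (f s) i := (continuous_repr b i).comp hf
  have cs : Continuous fun s => (Real.sin (μ i * s) : 𝕜) * b.repr (f s) i :=
    (RCLike.continuous_ofReal.comp (by fun_prop)).mul hfi
  have cc : Continuous fun s => (Real.cos (μ i * s) : 𝕜) * b.repr (f s) i :=
    (RCLike.continuous_ofReal.comp (by fun_prop)).mul hfi
  have hP : ∀ t, b.repr (rotP b μ f x₀ t) i =
      b.repr x₀ i - ∫ s in (0 : ℝ)..t, (Real.sin (μ i * s) : 𝕜) * b.repr (f s) i := fun t => by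
    rw [rotP, map_sub, lp.coeFn_sub, Pi.sub_apply,
      repr_intervalIntegral b (intervalIntegrable_sinOp b μ (hf.intervalIntegrable _ _))]
    simp only [repr_sinOp]
  have hQ : ∀ t, b.repr (rotQ b μ f z₀ t) i =
      b.repr z₀ i + ∫ s in (0 : ℝ)..t, (Real.cos (μ i * s) : 𝕜) * b.repr (f s) i := fun t => by
    rw [rotQ, map_add, lp.coeFn_add, Pi.add_apply,
      repr_intervalIntegral b (intervalIntegrable_cosOp b μ (hf.intervalIntegrable _ _))]
    simp only [repr_cosOp]
  have dP : HasDerivAt (fun t => b.repr (rotP b μ f x₀ t) i)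
      (-((Real.sin (μ i * t) : 𝕜) * b.repr (f t) i)) t := by
    simp only [hP]
    exact (cs.integral_hasStrictDerivAt 0 t).hasDerivAt.const_sub _
  have dQ : HasDerivAt (fun t => b.repr (rotQ b μ f z₀ t) i)
      ((Real.cos (μ i * t) : 𝕜) * b.repr (f t) i) t := by
    simp only [hQ]
    exact (cc.integral_hasStrictDerivAt 0 t).hasDerivAt.const_add _
  have hX : ∀ t, b.repr (rotX b μ f x₀ z₀ t) i = (Real.cos (μ i * t) : 𝕜) *
      b.repr (rotP b μ f x₀ t) i + (Real.sin (μ i * t) : 𝕜) * b.repr (rotQ b μ f z₀ t) i :=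
    fun t => by
      rw [rotX, map_add, lp.coeFn_add, Pi.add_apply, repr_cosOp, repr_sinOp]
  have hZ : ∀ t, b.repr (rotZ b μ f x₀ z₀ t) i = (Real.cos (μ i * t) : 𝕜) *
      b.repr (rotQ b μ f z₀ t) i - (Real.sin (μ i * t) : 𝕜) * b.repr (rotP b μ f x₀ t) i :=
    fun t => by
      rw [rotZ, map_sub, lp.coeFn_sub, Pi.sub_apply, repr_cosOp, repr_sinOp]
  have hcs : (Real.cos (μ i * t) : 𝕜) ^ 2 + (Real.sin (μ i * t) : 𝕜) ^ 2 = 1 := by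
    exact_mod_cast congrArg (RCLike.ofReal (K := 𝕜)) (Real.cos_sq_add_sin_sq (μ i * t))
  constructor
  · simp only [hX, hZ]
    convert! ((dcos t).mul dP).add ((dsin t).mul dQ) using 1
    simp only [RCLike.ofReal_neg, RCLike.ofReal_mul]
    ring
  · simp only [hX, hZ]
    convert! ((dcos t).mul dQ).sub ((dsin t).mul dP) using 1
    simp only [RCLike.ofReal_neg, RCLike.ofReal_mul]
    linear_combination (-(b.repr (f t) i)) * hcs

/-- Solutions in the classical sense, coordinate by coordinate. -/
theorem isRot_of_hasDerivAt {f x z : ℝ → H} (hf : Continuous f) (hx : Continuous x)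
    (hz : Continuous z)
    (dx : ∀ i t, HasDerivAt (fun t => b.repr (x t) i) ((μ i : 𝕜) * b.repr (z t) i) t)
    (dz : ∀ i t, HasDerivAt (fun t => b.repr (z t) i)
      (b.repr (f t) i - (μ i : 𝕜) * b.repr (x t) i) t) (T : ℝ) : IsRot b μ T f x z := by
  refine ⟨hx.continuousOn, hz.continuousOn, fun t _ i => ?_, fun t _ i => ?_⟩
  · rw [intervalIntegral.integral_eq_sub_of_hasDerivAt (fun s _ => dx i s)]
    · ring
    · exact (continuous_const.mul ((continuous_repr b i).comp hz)).intervalIntegrable _ _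
  · rw [intervalIntegral.integral_eq_sub_of_hasDerivAt (fun s _ => dz i s)]
    · ring
    · exact (((continuous_repr b i).comp hf).sub
        (continuous_const.mul ((continuous_repr b i).comp hx))).intervalIntegrable _ _

theorem continuous_op_comp {Z : Type*} [TopologicalSpace Z] {L : ℝ → H →L[𝕜] H}
    (hL : Continuous fun p : ℝ × H => L p.1 p.2) {τ : Z → ℝ} (hτ : Continuous τ) {g : Z → H}
    (hg : Continuous g) : Continuous fun y => L (τ y) (g y) :=
  hL.comp (hτ.prodMk hg)

/-- The parameter space is general because the controlled state at time θ is produced by a flow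
whose initial data, source and final time all depend on θ. -/
theorem continuous_rot {Y : Type*} [TopologicalSpace Y] [FirstCountableTopology Y]
    {f : Y → ℝ → H} (hf : Continuous f.uncurry) {x₀ z₀ : Y → H} (hx : Continuous x₀)
    (hz : Continuous z₀) {τ : Y → ℝ} (hτ : Continuous τ) :
    (Continuous fun y => rotX b μ (f y) (x₀ y) (z₀ y) (τ y)) ∧
      Continuous fun y => rotZ b μ (f y) (x₀ y) (z₀ y) (τ y) := by
  have hs : Continuous (Function.uncurry fun (y : Y) (s : ℝ) => sinOp b μ s (f y s)) :=
    continuous_op_comp (continuous_sinOp b μ) continuous_snd hf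
  have hc : Continuous (Function.uncurry fun (y : Y) (s : ℝ) => cosOp b μ s (f y s)) :=
    continuous_op_comp (continuous_cosOp b μ) continuous_snd hf
  have hP : Continuous fun y => rotP b μ (f y) (x₀ y) (τ y) :=
    hx.sub (intervalIntegral.continuous_parametric_intervalIntegral_of_continuous hs hτ)
  have hQ : Continuous fun y => rotQ b μ (f y) (z₀ y) (τ y) :=
    hz.add (intervalIntegral.continuous_parametric_intervalIntegral_of_continuous hc hτ)
  exact ⟨(continuous_op_comp (continuous_cosOp b μ) hτ hP).add
      (continuous_op_comp (continuous_sinOp b μ) hτ hQ),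
    (continuous_op_comp (continuous_cosOp b μ) hτ hQ).sub
      (continuous_op_comp (continuous_sinOp b μ) hτ hP)⟩

theorem continuous_rotX {f : ℝ → H} (hf : Continuous f) (x₀ z₀ : H) :
    Continuous (rotX b μ f x₀ z₀) :=
  (continuous_rot (f := fun _ : ℝ => f) (hf.comp continuous_snd) continuous_const continuous_const
    continuous_id).1

theorem continuous_rotZ {f : ℝ → H} (hf : Continuous f) (x₀ z₀ : H) :
    Continuous (rotZ b μ f x₀ z₀) :=
  (continuous_rot (f := fun _ : ℝ => f) (hf.comp continuous_snd) continuous_const continuous_const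
    continuous_id).2

theorem isRot_rot {f : ℝ → H} (hf : Continuous f) (x₀ z₀ : H) (T : ℝ) :
    IsRot b μ T f (rotX b μ f x₀ z₀) (rotZ b μ f x₀ z₀) :=
  isRot_of_hasDerivAt hf (continuous_rotX hf x₀ z₀) (continuous_rotZ hf x₀ z₀)
    (fun i t => (hasDerivAt_repr_rot hf x₀ z₀ i t).1)
    (fun i t => (hasDerivAt_repr_rot hf x₀ z₀ i t).2) T

/-- The translates in time of a solution are solutions. -/
theorem isRot_rot_shift {f : ℝ → H} (hf : Continuous f) (x₀ z₀ : H) (θ T : ℝ) :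
    IsRot b μ T (fun t => f (t - θ)) (fun t => rotX b μ f x₀ z₀ (t - θ))
      (fun t => rotZ b μ f x₀ z₀ (t - θ)) :=
  isRot_of_hasDerivAt (f := fun t => f (t - θ)) (x := fun t => rotX b μ f x₀ z₀ (t - θ))
    (z := fun t => rotZ b μ f x₀ z₀ (t - θ)) (hf.comp (continuous_sub_right θ))
    ((continuous_rotX hf x₀ z₀).comp (continuous_sub_right θ))
    ((continuous_rotZ hf x₀ z₀).comp (continuous_sub_right θ))
    (fun i t => HasDerivAt.comp_sub_const (f := fun t => b.repr (rotX b μ f x₀ z₀ t) i) t θ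
      (hasDerivAt_repr_rot hf x₀ z₀ i (t - θ)).1)
    (fun i t => HasDerivAt.comp_sub_const (f := fun t => b.repr (rotZ b μ f x₀ z₀ t) i) t θ
      (hasDerivAt_repr_rot hf x₀ z₀ i (t - θ)).2) T

/-- The symplectic form is invariant under rotations. -/
theorem inner_rotation (t : ℝ) (p q p' q' : H) :
    inner 𝕜 (cosOp b μ t p + sinOp b μ t q) (cosOp b μ t q' - sinOp b μ t p') -
      inner 𝕜 (cosOp b μ t q - sinOp b μ t p) (cosOp b μ t p' + sinOp b μ t q') =
      inner 𝕜 p q' - inner 𝕜 q p' := by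
  have e : ∀ u v : H, inner 𝕜 u (cosOp b μ t (cosOp b μ t v)) +
      inner 𝕜 u (sinOp b μ t (sinOp b μ t v)) = inner 𝕜 u v := fun u v => by
    rw [← inner_add_right, cos_sq_add_sin_sq_op]
  simp only [inner_add_left, inner_sub_left, inner_add_right, inner_sub_right, inner_cosOp,
    inner_sinOp, cosOp_sinOp_comm]
  linear_combination e p q' - e q p'

/-- Green's formula. -/
theorem IsRot.hasDerivAt_symplectic {T : ℝ} {f x z f' x' z' : ℝ → H} (h : IsRot b μ T f x z)
    (h' : IsRot b μ T f' x' z') (hf : ContinuousOn f (Set.Icc 0 T))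
    (hf' : ContinuousOn f' (Set.Icc 0 T)) {t : ℝ} (ht : t ∈ Set.Ioo 0 T) :
    HasDerivAt (fun t => inner 𝕜 (x t) (z' t) - inner 𝕜 (z t) (x' t))
      (inner 𝕜 (x t) (f' t) - inner 𝕜 (f t) (x' t)) t := by
  have hT : (0 : ℝ) ≤ T := (ht.1.trans ht.2).le
  have ht' := Set.Ioo_subset_Icc_self ht
  have hD : ∀ {L : ℝ → H →L[𝕜] H}, (Continuous fun p : ℝ × H => L p.1 p.2) → ∀ {g : ℝ → H},
      ContinuousOn g (Set.Icc 0 T) →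
      HasDerivAt (fun t => ∫ s in (0 : ℝ)..t, L s (g s)) (L t (g t)) t := by
    intro L hL g hg
    have hc : ContinuousOn (fun s => L s (g s)) (Set.Icc 0 T) :=
      hL.comp_continuousOn (continuousOn_id.prodMk hg)
    refine intervalIntegral.integral_hasDerivAt_right ?_ ?_ ?_
    · refine (hc.mono ?_).intervalIntegrable
      rw [Set.uIcc_of_le ht'.1]
      exact Set.Icc_subset_Icc_right ht'.2
    · exact (hc.mono Set.Ioo_subset_Icc_self).stronglyMeasurableAtFilter isOpen_Ioo t ht
    · exact hc.continuousAt (Icc_mem_nhds ht.1 ht.2)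
  have dP : ∀ (g : ℝ → H) (x₀ : H), ContinuousOn g (Set.Icc 0 T) →
      HasDerivAt (rotP b μ g x₀) (-(sinOp b μ t (g t))) t := fun g x₀ hg =>
    (hD (continuous_sinOp b μ) hg).const_sub x₀
  have dQ : ∀ (g : ℝ → H) (z₀ : H), ContinuousOn g (Set.Icc 0 T) →
      HasDerivAt (rotQ b μ g z₀) (cosOp b μ t (g t)) t := fun g x₀ hg =>
    (hD (continuous_cosOp b μ) hg).const_add x₀
  have i1 : IntervalIntegrable f volume 0 T :=
    (by rwa [Set.uIcc_of_le hT] : ContinuousOn f (Set.uIcc 0 T)).intervalIntegrable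
  have i2 : IntervalIntegrable f' volume 0 T :=
    (by rwa [Set.uIcc_of_le hT] : ContinuousOn f' (Set.uIcc 0 T)).intervalIntegrable
  have key := ((dP f (x 0) hf).inner 𝕜 (dQ f' (z' 0) hf')).sub
    ((dQ f (z 0) hf).inner 𝕜 (dP f' (x' 0) hf'))
  -- The solutions x, z need not be differentiable in H, but their back-rotated versions are. The
  -- symplectic form does not see the rotation, so it is differentiated on the latter.
  have hev : (fun t => inner 𝕜 (x t) (z' t) - inner 𝕜 (z t) (x' t)) =ᶠ[nhds t]
      fun t => inner 𝕜 (rotP b μ f (x 0) t) (rotQ b μ f' (z' 0) t) -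
        inner 𝕜 (rotQ b μ f (z 0) t) (rotP b μ f' (x' 0) t) := by
    filter_upwards [Icc_mem_nhds ht.1 ht.2] with s hs
    rw [(h.eq_rot i1 hs).1, (h.eq_rot i1 hs).2, (h'.eq_rot i2 hs).1, (h'.eq_rot i2 hs).2]
    exact inner_rotation s _ _ _ _
  refine HasDerivAt.congr_of_eventuallyEq ?_ hev
  convert! key using 1
  rw [(h.eq_rot i1 ht').1, (h'.eq_rot i2 ht').1, rotX, rotX]
  simp only [inner_add_left, inner_add_right, inner_neg_left, inner_neg_right, inner_cosOp,
    inner_sinOp]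
  ring

end Rotation

end Cascade

/-! ### Observability of the normalized cascade -/

namespace Cascade

open MeasureTheory

section CascadeObservability

variable {𝕜 H ι : Type*} [RCLike 𝕜] [NormedAddCommGroup H] [InnerProductSpace 𝕜 H]
  [CompleteSpace H] {b : HilbertBasis ι 𝕜 H} {μ : ι → ℝ} [NormedSpace ℝ H]

/-- The initial energy is controlled by the energy at time `t` and the source. -/
theorem IsRot.norm_sq_init_le {T : ℝ} {f x z : ℝ → H} (h : IsRot b μ T f x z)
    (hf : IntervalIntegrable f volume 0 T) {t : ℝ} (ht : t ∈ Set.Icc 0 T) :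
    ‖x 0‖ ^ 2 + ‖z 0‖ ^ 2 ≤
      2 * (‖x t‖ ^ 2 + ‖z t‖ ^ 2) + 4 * (∫ s in (0 : ℝ)..T, ‖f s‖) ^ 2 := by
  obtain ⟨h1, h2⟩ := h.eq_rot hf ht
  rw [h1, h2, norm_sq_rotX_add]
  have i1 := norm_integral_op_le (norm_sinOp_le b μ) hf ht
  have i2 := norm_integral_op_le (norm_cosOp_le b μ) hf ht
  have n1 : ‖x 0‖ ≤ ‖rotP b μ f (x 0) t‖ + ‖∫ s in (0 : ℝ)..t, sinOp b μ s (f s)‖ := by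
    have := norm_add_le (rotP b μ f (x 0) t) (∫ s in (0 : ℝ)..t, sinOp b μ s (f s))
    rwa [rotP, sub_add_cancel, ← rotP] at this
  have n2 : ‖z 0‖ ≤ ‖rotQ b μ f (z 0) t‖ + ‖∫ s in (0 : ℝ)..t, cosOp b μ s (f s)‖ := by
    have := norm_sub_le (rotQ b μ f (z 0) t) (∫ s in (0 : ℝ)..t, cosOp b μ s (f s))
    rwa [rotQ, add_sub_cancel_right, ← rotQ] at this
  have aux : ∀ u v w c : ℝ, 0 ≤ u → u ≤ v + w → 0 ≤ w → w ≤ c → u ^ 2 ≤ 2 * v ^ 2 + 2 * c ^ 2 := by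
    intro u v w c hu huv hw hwc
    have hc : w ^ 2 ≤ c ^ 2 := pow_le_pow_left₀ hw hwc 2
    have hu2 : u ^ 2 ≤ (v + w) ^ 2 := pow_le_pow_left₀ hu huv 2
    nlinarith [sq_nonneg (v - w)]
  have a1 := aux _ _ _ _ (norm_nonneg _) n1 (norm_nonneg _) i1
  have a2 := aux _ _ _ _ (norm_nonneg _) n2 (norm_nonneg _) i2
  linarith

variable {T : ℝ} {D : H →L[𝕜] H} {x₁ z₁ x₂ z₂ : ℝ → H}

/-- The key estimate: a function whose derivative is small, and which varies much, cannot be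
small in the mean. -/
theorem cube_le_of_hasDerivAt {X i : ℝ → ℝ} (hT : 0 ≤ T) (hX : ContinuousOn X (Set.Icc 0 T))
    (hi : ContinuousOn i (Set.Icc 0 T)) (hd : ∀ t ∈ Set.Ioo 0 T, HasDerivAt X (-i t) t)
    (hi0 : ∀ t ∈ Set.Icc 0 T, 0 ≤ i t) {M : ℝ} (hM : ∀ t ∈ Set.Icc 0 T, i t ≤ M) {K : ℝ}
    {e : ℝ → ℝ} (he : ContinuousOn e (Set.Icc 0 T)) (hXe : ∀ t ∈ Set.Icc 0 T, X t ^ 2 ≤ K * e t) :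
    (∫ t in (0 : ℝ)..T, i t) ^ 3 ≤ 12 * M * K * ∫ t in (0 : ℝ)..T, e t := by
  have hu := Set.uIcc_of_le hT
  have ii : IntervalIntegrable i volume 0 T := ContinuousOn.intervalIntegrable (by rwa [hu])
  have ie : IntervalIntegrable e volume 0 T := ContinuousOn.intervalIntegrable (by rwa [hu])
  have e1 := intervalIntegral.integral_eq_sub_of_hasDerivAt_of_le hT hX hd ii.neg
  have i3 : IntervalIntegrable (fun t => 3 * X t ^ 2 * -i t) volume 0 T :=
    ContinuousOn.intervalIntegrable
      (by rw [hu]; exact (continuousOn_const.mul (hX.pow 2)).mul hi.neg)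
  -- The cube is the suitable power: its derivative contains X², which is what `hXe` bounds by the
  -- energy.
  have e2 := intervalIntegral.integral_eq_sub_of_hasDerivAt_of_le hT (f := fun t => X t ^ 3)
    (f' := fun t => 3 * X t ^ 2 * -i t) (hX.pow 3)
    (fun t ht => by
      have h := (hd t ht).pow 3
      simp only [Nat.cast_ofNat, Nat.add_one_sub_one] at h
      exact h) i3
  have e3 : -∫ t in (0 : ℝ)..T, 3 * X t ^ 2 * -i t ≤ ∫ t in (0 : ℝ)..T, 3 * M * K * e t := by
    rw [← intervalIntegral.integral_neg]
    refine intervalIntegral.integral_mono_on hT i3.neg (ie.const_mul _) fun t ht => ?_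
    have h1 := hXe t ht
    have h2 := hM t ht
    have h3 := hi0 t ht
    have h4 : X t ^ 2 * i t ≤ K * e t * M := mul_le_mul h1 h2 h3 ((sq_nonneg _).trans h1)
    linarith
  rw [intervalIntegral.integral_const_mul] at e3
  rw [intervalIntegral.integral_neg] at e1
  have hI : 0 ≤ ∫ t in (0 : ℝ)..T, i t := intervalIntegral.integral_nonneg hT hi0
  set I := ∫ t in (0 : ℝ)..T, i t
  have h5 : X T = X 0 - I := by linarith
  rw [h5] at e2
  -- With p = X 0, q = X T and p - q = I ≥ 0: p³ - q³ = I³/4 + (3/4) I (p + q)², and p + q = 2 X 0 -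
  -- I.
  nlinarith [mul_nonneg hI (sq_nonneg (2 * X 0 - I))]

/-- Weakly coupled estimate: the coupling integral is controlled by the energy of the second
component. -/
theorem coupling_cube_le (h₁ : IsRot b μ T 0 x₁ z₁) (h₂ : IsRot b μ T (fun t => -D (x₁ t)) x₂ z₂)
    (hT : 0 ≤ T) (hD : ∀ w, 0 ≤ RCLike.re (inner 𝕜 (D w) w)) :
    (∫ t in (0 : ℝ)..T, RCLike.re (inner 𝕜 (D (x₁ t)) (x₁ t))) ^ 3 ≤
      24 * ‖D‖ * (‖x₁ 0‖ ^ 2 + ‖z₁ 0‖ ^ 2) ^ 2 *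
        ∫ t in (0 : ℝ)..T, (‖x₂ t‖ ^ 2 + ‖z₂ t‖ ^ 2) / 2 := by
  have hDx : ContinuousOn (fun t => D (x₁ t)) (Set.Icc 0 T) :=
    D.continuous.comp_continuousOn h₁.cont_fst
  have hr := RCLike.continuous_re (K := 𝕜)
  have key := cube_le_of_hasDerivAt (T := T)
    (X := fun t => RCLike.re (inner 𝕜 (x₁ t) (z₂ t) - inner 𝕜 (z₁ t) (x₂ t)))
    (i := fun t => RCLike.re (inner 𝕜 (D (x₁ t)) (x₁ t)))
    (M := ‖D‖ * (‖x₁ 0‖ ^ 2 + ‖z₁ 0‖ ^ 2)) (K := 2 * (‖x₁ 0‖ ^ 2 + ‖z₁ 0‖ ^ 2))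
    (e := fun t => (‖x₂ t‖ ^ 2 + ‖z₂ t‖ ^ 2) / 2) hT
    (hr.comp_continuousOn ((h₁.cont_fst.inner (𝕜 := 𝕜) h₂.cont_snd).sub (h₁.cont_snd.inner (𝕜 := 𝕜) h₂.cont_fst)))
    (hr.comp_continuousOn (hDx.inner (𝕜 := 𝕜) h₁.cont_fst)) ?_ (fun t _ => hD _) ?_
    (((h₂.cont_fst.norm.pow 2).add (h₂.cont_snd.norm.pow 2)).div_const 2) ?_
  · linarith
  · intro t ht
    have h := h₁.hasDerivAt_symplectic h₂ continuousOn_const hDx.neg ht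
    have h2 := (RCLike.reCLM (K := 𝕜)).hasFDerivAt.comp_hasDerivAt t h
    convert! h2 using 1
    simp only [inner_neg_right, Pi.zero_apply, inner_zero_left, sub_zero, RCLike.reCLM_apply, map_neg]
    rw [inner_re_symm]
  · intro t ht
    have h := h₁.norm_sq_eq ht
    calc RCLike.re (inner 𝕜 (D (x₁ t)) (x₁ t)) ≤ ‖D (x₁ t)‖ * ‖x₁ t‖ := re_inner_le_norm _ _
      _ ≤ ‖D‖ * ‖x₁ t‖ * ‖x₁ t‖ := by gcongr; exact D.le_opNorm _
      _ = ‖D‖ * ‖x₁ t‖ ^ 2 := by ring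
      _ ≤ _ := by gcongr; nlinarith [sq_nonneg ‖z₁ t‖]
  · intro t ht
    have h := h₁.norm_sq_eq ht
    have h1 : |RCLike.re (inner 𝕜 (x₁ t) (z₂ t) - inner 𝕜 (z₁ t) (x₂ t))| ≤
        ‖x₁ t‖ * ‖z₂ t‖ + ‖z₁ t‖ * ‖x₂ t‖ :=
      (RCLike.abs_re_le_norm _).trans ((norm_sub_le _ _).trans
        (add_le_add (norm_inner_le_norm _ _) (norm_inner_le_norm _ _)))
    have h2 : |RCLike.re (inner 𝕜 (x₁ t) (z₂ t) - inner 𝕜 (z₁ t) (x₂ t))| ^ 2 ≤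
        (‖x₁ t‖ * ‖z₂ t‖ + ‖z₁ t‖ * ‖x₂ t‖) ^ 2 := pow_le_pow_left₀ (abs_nonneg _) h1 2
    rw [sq_abs] at h2
    rw [← h]
    -- Cauchy–Schwarz in the plane; the square supplied is the defect in Lagrange's identity.
    nlinarith [sq_nonneg (‖x₁ t‖ * ‖x₂ t‖ - ‖z₁ t‖ * ‖z₂ t‖)]

/-- The arithmetic of the absorption, with I the coupling integral, S the integrated energy of the
second pair, E the energy of the first, N the squared source norm and Φ the squared observation
norm. The bound `h2` on E turns the cubic inequality `h1` into a linear bound of I by S with a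
factor T⁻². For T > T₁ the source term is at most (96/256) S ≤ S/2. -/
theorem energy_le_of_cube_le {α β γ a₀ T E I S N Φ η : ℝ} (hα : 0 < α) (hβ : 0 ≤ β) (hγ : 0 < γ)
    (ha₀ : 0 < a₀) (hT : 0 < T) (hTT : √(2 * 128 * a₀) * β * γ / α < T) (hI : 0 ≤ I) (hS : 0 ≤ S)
    (hE : 0 ≤ E)
    (h1 : I ^ 3 ≤ 24 * β * (2 * E) ^ 2 * S) (h2 : T * E * α ≤ γ * I) (h3 : N ≤ β * I)
    (h4 : S - a₀ * N ≤ η * Φ) :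
    S ≤ 2 * η * Φ ∧ E ≤ 96 * β * γ ^ 3 / (α ^ 3 * T ^ 3) * S := by
  have h5 : α ^ 2 * T ^ 2 * I ≤ 96 * β * γ ^ 2 * S := by
    -- The factor I² is cancelled below, so I = 0 is treated apart.
    rcases hI.eq_or_lt with h0 | hpos
    · rw [← h0, mul_zero]; positivity
    · have h6 : (T * E * α) ^ 2 ≤ (γ * I) ^ 2 := pow_le_pow_left₀ (by positivity) h2 2
      have h7 : (α ^ 2 * T ^ 2 * I) * I ^ 2 ≤ (96 * β * γ ^ 2 * S) * I ^ 2 := by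
        calc (α ^ 2 * T ^ 2 * I) * I ^ 2 = α ^ 2 * T ^ 2 * I ^ 3 := by ring
          _ ≤ α ^ 2 * T ^ 2 * (24 * β * (2 * E) ^ 2 * S) := by gcongr
          _ = 96 * β * S * (T * E * α) ^ 2 := by ring
          _ ≤ 96 * β * S * (γ * I) ^ 2 := by gcongr
          _ = _ := by ring
      exact le_of_mul_le_mul_right h7 (by positivity)
  constructor
  · have h6 : √(2 * 128 * a₀) * β * γ ≤ T * α := by
      rw [div_lt_iff₀ hα] at hTT; exact hTT.le
    have h7 : (√(2 * 128 * a₀) * β * γ) ^ 2 ≤ (T * α) ^ 2 := pow_le_pow_left₀ (by positivity) h6 2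
    have h8 : (√(2 * 128 * a₀) * β * γ) ^ 2 = 256 * a₀ * β ^ 2 * γ ^ 2 := by
      rw [mul_pow, mul_pow, Real.sq_sqrt (by positivity)]; ring
    rw [h8] at h7
    have h9 : (T * α) ^ 2 * (a₀ * (β * I)) ≤ (T * α) ^ 2 * (S / 2) := by
      calc (T * α) ^ 2 * (a₀ * (β * I)) = a₀ * β * (α ^ 2 * T ^ 2 * I) := by ring
        _ ≤ a₀ * β * (96 * β * γ ^ 2 * S) := by gcongr
        _ = 96 / 256 * S * (256 * a₀ * β ^ 2 * γ ^ 2) := by ring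
        _ ≤ 96 / 256 * S * (T * α) ^ 2 := by gcongr
        _ ≤ _ := by nlinarith [mul_nonneg hS (sq_nonneg (T * α))]
    have h10 := le_of_mul_le_mul_left h9 (by positivity)
    have h11 : a₀ * N ≤ a₀ * (β * I) := by gcongr
    linarith
  · rw [div_mul_eq_mul_div, le_div_iff₀ (by positivity)]
    calc E * (α ^ 3 * T ^ 3) = (T * E * α) * (α ^ 2 * T ^ 2) := by ring
      _ ≤ γ * I * (α ^ 2 * T ^ 2) := by gcongr
      _ = γ * (α ^ 2 * T ^ 2 * I) := by ring
      _ ≤ γ * (96 * β * γ ^ 2 * S) := by gcongr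
      _ = _ := by ring

/-- Observability of the cascade system, for a time larger than the minimal time. -/
theorem cascade_observability (P : H →L[𝕜] H) {α γ a₀ η : ℝ} (hα : 0 < α) (hγ : 0 < γ)
    (ha₀ : 0 < a₀) (hη : 0 < η) (hT : 0 < T) (hTT : √(2 * 128 * a₀) * ‖D‖ * γ / α < T)
    (hsq : ∀ w, ‖D w‖ ^ 2 ≤ ‖D‖ * RCLike.re (inner 𝕜 (D w) w))
    (hco : ∀ w, α * ‖P w‖ ^ 2 ≤ RCLike.re (inner 𝕜 (D w) w)) :
    ∃ K : ℝ, 0 < K ∧ ∀ (x₁ z₁ x₂ z₂ : ℝ → H) (Φ : ℝ), IsRot b μ T 0 x₁ z₁ →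
      IsRot b μ T (fun t => -D (x₁ t)) x₂ z₂ →
      T * ((‖x₁ 0‖ ^ 2 + ‖z₁ 0‖ ^ 2) / 2) ≤ γ * ∫ t in (0 : ℝ)..T, ‖P (x₁ t)‖ ^ 2 →
      (∫ t in (0 : ℝ)..T, (‖x₂ t‖ ^ 2 + ‖z₂ t‖ ^ 2) / 2) -
        a₀ * (∫ t in (0 : ℝ)..T, ‖D (x₁ t)‖ ^ 2) ≤ η * Φ →
      ‖x₁ 0‖ ^ 2 + ‖z₁ 0‖ ^ 2 + ‖x₂ 0‖ ^ 2 + ‖z₂ 0‖ ^ 2 ≤ K * Φ := by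
  set β := ‖D‖ with hβ
  have hβ0 : 0 ≤ β := norm_nonneg _
  have hu := Set.uIcc_of_le hT.le
  set K₁ := 96 * β * γ ^ 3 / (α ^ 3 * T ^ 3)
  have hK₁ : 0 ≤ K₁ := by positivity
  refine ⟨(2 * K₁ + (4 / T + 8 * T ^ 2 * β ^ 2 * K₁)) * (2 * η), by positivity, ?_⟩
  intro x₁ z₁ x₂ z₂ Φ h₁ h₂ hc hobs
  have hDre : ∀ w, 0 ≤ RCLike.re (inner 𝕜 (D w) w) := fun w =>
    (by positivity : 0 ≤ α * ‖P w‖ ^ 2).trans (hco w)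
  have hDx : ContinuousOn (fun t => D (x₁ t)) (Set.Icc 0 T) :=
    D.continuous.comp_continuousOn h₁.cont_fst
  have ci : ContinuousOn (fun t => RCLike.re (inner 𝕜 (D (x₁ t)) (x₁ t))) (Set.Icc 0 T) :=
    RCLike.continuous_re.comp_continuousOn (hDx.inner (𝕜 := 𝕜) h₁.cont_fst)
  have ii : IntervalIntegrable (fun t => RCLike.re (inner 𝕜 (D (x₁ t)) (x₁ t))) volume 0 T :=
    ContinuousOn.intervalIntegrable (by rwa [hu])
  have iP : IntervalIntegrable (fun t => ‖P (x₁ t)‖ ^ 2) volume 0 T :=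
    ContinuousOn.intervalIntegrable
      (by rw [hu]; exact (P.continuous.comp_continuousOn h₁.cont_fst).norm.pow 2)
  have iD : IntervalIntegrable (fun t => ‖D (x₁ t)‖ ^ 2) volume 0 T :=
    ContinuousOn.intervalIntegrable (by rw [hu]; exact hDx.norm.pow 2)
  have iF : IntervalIntegrable (fun t => -D (x₁ t)) volume 0 T :=
    ContinuousOn.intervalIntegrable (by rw [hu]; exact hDx.neg)
  have ie : IntervalIntegrable (fun t => (‖x₂ t‖ ^ 2 + ‖z₂ t‖ ^ 2) / 2) volume 0 T :=
    ContinuousOn.intervalIntegrable (by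
      rw [hu]; exact ((h₂.cont_fst.norm.pow 2).add (h₂.cont_snd.norm.pow 2)).div_const 2)
  have hI : 0 ≤ ∫ t in (0 : ℝ)..T, RCLike.re (inner 𝕜 (D (x₁ t)) (x₁ t)) :=
    intervalIntegral.integral_nonneg hT.le fun t _ => hDre _
  have hS : 0 ≤ ∫ t in (0 : ℝ)..T, (‖x₂ t‖ ^ 2 + ‖z₂ t‖ ^ 2) / 2 :=
    intervalIntegral.integral_nonneg hT.le fun t _ => by positivity
  have c1 := coupling_cube_le h₁ h₂ hT.le hDre
  have c2 : α * (∫ t in (0 : ℝ)..T, ‖P (x₁ t)‖ ^ 2) ≤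
      ∫ t in (0 : ℝ)..T, RCLike.re (inner 𝕜 (D (x₁ t)) (x₁ t)) := by
    rw [← intervalIntegral.integral_const_mul]
    exact intervalIntegral.integral_mono_on hT.le (iP.const_mul α) ii fun t _ => hco _
  have c3 : (∫ t in (0 : ℝ)..T, ‖D (x₁ t)‖ ^ 2) ≤
      β * ∫ t in (0 : ℝ)..T, RCLike.re (inner 𝕜 (D (x₁ t)) (x₁ t)) := by
    rw [← intervalIntegral.integral_const_mul]
    exact intervalIntegral.integral_mono_on hT.le iD (ii.const_mul β) fun t _ => hsq _
  set I := ∫ t in (0 : ℝ)..T, RCLike.re (inner 𝕜 (D (x₁ t)) (x₁ t))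
  set S := ∫ t in (0 : ℝ)..T, (‖x₂ t‖ ^ 2 + ‖z₂ t‖ ^ 2) / 2 with hSdef
  set E := (‖x₁ 0‖ ^ 2 + ‖z₁ 0‖ ^ 2) / 2 with hEdef
  have hE : 0 ≤ E := by positivity
  have c4 : T * E * α ≤ γ * I := by
    calc T * E * α ≤ γ * (∫ t in (0 : ℝ)..T, ‖P (x₁ t)‖ ^ 2) * α := by gcongr
      _ = γ * (α * ∫ t in (0 : ℝ)..T, ‖P (x₁ t)‖ ^ 2) := by ring
      _ ≤ γ * I := by gcongr
  have hE2 : ‖x₁ 0‖ ^ 2 + ‖z₁ 0‖ ^ 2 = 2 * E := by rw [hEdef]; ring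
  rw [hE2] at c1
  obtain ⟨d1, d2⟩ := energy_le_of_cube_le hα hβ0 hγ ha₀ hT hTT hI hS hE c1 c4 c3 hobs
  -- the initial energy of the second component
  have n1 : (∫ s in (0 : ℝ)..T, ‖-D (x₁ s)‖) ^ 2 ≤ (T * β) ^ 2 * (2 * E) := by
    have h0 : ∀ s ∈ Set.Icc 0 T, ‖-D (x₁ s)‖ ≤ β * √(2 * E) := fun s hs => by
      rw [norm_neg]
      refine (D.le_opNorm _).trans ?_
      gcongr
      refine Real.le_sqrt_of_sq_le ?_
      rw [← hE2, ← h₁.norm_sq_eq hs]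
      nlinarith [sq_nonneg ‖z₁ s‖]
    have h1 : (∫ s in (0 : ℝ)..T, ‖-D (x₁ s)‖) ≤ T * β * √(2 * E) := by
      refine (intervalIntegral.integral_mono_on hT.le iF.norm intervalIntegrable_const h0).trans ?_
      rw [intervalIntegral.integral_const, smul_eq_mul]
      linarith
    calc (∫ s in (0 : ℝ)..T, ‖-D (x₁ s)‖) ^ 2 ≤ (T * β * √(2 * E)) ^ 2 :=
          pow_le_pow_left₀ (intervalIntegral.integral_nonneg hT.le fun _ _ => norm_nonneg _) h1 2
      _ = _ := by rw [mul_pow _ (√(2 * E)), Real.sq_sqrt (by positivity)]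
  -- The initial energy is bounded by the energy at each time t plus the source; averaging over t
  -- brings in S.
  have n2 : T * (‖x₂ 0‖ ^ 2 + ‖z₂ 0‖ ^ 2) ≤ 4 * S + T * (4 * ((T * β) ^ 2 * (2 * E))) := by
    have h0 : ∀ t ∈ Set.Icc 0 T, ‖x₂ 0‖ ^ 2 + ‖z₂ 0‖ ^ 2 ≤
        4 * ((‖x₂ t‖ ^ 2 + ‖z₂ t‖ ^ 2) / 2) + 4 * ((T * β) ^ 2 * (2 * E)) := fun t ht => by
      have := h₂.norm_sq_init_le iF ht
      linarith
    have h1 := intervalIntegral.integral_mono_on hT.le intervalIntegrable_const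
      ((ie.const_mul 4).add intervalIntegrable_const) h0
    rw [intervalIntegral.integral_add (ie.const_mul 4) intervalIntegrable_const,
      intervalIntegral.integral_const_mul, intervalIntegral.integral_const,
      intervalIntegral.integral_const, smul_eq_mul, smul_eq_mul, sub_zero] at h1
    exact h1
  have n3 : ‖x₂ 0‖ ^ 2 + ‖z₂ 0‖ ^ 2 ≤ 4 / T * S + 8 * T ^ 2 * β ^ 2 * E := by
    refine le_of_mul_le_mul_left ?_ hT
    calc _ ≤ _ := n2
      _ = _ := by field_simp; ring
  calc ‖x₁ 0‖ ^ 2 + ‖z₁ 0‖ ^ 2 + ‖x₂ 0‖ ^ 2 + ‖z₂ 0‖ ^ 2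
      ≤ 2 * E + (4 / T * S + 8 * T ^ 2 * β ^ 2 * E) := by linarith
    _ ≤ 2 * (K₁ * S) + (4 / T * S + 8 * T ^ 2 * β ^ 2 * (K₁ * S)) := by gcongr
    _ = (2 * K₁ + (4 / T + 8 * T ^ 2 * β ^ 2 * K₁)) * S := by ring
    _ ≤ (2 * K₁ + (4 / T + 8 * T ^ 2 * β ^ 2 * K₁)) * (2 * η * Φ) := by gcongr
    _ = _ := by ring

end CascadeObservability

end Cascade

/-! ### From the scale H_s to normalized coordinates; observations in the sense of distributions -/

namespace Cascade

open MeasureTheory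
open scoped ContDiff

section Scale

variable {𝕜 H : Type*} [RCLike 𝕜] [NormedAddCommGroup H] [InnerProductSpace 𝕜 H] [CompleteSpace H]
  {A : H →ₗ.[𝕜] H} {hA : WaveOperator A}

theorem weight_add (s r : ℤ) (i : Idx hA) : weight hA (s + r) i = weight hA s i * weight hA r i := by
  unfold weight
  rw [← Real.rpow_add (eigenbasis_spec hA i).1]
  push_cast
  ring_nf

theorem weight_one_mul_self (i : Idx hA) : weight hA 1 i * weight hA 1 i = eigenval hA i := by
  rw [← weight_add]
  unfold weight
  norm_num

theorem coeff_add {s : ℤ} (x y : Hs hA s) (i : Idx hA) : (x + y).coeff i = x.coeff i + y.coeff i :=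
  rfl

theorem coeff_smul {s : ℤ} (c : 𝕜) (x : Hs hA s) (i : Idx hA) : (c • x).coeff i = c * x.coeff i :=
  rfl

theorem coeff_sub {s : ℤ} (x y : Hs hA s) (i : Idx hA) : (x - y).coeff i = x.coeff i - y.coeff i :=
  rfl

theorem coeff_ext {s : ℤ} {x y : Hs hA s} (h : ∀ i, x.coeff i = y.coeff i) : x = y :=
  Subtype.ext (funext h)

theorem coeff_eq_repr {s : ℤ} (x : Hs hA s) (i : Idx hA) :
    x.coeff i = (weight hA s i : 𝕜)⁻¹ * (eigenbasis hA).repr (Apow hA s x) i := by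
  rw [repr_Apow, inv_mul_cancel_left₀ (weight_ne_zero hA s i)]

theorem continuousOn_of_Apow {s : ℤ} {u : Set ℝ} {w : ℝ → Hs hA s}
    (h : ContinuousOn (fun t => Apow hA s (w t)) u) : ContinuousOn w u := by
  have := (Apow hA s).symm.continuous.comp_continuousOn h
  exact this.congr fun t _ => by simp

/-- The wave equation, as a first order system in the space `H`. -/
theorem isRot_iff_solvesWave {a c : ℤ} (hac : a = c + 1) {T : ℝ} {w : ℝ → Hs hA a}
    {z : ℝ → Hs hA c} {f : ℝ → H} {F : ℝ → Idx hA → 𝕜}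
    (hF : ∀ t ∈ Set.Icc 0 T, ∀ i, (eigenbasis hA).repr (f t) i = (weight hA c i : 𝕜) * F t i) :
    IsRot (eigenbasis hA) (weight hA 1) T f (fun t => Apow hA a (w t)) (fun t => Apow hA c (z t)) ↔
      ContinuousOn w (Set.Icc 0 T) ∧ ContinuousOn z (Set.Icc 0 T) ∧
        SolvesWave T F (fun t => (w t).coeff) (fun t => (z t).coeff) := by
  have hw : ∀ i, (weight hA a i : 𝕜) = (weight hA c i : 𝕜) * (weight hA 1 i : 𝕜) := fun i => by
    rw [hac, weight_add, RCLike.ofReal_mul]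
  have e1 : ∀ t, t ∈ Set.Icc 0 T → ∀ i, ((eigenbasis hA).repr (Apow hA a (w t)) i =
      (eigenbasis hA).repr (Apow hA a (w 0)) i +
        ∫ s in (0 : ℝ)..t, (weight hA 1 i : 𝕜) * (eigenbasis hA).repr (Apow hA c (z s)) i) ↔
      (w t).coeff i = (w 0).coeff i + ∫ s in (0 : ℝ)..t, (z s).coeff i := by
    intro t ht i
    have : ∀ s, (weight hA 1 i : 𝕜) * (eigenbasis hA).repr (Apow hA c (z s)) i =
        (weight hA a i : 𝕜) * (z s).coeff i := fun s => by rw [repr_Apow, hw]; ring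
    simp only [this, intervalIntegral.integral_const_mul]
    rw [repr_Apow, repr_Apow, ← mul_add]
    exact mul_right_inj' (weight_ne_zero hA a i)
  have e2 : ∀ t, t ∈ Set.Icc 0 T → ∀ i, ((eigenbasis hA).repr (Apow hA c (z t)) i =
      (eigenbasis hA).repr (Apow hA c (z 0)) i +
        ∫ s in (0 : ℝ)..t, ((eigenbasis hA).repr (f s) i -
          (weight hA 1 i : 𝕜) * (eigenbasis hA).repr (Apow hA a (w s)) i)) ↔
      (z t).coeff i = (z 0).coeff i +
        ∫ s in (0 : ℝ)..t, (F s i - (eigenval hA i : 𝕜) * (w s).coeff i) := by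
    intro t ht i
    have : (∫ s in (0 : ℝ)..t, ((eigenbasis hA).repr (f s) i -
          (weight hA 1 i : 𝕜) * (eigenbasis hA).repr (Apow hA a (w s)) i)) =
        (weight hA c i : 𝕜) * ∫ s in (0 : ℝ)..t, (F s i - (eigenval hA i : 𝕜) * (w s).coeff i) := by
      rw [← intervalIntegral.integral_const_mul]
      refine intervalIntegral.integral_congr fun s hs => ?_
      rw [Set.uIcc_of_le ht.1] at hs
      simp only
      rw [hF s ⟨hs.1, hs.2.trans ht.2⟩, repr_Apow, hw, ← weight_one_mul_self, RCLike.ofReal_mul]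
      ring
    rw [this, repr_Apow, repr_Apow, ← mul_add]
    exact mul_right_inj' (weight_ne_zero hA c i)
  constructor
  · intro h
    exact ⟨continuousOn_of_Apow h.cont_fst, continuousOn_of_Apow h.cont_snd,
      fun t ht i => ⟨(e1 t ht i).1 (h.eq_fst t ht i), (e2 t ht i).1 (h.eq_snd t ht i)⟩⟩
  · rintro ⟨h1, h2, h3⟩
    exact ⟨(Apow hA a).continuous.comp_continuousOn h1, (Apow hA c).continuous.comp_continuousOn h2,
      fun t ht i => (e1 t ht i).2 (h3 t ht i).1, fun t ht i => (e2 t ht i).2 (h3 t ht i).2⟩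

theorem IsWave.isRot {k : ℤ} {T : ℝ} {f : ℝ → Hs hA k} {w0 : Hs hA (k + 1)} {w1 : Hs hA k}
    {w : ℝ → Hs hA (k + 1)} {z : ℝ → Hs hA k} (h : IsWave k T f w0 w1 w z) :
    IsRot (eigenbasis hA) (weight hA 1) T (fun t => Apow hA k (f t))
      (fun t => Apow hA (k + 1) (w t)) (fun t => Apow hA k (z t)) :=
  (isRot_iff_solvesWave rfl fun t _ i => repr_Apow hA k (f t) i).2
    ⟨h.continuousOn, h.continuousOn_deriv, h.solves⟩

theorem isWave_of_isRot {k : ℤ} {T : ℝ} {f x z : ℝ → H}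
    (h : IsRot (eigenbasis hA) (weight hA 1) T f x z) :
    IsWave k T (fun t => (Apow hA k).symm (f t)) ((Apow hA (k + 1)).symm (x 0))
      ((Apow hA k).symm (z 0)) (fun t => (Apow hA (k + 1)).symm (x t))
      (fun t => (Apow hA k).symm (z t)) := by
  have h2 := (isRot_iff_solvesWave (hA := hA) (a := k + 1) (c := k) rfl (T := T)
    (w := fun t => (Apow hA (k + 1)).symm (x t)) (z := fun t => (Apow hA k).symm (z t)) (f := f)
    (F := fun t => ((Apow hA k).symm (f t)).coeff) fun t _ i => by
      rw [← repr_Apow, LinearIsometryEquiv.apply_symm_apply]).1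
    (by simpa only [LinearIsometryEquiv.apply_symm_apply] using h)
  exact ⟨h2.1, h2.2.1, rfl, rfl, h2.2.2⟩

theorem energy_eq {k : ℤ} (w : Hs hA (k + 1)) (z : Hs hA k) :
    energy w z = (‖Apow hA (k + 1) w‖ ^ 2 + ‖Apow hA k z‖ ^ 2) / 2 := by
  rw [energy, LinearIsometryEquiv.norm_map, LinearIsometryEquiv.norm_map]

theorem energy_nonneg {k : ℤ} (w : Hs hA (k + 1)) (z : Hs hA k) : 0 ≤ energy w z := by
  unfold energy; positivity

end Scale

section SquareIntegrable

variable {E : Type*} [NormedAddCommGroup E] {T : ℝ}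

theorem ContinuousOn.l2On {f : ℝ → E} (hf : ContinuousOn f (Set.Icc 0 T)) : L2On T f := by
  have h1 : AEStronglyMeasurable f (volume.restrict (Set.Ioo 0 T)) :=
    hf.aestronglyMeasurable_of_subset_isCompact isCompact_Icc
      measurableSet_Ioo Set.Ioo_subset_Icc_self
  obtain ⟨C, hC⟩ := isCompact_Icc.exists_bound_of_continuousOn hf
  refine MemLp.of_bound h1 C ?_
  filter_upwards [ae_restrict_mem measurableSet_Ioo] with t ht
  exact hC t (Set.Ioo_subset_Icc_self ht)

theorem L2On.intervalIntegrable {f : ℝ → E} (hf : L2On T f) (hT : 0 ≤ T) :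
    IntervalIntegrable f volume 0 T := by
  rw [intervalIntegrable_iff_integrableOn_Ioo_of_le hT]
  exact hf.integrable (by norm_num)

theorem L2On.intervalIntegrable_sq {f : ℝ → E} (hf : L2On T f) (hT : 0 ≤ T) :
    IntervalIntegrable (fun t => ‖f t‖ ^ 2) volume 0 T := by
  rw [intervalIntegrable_iff_integrableOn_Ioo_of_le hT]
  exact (memLp_two_iff_integrable_sq_norm hf.1).1 hf

theorem sq_integral_le {f : ℝ → E} (hf : L2On T f) (hT : 0 < T) :
    (∫ t in (0 : ℝ)..T, ‖f t‖) ^ 2 ≤ T * ∫ t in (0 : ℝ)..T, ‖f t‖ ^ 2 := by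
  have i1 := (hf.intervalIntegrable hT.le).norm
  have i2 := hf.intervalIntegrable_sq hT.le
  set m := (∫ t in (0 : ℝ)..T, ‖f t‖) with hm
  -- Cauchy–Schwarz as nonnegativity of the variance of ‖f‖ about its mean m / T.
  have h : 0 ≤ ∫ t in (0 : ℝ)..T, (‖f t‖ ^ 2 - 2 * (m / T) * ‖f t‖ + (m / T) ^ 2) :=
    intervalIntegral.integral_nonneg hT.le fun t _ => by nlinarith [sq_nonneg (‖f t‖ - m / T)]
  rw [intervalIntegral.integral_add (i2.sub (i1.const_mul _)) intervalIntegrable_const,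
    intervalIntegral.integral_sub i2 (i1.const_mul _), intervalIntegral.integral_const_mul, ← hm,
    intervalIntegral.integral_const, smul_eq_mul] at h
  have h2 : (T - 0) * (m / T) ^ 2 = m ^ 2 / T := by field_simp; ring
  have h3 : 2 * (m / T) * m = 2 * (m ^ 2 / T) := by ring
  rw [h2, h3] at h
  have h4 : m ^ 2 / T ≤ ∫ t in (0 : ℝ)..T, ‖f t‖ ^ 2 := by linarith
  rw [div_le_iff₀ hT] at h4
  linarith

theorem L2On.comp_add {f : ℝ → E} (hf : L2On T f) {a S : ℝ} (ha : 0 ≤ a) (haS : a + S ≤ T) :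
    L2On S fun t => f (a + t) := by
  have h1 : MemLp f 2 (volume.restrict (Set.Ioo a (a + S))) :=
    MemLp.mono_measure (Measure.restrict_mono (Set.Ioo_subset_Ioo ha haS) le_rfl) hf
  have h2 := (measurePreserving_add_left (volume : Measure ℝ) a).restrict_preimage
    (measurableSet_Ioo (a := a) (b := a + S))
  have h3 : (fun x => a + x) ⁻¹' Set.Ioo a (a + S) = Set.Ioo 0 S := by
    ext x; simp
  rw [h3] at h2
  exact h1.comp_measurePreserving h2

end SquareIntegrable

section Observation

variable {𝕜 H : Type*} [RCLike 𝕜] [NormedAddCommGroup H] [InnerProductSpace 𝕜 H] [CompleteSpace H]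
  {A : H →ₗ.[𝕜] H} {hA : WaveOperator A}
  {G : Type*} [NormedAddCommGroup G] [InnerProductSpace 𝕜 G] [CompleteSpace G]
  {k : ℤ} {BB : Hs hA (k + 2) × Hs hA k →L[𝕜] G} {T : ℝ}

theorem intervalIntegrable_inner {φ : ℝ → G} {s t : ℝ} (h : IntervalIntegrable φ volume s t)
    (g : G) : IntervalIntegrable (fun t => (inner 𝕜 g (φ t) : 𝕜)) volume s t :=
  ⟨(innerSL 𝕜 g).integrable_comp h.1, (innerSL 𝕜 g).integrable_comp h.2⟩

theorem intervalIntegrable_test_mul {ψ : ℝ → ℝ} (hψ : Continuous ψ) {h : ℝ → 𝕜} {s t : ℝ}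
    (hh : IntervalIntegrable h volume s t) :
    IntervalIntegrable (fun t => (ψ t : 𝕜) * h t) volume s t :=
  hh.continuousOn_mul (RCLike.continuous_ofReal.comp hψ).continuousOn

/-- The observation depends linearly on the solution. -/
theorem IsObs.add_smul {w z w' z' : ℝ → Idx hA → 𝕜} {φ φ' : ℝ → G} (hT : 0 ≤ T)
    (h : IsObs BB T w z φ) (h' : IsObs BB T w' z' φ')
    (hw : ∀ i, IntervalIntegrable (fun t => w t i) volume 0 T)
    (hz : ∀ i, IntervalIntegrable (fun t => z t i) volume 0 T)
    (hw' : ∀ i, IntervalIntegrable (fun t => w' t i) volume 0 T)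
    (hz' : ∀ i, IntervalIntegrable (fun t => z' t i) volume 0 T) (c : 𝕜) :
    IsObs BB T (fun t i => w t i + c * w' t i) (fun t i => z t i + c * z' t i)
      (fun t => φ t + c • φ' t) := by
  refine ⟨h.1.add (h'.1.const_smul c), fun ψ hψ hc hs => ?_⟩
  obtain ⟨x, y, hx, hy, e⟩ := h.2 ψ hψ hc hs
  obtain ⟨x', y', hx', hy', e'⟩ := h'.2 ψ hψ hc hs
  have aux : ∀ u u' : ℝ → 𝕜, IntervalIntegrable u volume 0 T → IntervalIntegrable u' volume 0 T →
      ∫ t in (0 : ℝ)..T, (ψ t : 𝕜) * (u t + c * u' t) =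
        (∫ t in (0 : ℝ)..T, (ψ t : 𝕜) * u t) + c * ∫ t in (0 : ℝ)..T, (ψ t : 𝕜) * u' t := by
    intro u u' hu hu'
    rw [← intervalIntegral.integral_const_mul, ← intervalIntegral.integral_add
      (intervalIntegrable_test_mul hψ.continuous hu)
      ((intervalIntegrable_test_mul hψ.continuous hu').const_mul c)]
    exact intervalIntegral.integral_congr fun t _ => by ring
  refine ⟨x + c • x', y + c • y', fun i => ?_, fun i => ?_, fun g => ?_⟩
  · rw [coeff_add, coeff_smul, hx, hx', aux _ _ (hw i) (hw' i)]
  · rw [coeff_add, coeff_smul, hy, hy', aux _ _ (hz i) (hz' i)]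
  · have h1 : BB (x + c • x', y + c • y') = BB (x, y) + c • BB (x', y') := by
      rw [← map_smul, ← map_add]; rfl
    rw [h1, inner_add_right, inner_smul_right, e, e', ← aux _ _
      (intervalIntegrable_inner (h.1.intervalIntegrable hT) g)
      (intervalIntegrable_inner (h'.1.intervalIntegrable hT) g)]
    simp only [inner_add_right, inner_smul_right]

theorem intervalIntegral_eq_integral_of_tsupport {F : Type*} [NormedAddCommGroup F]
    [NormedSpace ℝ F] {h : ℝ → F} {s t : ℝ} {ψ : ℝ → ℝ} (hs : tsupport ψ ⊆ Set.Ioo s t)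
    (hψ : ∀ x, ψ x = 0 → h x = 0) : ∫ x in s..t, h x = ∫ x, h x := by
  refine intervalIntegral.integral_eq_integral_of_support_subset fun x hx => ?_
  exact Set.Ioo_subset_Ioc_self (hs (subset_tsupport ψ fun h0 => hx (hψ x h0)))

/-- The observation of a translated solution. -/
theorem IsObs.comp_add {w z : ℝ → Idx hA → 𝕜} {φ : ℝ → G} (h : IsObs BB T w z φ) {a S : ℝ}
    (ha : 0 ≤ a) (haS : a + S ≤ T) :
    IsObs BB S (fun t => w (a + t)) (fun t => z (a + t)) (fun t => φ (a + t)) := by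
  refine ⟨h.1.comp_add ha haS, fun ψ hψ hc hs => ?_⟩
  -- A test function on the short window, translated by a, is a test function on (0, T).
  have hts : tsupport (fun t => ψ (t - a)) ⊆ Set.Ioo 0 T := by
    have h1 : tsupport (fun t => ψ (t - a)) = (fun t => t - a) ⁻¹' tsupport ψ :=
      tsupport_comp_eq_preimage ψ (Homeomorph.subRight a)
    rw [h1]
    intro t ht
    have := hs ht
    exact ⟨by linarith [this.1], by linarith [this.2]⟩
  have hint : ∀ u : ℝ → 𝕜, ∫ t in (0 : ℝ)..T, (ψ (t - a) : 𝕜) * u t =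
      ∫ t in (0 : ℝ)..S, (ψ t : 𝕜) * u (a + t) := by
    intro u
    rw [intervalIntegral_eq_integral_of_tsupport hts fun x hx => by simp [hx],
      intervalIntegral_eq_integral_of_tsupport hs fun x hx => by simp [hx],
      ← integral_add_left_eq_self _ a]
    simp
  obtain ⟨x, y, hx, hy, e⟩ := h.2 (fun t => ψ (t - a)) (hψ.comp (contDiff_id.sub contDiff_const))
    (hc.comp_homeomorph (Homeomorph.subRight a)) hts
  refine ⟨x, y, fun i => ?_, fun i => ?_, fun g => ?_⟩
  · rw [hx, hint fun t => w t i]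
  · rw [hy, hint fun t => z t i]
  · rw [e, hint fun t => inner 𝕜 g (φ t)]

/-- Functions which agree as distributions agree almost everywhere. -/
theorem ae_eq_of_integral_test_eq {φ φ' : ℝ → G} (hT : 0 ≤ T) (h : L2On T φ) (h' : L2On T φ')
    (e : ∀ ψ : ℝ → ℝ, ContDiff ℝ ∞ ψ → HasCompactSupport ψ → tsupport ψ ⊆ Set.Ioo 0 T → ∀ g : G,
      ∫ t in (0 : ℝ)..T, (ψ t : 𝕜) * inner 𝕜 g (φ t) =
        ∫ t in (0 : ℝ)..T, (ψ t : 𝕜) * inner 𝕜 g (φ' t)) :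
    φ =ᵐ[volume.restrict (Set.Ioo 0 T)] φ' := by
  let _ : NormedSpace ℝ G := NormedSpace.restrictScalars ℝ 𝕜 G
  have hsub : L2On T fun t => φ t - φ' t := h.sub h'
  have hint : IntegrableOn (fun t => φ t - φ' t) (Set.Ioo 0 T) := hsub.integrable (by norm_num)
  -- The fundamental lemma of the calculus of variations for vector values; pairing with each g
  -- reduces its hypothesis to the scalar one.
  have key := IsOpen.ae_eq_zero_of_integral_contDiff_smul_eq_zero (μ := volume)
    (isOpen_Ioo (a := (0 : ℝ)) (b := T)) hint.locallyIntegrableOn fun ψ hψ hc hs => ?_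
  · rw [Filter.EventuallyEq, ae_restrict_iff' measurableSet_Ioo]
    filter_upwards [key] with t ht ht'
    exact sub_eq_zero.1 (ht ht')
  · rw [← intervalIntegral_eq_integral_of_tsupport hs fun x hx => by simp [hx]]
    have hi : IntervalIntegrable (fun t => ψ t • (φ t - φ' t)) volume 0 T :=
      (hsub.intervalIntegrable hT).continuousOn_smul hψ.continuous.continuousOn
    refine ext_inner_left 𝕜 fun g => ?_
    have h1 := (innerSL 𝕜 g).intervalIntegral_comp_comm hi
    simp only [innerSL_apply_apply] at h1
    rw [← h1, inner_zero_right]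
    have h2 : ∀ t, inner 𝕜 g (ψ t • (φ t - φ' t)) =
        (ψ t : 𝕜) * inner 𝕜 g (φ t) - (ψ t : 𝕜) * inner 𝕜 g (φ' t) := fun t => by
      rw [show ψ t • (φ t - φ' t) = (ψ t : 𝕜) • (φ t - φ' t) from rfl, inner_smul_right,
        inner_sub_right, mul_sub]
    simp only [h2]
    rw [intervalIntegral.integral_sub, e ψ hψ hc hs g, sub_self]
    · exact intervalIntegrable_test_mul hψ.continuous
        (intervalIntegrable_inner (h.intervalIntegrable hT) g)
    · exact intervalIntegrable_test_mul hψ.continuous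
        (intervalIntegrable_inner (h'.intervalIntegrable hT) g)

/-- The coefficients of the time averages determine the point of H_{k+2} × H_k at which the
observation operator is evaluated, so two observations of one solution agree as distributions. This
uniqueness makes the observation map linear. -/
theorem IsObs.ae_eq {w z : ℝ → Idx hA → 𝕜} {φ φ' : ℝ → G} (hT : 0 ≤ T) (h : IsObs BB T w z φ)
    (h' : IsObs BB T w z φ') : φ =ᵐ[volume.restrict (Set.Ioo 0 T)] φ' := by
  refine ae_eq_of_integral_test_eq (𝕜 := 𝕜) hT h.1 h'.1 fun ψ hψ hc hs g => ?_
  obtain ⟨x, y, hx, hy, e⟩ := h.2 ψ hψ hc hs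
  obtain ⟨x', y', hx', hy', e'⟩ := h'.2 ψ hψ hc hs
  rw [← e, ← e', coeff_ext fun i => (hx i).trans (hx' i).symm,
    coeff_ext fun i => (hy i).trans (hy' i).symm]

theorem IsObs.congr {w z w' z' : ℝ → Idx hA → 𝕜} {φ : ℝ → G} (hT : 0 ≤ T) (h : IsObs BB T w z φ)
    (hw : ∀ t ∈ Set.Icc 0 T, w t = w' t) (hz : ∀ t ∈ Set.Icc 0 T, z t = z' t) :
    IsObs BB T w' z' φ := by
  refine ⟨h.1, fun ψ hψ hc hs => ?_⟩
  obtain ⟨x, y, hx, hy, e⟩ := h.2 ψ hψ hc hs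
  refine ⟨x, y, fun i => ?_, fun i => ?_, e⟩
  · rw [hx]
    refine intervalIntegral.integral_congr fun t ht => ?_
    rw [Set.uIcc_of_le hT] at ht
    simp only [hw t ht]
  · rw [hy]
    refine intervalIntegral.integral_congr fun t ht => ?_
    rw [Set.uIcc_of_le hT] at ht
    simp only [hz t ht]

end Observation

end Cascade

/-! ### Uniform constants from a fixed observation time -/

namespace Cascade

open MeasureTheory

/-- An estimate on all the windows of length `τ` gives a uniform estimate on `[0, T]`, `T ≥ τ`. -/
theorem le_two_mul_of_window {E G : ℝ → ℝ} {τ T : ℝ} (hτ : 0 < τ) (hT : τ ≤ T) (hE0 : E 0 = 0)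
    (hG0 : 0 ≤ G 0) (hE : MonotoneOn E (Set.Icc 0 T)) (hG : MonotoneOn G (Set.Icc 0 T))
    (h : ∀ a, 0 ≤ a → a + τ ≤ T → E (a + τ) - E a ≤ G (a + τ) - G a) : E T ≤ 2 * G T := by
  have hind : ∀ n : ℕ, n * τ ≤ T → E (n * τ) ≤ G (n * τ) := by
    intro n
    induction n with
    | zero => intro _; simpa [hE0] using hG0
    | succ n ih =>
      intro hn
      have e : ((n + 1 : ℕ) : ℝ) * τ = n * τ + τ := by push_cast; ring
      rw [e] at hn ⊢
      have h1 := ih (by linarith)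
      have h2 := h (n * τ) (by positivity) hn
      linarith
  have hT0 : 0 ≤ T := hτ.le.trans hT
  set n := ⌊T / τ⌋₊
  have h1 : n * τ ≤ T := by
    rw [← le_div_iff₀ hτ]; exact Nat.floor_le (by positivity)
  have h2 : T - τ ≤ n * τ := by
    have := (Nat.lt_floor_add_one (T / τ)).le
    rw [div_le_iff₀ hτ] at this
    linarith
  have m1 : T - τ ∈ Set.Icc 0 T := ⟨by linarith, by linarith⟩
  have m2 : n * τ ∈ Set.Icc 0 T := ⟨by positivity, h1⟩
  have m3 : T ∈ Set.Icc 0 T := ⟨hT0, le_rfl⟩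
  have m4 : (0 : ℝ) ∈ Set.Icc 0 T := ⟨le_rfl, hT0⟩
  -- The consecutive windows cover [0, nτ] with nτ ≥ T - τ; one further window ending at T covers
  -- the rest. Overlaps are counted at most twice, whence the factor 2.
  have h3 := h (T - τ) m1.1 (by linarith)
  rw [sub_add_cancel] at h3
  have h4 := hE m1 m2 h2
  have h5 := hind n h1
  have h6 := hG m2 m3 h1
  have h7 := hG m4 m1 m1.1
  linarith

theorem monotoneOn_primitive {u : ℝ → ℝ} {T : ℝ} (hu : IntervalIntegrable u volume 0 T)
    (h0 : ∀ t, 0 ≤ u t) : MonotoneOn (fun t => ∫ s in (0 : ℝ)..t, u s) (Set.Icc 0 T) := by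
  intro a ha c hc hac
  exact intervalIntegral.integral_mono_interval le_rfl ha.1 hac
    (Filter.Eventually.of_forall h0) (hu.mono_set (uIcc_zero_subset hc))

theorem primitive_sub {u : ℝ → ℝ} {T a τ : ℝ} (hu : IntervalIntegrable u volume 0 T) (ha : 0 ≤ a)
    (hτ : 0 ≤ τ) (haT : a + τ ≤ T) :
    (∫ s in (0 : ℝ)..(a + τ), u s) - ∫ s in (0 : ℝ)..a, u s = ∫ s in (0 : ℝ)..τ, u (a + s) := by
  rw [intervalIntegral.integral_comp_add_left u a, add_zero,
    intervalIntegral.integral_interval_sub_left]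
  · exact hu.mono_set (uIcc_zero_subset ⟨by linarith, haT⟩)
  · exact hu.mono_set (uIcc_zero_subset ⟨ha, by linarith⟩)

section Uniform

variable {𝕜 H : Type*} [RCLike 𝕜] [NormedAddCommGroup H] [InnerProductSpace 𝕜 H] [CompleteSpace H]
  {A : H →ₗ.[𝕜] H} {hA : WaveOperator A} {k : ℤ} {T : ℝ} {f : ℝ → Hs hA k} {w0 : Hs hA (k + 1)}
  {w1 : Hs hA k} {w : ℝ → Hs hA (k + 1)} {z : ℝ → Hs hA k}

theorem intervalIntegrable_coeff {s : ℤ} {w : ℝ → Hs hA s} {a c : ℝ}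
    (h : IntervalIntegrable w volume a c) (i : Idx hA) :
    IntervalIntegrable (fun t => (w t).coeff i) volume a c := by
  simp only [coeff_eq_repr, ← coordL_apply]
  exact (IntervalIntegrable.const_mul ⟨((coordL (eigenbasis hA) i) ∘L
    ((Apow hA s).toContinuousLinearEquiv : Hs hA s →L[𝕜] H)).integrable_comp h.1,
    ((coordL (eigenbasis hA) i) ∘L
    ((Apow hA s).toContinuousLinearEquiv : Hs hA s →L[𝕜] H)).integrable_comp h.2⟩ _)

theorem intervalIntegrable_of_continuousOn {E : Type*} [NormedAddCommGroup E] {w : ℝ → E}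
    (hT : 0 ≤ T) (h : ContinuousOn w (Set.Icc 0 T)) : IntervalIntegrable w volume 0 T :=
  ContinuousOn.intervalIntegrable (by rwa [Set.uIcc_of_le hT])

theorem IsWave.continuousOn_energy (h : IsWave k T f w0 w1 w z) :
    ContinuousOn (fun t => energy (w t) (z t)) (Set.Icc 0 T) :=
  ((h.continuousOn.norm.pow 2).add (h.continuousOn_deriv.norm.pow 2)).div_const 2

theorem IsWave.comp_add (h : IsWave k T f w0 w1 w z) (hf : L2On T f) {a S : ℝ} (ha : 0 ≤ a)
    (hS : 0 ≤ S) (haS : a + S ≤ T) :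
    IsWave k S (fun t => f (a + t)) (w a) (z a) (fun t => w (a + t)) (fun t => z (a + t)) := by
  have hT : 0 ≤ T := by linarith
  have hm : Set.MapsTo (fun t => a + t) (Set.Icc 0 S) (Set.Icc 0 T) := fun t ht =>
    ⟨by linarith [ht.1], by linarith [ht.2]⟩
  refine ⟨h.continuousOn.comp (by fun_prop) hm, h.continuousOn_deriv.comp (by fun_prop) hm,
    by simp, by simp, fun t ht i => ?_⟩
  have hat : a + t ∈ Set.Icc 0 T := hm ht
  have haT : a ∈ Set.Icc 0 T := ⟨ha, by linarith⟩
  have iw := intervalIntegrable_coeff (intervalIntegrable_of_continuousOn hT h.continuousOn) i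
  have iz := intervalIntegrable_coeff (intervalIntegrable_of_continuousOn hT h.continuousOn_deriv) i
  have ig : IntervalIntegrable (fun s => (f s).coeff i - (eigenval hA i : 𝕜) * (w s).coeff i)
      volume 0 T :=
    (intervalIntegrable_coeff (hf.intervalIntegrable hT) i).sub (iw.const_mul _)
  have aux : ∀ u : ℝ → 𝕜, IntervalIntegrable u volume 0 T →
      ∫ s in (0 : ℝ)..(a + t), u s =
        (∫ s in (0 : ℝ)..a, u s) + ∫ s in (0 : ℝ)..t, u (a + s) := fun u hu => by
    rw [intervalIntegral.integral_comp_add_left u a, add_zero,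
      intervalIntegral.integral_add_adjacent_intervals]
    · exact hu.mono_set (uIcc_zero_subset haT)
    · refine hu.mono_set ?_
      rw [Set.uIcc_of_le (by linarith [ht.1]), Set.uIcc_of_le hT]
      exact Set.Icc_subset_Icc ha hat.2
  obtain ⟨h1, h2⟩ := h.solves (a + t) hat i
  obtain ⟨h3, h4⟩ := h.solves a haT i
  rw [aux _ iz, ← add_assoc, ← h3] at h1
  rw [aux _ ig, ← add_assoc, ← h4] at h2
  simp only [add_zero]
  exact ⟨h1, h2⟩

theorem IsWave.sub {f' : ℝ → Hs hA k} {w0' : Hs hA (k + 1)}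
    {w1' : Hs hA k} {w' : ℝ → Hs hA (k + 1)} {z' : ℝ → Hs hA k} (h : IsWave k T f w0 w1 w z)
    (h' : IsWave k T f' w0' w1' w' z') (hf : L2On T f) (hf' : L2On T f') :
    IsWave k T (fun t => f t - f' t) (w0 - w0') (w1 - w1') (fun t => w t - w' t)
      (fun t => z t - z' t) := by
  refine ⟨h.continuousOn.sub h'.continuousOn, h.continuousOn_deriv.sub h'.continuousOn_deriv,
    by rw [h.init, h'.init], by rw [h.init_deriv, h'.init_deriv], fun t ht i => ?_⟩
  have hT : 0 ≤ T := ht.1.trans ht.2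
  have hsub := uIcc_zero_subset ht
  have iw := (intervalIntegrable_coeff (intervalIntegrable_of_continuousOn hT h.continuousOn)
    i).mono_set hsub
  have iz := (intervalIntegrable_coeff (intervalIntegrable_of_continuousOn hT h.continuousOn_deriv)
    i).mono_set hsub
  have iw' := (intervalIntegrable_coeff (intervalIntegrable_of_continuousOn hT h'.continuousOn)
    i).mono_set hsub
  have iz' := (intervalIntegrable_coeff (intervalIntegrable_of_continuousOn hT h'.continuousOn_deriv)
    i).mono_set hsub
  have jf := (intervalIntegrable_coeff (hf.intervalIntegrable hT) i).mono_set hsub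
  have jf' := (intervalIntegrable_coeff (hf'.intervalIntegrable hT) i).mono_set hsub
  obtain ⟨h1, h2⟩ := h.solves t ht i
  obtain ⟨h3, h4⟩ := h'.solves t ht i
  beta_reduce at h1 h2 h3 h4
  simp only [coeff_sub]
  constructor
  · rw [intervalIntegral.integral_sub iz iz', h1, h3]
    ring
  · have e : ∀ s, (f s).coeff i - (f' s).coeff i -
        (eigenval hA i : 𝕜) * ((w s).coeff i - (w' s).coeff i) =
        ((f s).coeff i - (eigenval hA i : 𝕜) * (w s).coeff i) -
        ((f' s).coeff i - (eigenval hA i : 𝕜) * (w' s).coeff i) := fun s => by ring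
    simp only [e]
    rw [intervalIntegral.integral_sub (jf.sub (iw.const_mul _)) (jf'.sub (iw'.const_mul _)), h2, h4]
    ring

theorem exists_isWave_free (w0 : Hs hA (k + 1)) (w1 : Hs hA k) (T : ℝ) :
    ∃ w z, IsWave k T (0 : ℝ → Hs hA k) w0 w1 w z := by
  -- The Bochner integrals in Duhamel's formula need a real structure on H, taken by restriction of
  -- scalars.
  let _ : NormedSpace ℝ H := NormedSpace.restrictScalars ℝ 𝕜 H
  have h := isWave_of_isRot (k := k) (isRot_rot (b := eigenbasis hA) (μ := weight hA 1) (f := 0)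
    continuous_const (Apow hA (k + 1) w0) (Apow hA k w1) T)
  simp only [rotX_zero, rotZ_zero, LinearIsometryEquiv.symm_apply_apply, Pi.zero_apply,
    map_zero] at h
  exact ⟨_, _, h⟩

theorem IsWave.energy_eq_init (h : IsWave k T 0 w0 w1 w z) {t : ℝ} (ht : t ∈ Set.Icc 0 T) :
    energy (w t) (z t) = energy w0 w1 := by
  let _ : NormedSpace ℝ H := NormedSpace.restrictScalars ℝ 𝕜 H
  have h1 := h.isRot
  simp only [Pi.zero_apply, map_zero] at h1
  have h2 := IsRot.norm_sq_eq h1 ht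
  rw [energy_eq, h2, h.init, h.init_deriv, energy_eq]

theorem L2On.Apow (hf : L2On T f) : L2On T fun t => Cascade.Apow hA k (f t) :=
  ((Cascade.Apow hA k).toContinuousLinearEquiv : Hs hA k →L[𝕜] H).comp_memLp' hf

theorem IsWave.energy_le (h : IsWave k T f w0 w1 w z) (hf : L2On T f) (hT : 0 < T) {t : ℝ}
    (ht : t ∈ Set.Icc 0 T) :
    energy (w t) (z t) ≤ 2 * energy w0 w1 + 2 * T * ∫ s in (0 : ℝ)..T, ‖f s‖ ^ 2 := by
  let _ : NormedSpace ℝ H := NormedSpace.restrictScalars ℝ 𝕜 H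
  have h2 := h.isRot.norm_sq_le (hf.Apow.intervalIntegrable hT.le) ht
  simp only [LinearIsometryEquiv.norm_map] at h2
  have h3 := sq_integral_le hf hT
  rw [h.init, h.init_deriv] at h2
  unfold energy
  linarith

variable {G : Type*} [NormedAddCommGroup G] [InnerProductSpace 𝕜 G] [CompleteSpace G]
  {BB : Hs hA (k + 2) × Hs hA k →L[𝕜] G}

theorem integral_norm_sq_sub_le {φ φ' : ℝ → G} (h : L2On T φ) (h' : L2On T φ') (hT : 0 ≤ T) :
    ∫ t in (0 : ℝ)..T, ‖φ t - φ' t‖ ^ 2 ≤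
      2 * (∫ t in (0 : ℝ)..T, ‖φ t‖ ^ 2) + 2 * ∫ t in (0 : ℝ)..T, ‖φ' t‖ ^ 2 := by
  have i1 := h.intervalIntegrable_sq hT
  have i2 := h'.intervalIntegrable_sq hT
  have i3 : L2On T fun t => φ t - φ' t := h.sub h'
  rw [← intervalIntegral.integral_const_mul, ← intervalIntegral.integral_const_mul,
    ← intervalIntegral.integral_add (i1.const_mul 2) (i2.const_mul 2)]
  refine intervalIntegral.integral_mono_on hT (i3.intervalIntegrable_sq hT)
    ((i1.const_mul 2).add (i2.const_mul 2)) fun t _ => ?_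
  have h1 := norm_sub_le (φ t) (φ' t)
  have h2 : ‖φ t - φ' t‖ ^ 2 ≤ (‖φ t‖ + ‖φ' t‖) ^ 2 := pow_le_pow_left₀ (norm_nonneg _) h1 2
  nlinarith [sq_nonneg (‖φ t‖ - ‖φ' t‖)]

/-- The observability inequality with a source, on a fixed interval. -/
theorem exists_observability_with_source {T₀ : ℝ} (hadm : Admissible BB) (hobs : Observable BB T₀)
    (hT : 0 < T) (hTT : T₀ < T) :
    ∃ K : ℝ, 0 < K ∧ ∀ (w0 : Hs hA (k + 1)) (w1 : Hs hA k) (f : ℝ → Hs hA k)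
      (w : ℝ → Hs hA (k + 1)) (z : ℝ → Hs hA k) (φ : ℝ → G), L2On T f → IsWave k T f w0 w1 w z →
      IsObs BB T (fun t => (w t).coeff) (fun t => (z t).coeff) φ →
      ∫ t in (0 : ℝ)..T, energy (w t) (z t) ≤
        K * ((∫ t in (0 : ℝ)..T, ‖φ t‖ ^ 2) + ∫ t in (0 : ℝ)..T, ‖f t‖ ^ 2) := by
  obtain ⟨c, hc, hadm⟩ := hadm T hT
  obtain ⟨c', hc', hobs⟩ := hobs T hTT
  set C := c * (2 * T + 2 * T ^ 2 + 1)
  refine ⟨2 * T * (2 / c' * (1 + C)) + 4 * T ^ 2, by positivity, ?_⟩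
  intro w0 w1 f w z φ hf hw hφ
  -- The solution is split into a free part with the same data, handled by observability, and a part
  -- with zero data and source f, handled by admissibility and the energy estimate.
  obtain ⟨wf, zf, hfree⟩ := exists_isWave_free w0 w1 T
  have hz : L2On T (0 : ℝ → Hs hA k) := MemLp.zero
  have hq := hw.sub hfree hf hz
  simp only [sub_self, Pi.zero_apply, sub_zero] at hq
  obtain ⟨φq, hφq, hle⟩ := hadm _ _ _ _ _ hf hq
  set F := ∫ t in (0 : ℝ)..T, ‖f t‖ ^ 2
  set Φ := ∫ t in (0 : ℝ)..T, ‖φ t‖ ^ 2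
  have hF : 0 ≤ F := intervalIntegral.integral_nonneg hT.le fun _ _ => by positivity
  have hΦ : 0 ≤ Φ := intervalIntegral.integral_nonneg hT.le fun _ _ => by positivity
  have eq : ∀ t ∈ Set.Icc 0 T, energy (w t - wf t) (z t - zf t) ≤ 2 * T * F := fun t ht => by
    have := hq.energy_le hf hT ht
    simpa [energy] using this
  have ieq : IntervalIntegrable (fun t => energy (w t - wf t) (z t - zf t)) volume 0 T :=
    intervalIntegrable_of_continuousOn hT.le hq.continuousOn_energy
  have eq0 : energy (w 0 - wf 0) (z 0 - zf 0) = 0 := by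
    rw [hw.init, hw.init_deriv, hfree.init, hfree.init_deriv]
    simp [energy]
  have eint : ∫ t in (0 : ℝ)..T, energy (w t - wf t) (z t - zf t) ≤ 2 * T ^ 2 * F := by
    refine (intervalIntegral.integral_mono_on hT.le ieq intervalIntegrable_const eq).trans ?_
    rw [intervalIntegral.integral_const, smul_eq_mul]
    exact le_of_eq (by ring)
  have hφqle : ∫ t in (0 : ℝ)..T, ‖φq t‖ ^ 2 ≤ C * F := by
    refine hle.trans ?_
    rw [eq0]
    calc _ ≤ c * (0 + 2 * T * F + 2 * T ^ 2 * F + F) := by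
          gcongr
          exact eq T ⟨hT.le, le_rfl⟩
      _ = C * F := by ring
  have iw := intervalIntegrable_of_continuousOn hT.le hw.continuousOn
  have iz := intervalIntegrable_of_continuousOn hT.le hw.continuousOn_deriv
  have iqw := intervalIntegrable_of_continuousOn hT.le hq.continuousOn
  have iqz := intervalIntegrable_of_continuousOn hT.le hq.continuousOn_deriv
  -- By linearity the free part is observed as φ - φq, which is what the observability inequality is
  -- applied to.
  have hobsf := (hφ.add_smul hT.le hφq (intervalIntegrable_coeff iw) (intervalIntegrable_coeff iz)
    (intervalIntegrable_coeff iqw) (intervalIntegrable_coeff iqz) (-1)).congr hT.le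
    (w' := fun t => (wf t).coeff) (z' := fun t => (zf t).coeff)
    (fun t _ => funext fun i => by rw [coeff_sub]; ring)
    (fun t _ => funext fun i => by rw [coeff_sub]; ring)
  simp only [neg_smul, one_smul, ← sub_eq_add_neg] at hobsf
  have h1 := hobs w0 w1 wf zf _ hfree hobsf
  have h2 := integral_norm_sq_sub_le hφ.1 hφq.1 hT.le
  have h3 : c' * energy (wf 0) (zf 0) ≤ 2 * (1 + C) * (Φ + F) := by
    have hC : 0 ≤ C := by positivity
    calc c' * energy (wf 0) (zf 0) ≤ 2 * Φ + 2 * (C * F) := by linarith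
      _ ≤ 2 * (1 + C) * (Φ + F) := by nlinarith [mul_nonneg hC hΦ]
  have h4 : energy (wf 0) (zf 0) ≤ 2 / c' * (1 + C) * (Φ + F) := by
    rw [div_mul_eq_mul_div, div_mul_eq_mul_div, le_div_iff₀ hc']
    linarith
  have h5 : ∀ t ∈ Set.Icc 0 T, energy (w t) (z t) ≤
      2 * (2 / c' * (1 + C) * (Φ + F)) + 2 * (2 * T * F) := fun t ht => by
    have e1 := hfree.energy_eq_init ht
    rw [hfree.init, hfree.init_deriv] at h4
    have e2 := eq t ht
    have aux : ∀ {s : ℤ} (u v : Hs hA s), ‖u‖ ^ 2 ≤ 2 * ‖v‖ ^ 2 + 2 * ‖u - v‖ ^ 2 := fun u v => by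
      have h6 : ‖u‖ ≤ ‖v‖ + ‖u - v‖ := by
        have := norm_add_le v (u - v)
        rwa [add_sub_cancel] at this
      have h7 := pow_le_pow_left₀ (norm_nonneg _) h6 2
      nlinarith [sq_nonneg (‖v‖ - ‖u - v‖)]
    have e3 := aux (w t) (wf t)
    have e4 := aux (z t) (zf t)
    rw [← e1] at h4
    unfold energy at e2 h4 ⊢
    linarith
  refine (intervalIntegral.integral_mono_on hT.le
    (intervalIntegrable_of_continuousOn hT.le hw.continuousOn_energy)
    intervalIntegrable_const h5).trans ?_
  rw [intervalIntegral.integral_const, smul_eq_mul, sub_zero]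
  nlinarith [mul_nonneg (sq_nonneg T) hΦ]

/-- Both inequalities hold on [0, τ] with some constant. Free energy is conserved and the equation
is invariant under translation in time, so they hold with the same constant on every window of
length τ; summing the windows costs a factor 2, whatever T is. -/
theorem exists_uniformConstants {P : H →L[𝕜] H} {T₀ τ : ℝ} (hT₀ : 0 < T₀)
    (hP : CouplingObservable hA P T₀) (hadm : Admissible BB) (hobs : Observable BB T₀)
    (hτ : T₀ < τ) : ∃ γ a₀ : ℝ, UniformConstants BB P τ γ a₀ := by
  have hτ0 : 0 < τ := hT₀.trans hτ
  obtain ⟨c, hc, hP⟩ := hP τ hτ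
  obtain ⟨K, hK, hobs⟩ := exists_observability_with_source hadm hobs hτ0 hτ
  refine ⟨2 * (τ / c), 2 * K, hτ0, by positivity, by positivity, ?_, 2 * K, by positivity, ?_⟩
  · intro T hT w0 w1 w z hw
    have hT0 : 0 ≤ T := hτ0.le.trans hT.le
    have hPc : IntervalIntegrable (fun t => ‖P (Apow hA 0 (z t))‖ ^ 2) volume 0 T :=
      intervalIntegrable_of_continuousOn hT0 ((P.continuous.comp_continuousOn
        ((Apow hA 0).continuous.comp_continuousOn hw.continuousOn_deriv)).norm.pow 2)
    have he := energy_nonneg (w 0) (z 0)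
    have hmono := monotoneOn_primitive hPc fun t => by positivity
    have key := le_two_mul_of_window (E := fun t => t * energy (w 0) (z 0))
      (G := fun t => τ / c * ∫ s in (0 : ℝ)..t, ‖P (Apow hA 0 (z s))‖ ^ 2) hτ0 hT.le (by simp)
      (by simp) (fun a _ b _ hab => mul_le_mul_of_nonneg_right hab he)
      (fun a ha b hb hab => mul_le_mul_of_nonneg_left (hmono ha hb hab) (by positivity)) ?_
    · simpa only [mul_assoc] using key
    · intro a ha haT
      have hs := hw.comp_add MemLp.zero ha hτ0.le haT
      have h1 := hP _ _ _ _ hs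
      simp only [add_zero] at h1
      rw [hw.energy_eq_init ⟨ha, by linarith⟩] at h1
      rw [hw.init, hw.init_deriv, ← mul_sub, primitive_sub hPc ha hτ0.le haT,
        div_mul_eq_mul_div, le_div_iff₀ hc]
      nlinarith
  · intro T hT w0 w1 f w z φ hf hw hφ
    have hT0 : 0 ≤ T := hτ0.le.trans hT.le
    have ie := intervalIntegrable_of_continuousOn hT0 hw.continuousOn_energy
    have iφ := hφ.1.intervalIntegrable_sq hT0
    have jf := hf.intervalIntegrable_sq hT0
    have hmE := monotoneOn_primitive ie fun t => energy_nonneg _ _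
    have hmG := monotoneOn_primitive ((iφ.add jf).const_mul K) fun t => by positivity
    have key := le_two_mul_of_window (E := fun t => ∫ s in (0 : ℝ)..t, energy (w s) (z s))
      (G := fun t => ∫ s in (0 : ℝ)..t, K * (‖φ s‖ ^ 2 + ‖f s‖ ^ 2)) hτ0 hT.le (by simp)
      (by simp) hmE hmG ?_
    · simp only [intervalIntegral.integral_const_mul] at key
      rw [intervalIntegral.integral_add iφ jf] at key
      linarith
    · intro a ha haT
      have hs := hw.comp_add hf ha hτ0.le haT
      have h1 := hobs _ _ _ _ _ _ (hf.comp_add ha haT) hs (hφ.comp_add ha haT)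
      rw [primitive_sub ie ha hτ0.le haT, primitive_sub ((iφ.add jf).const_mul K) ha hτ0.le haT,
        intervalIntegral.integral_const_mul, intervalIntegral.integral_add
          ((hφ.1.comp_add ha haT).intervalIntegrable_sq hτ0.le)
          ((hf.comp_add ha haT).intervalIntegrable_sq hτ0.le)]
      exact h1

end Uniform

end Cascade

/-! ### Hilbert uniqueness method and the controlled trajectory -/

namespace Cascade

open MeasureTheory

section Duality

variable {𝕜 V G : Type*} [RCLike 𝕜] [NormedAddCommGroup V] [InnerProductSpace 𝕜 V]
  [CompleteSpace V] [NormedAddCommGroup G] [InnerProductSpace 𝕜 G] [CompleteSpace G]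

/-- An operator which is bounded below has a surjective adjoint. -/
theorem exists_adjoint_apply_eq {L : Type*} [NormedAddCommGroup L] [InnerProductSpace 𝕜 L]
    [CompleteSpace L] (Ψ : V →L[𝕜] L) {c : ℝ} (hc : 0 < c) (h : ∀ W, c * ‖W‖ ≤ ‖Ψ W‖) (Y : V) :
    ∃ v : L, ∀ W, inner 𝕜 v (Ψ W) = inner 𝕜 Y W := by
  -- The Gram operator Ψ*Ψ is coercive with constant c², hence invertible. The element sought is Ψ
  -- (Ψ*Ψ)⁻¹ Y.
  have hu : IsUnit (Ψ.adjoint ∘L Ψ) := by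
    refine ContinuousLinearMap.isUnit_of_forall_le_norm_inner_map _ (c := ⟨c ^ 2, sq_nonneg c⟩)
      (by exact_mod_cast pow_pos hc 2) fun x => ?_
    rw [ContinuousLinearMap.comp_apply, ContinuousLinearMap.adjoint_inner_left,
      inner_self_eq_norm_sq_to_K, norm_pow, RCLike.norm_ofReal, abs_norm]
    have := pow_le_pow_left₀ (by positivity) (h x) 2
    rw [mul_pow] at this
    calc ‖x‖ ^ 2 * c ^ 2 = c ^ 2 * ‖x‖ ^ 2 := mul_comm _ _
      _ ≤ _ := this
  obtain ⟨S, hS⟩ := hu.exists_right_inv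
  refine ⟨Ψ (S Y), fun W => ?_⟩
  have e := congrArg (fun R : V →L[𝕜] V => R Y) hS
  simp only [mul_apply_eq_comp, ContinuousLinearMap.comp_apply,
    one_apply_eq_self] at e
  rw [← ContinuousLinearMap.adjoint_inner_left, e]

theorem setIntegral_indicator_Iio {E : Type*} [NormedAddCommGroup E] [NormedSpace ℝ E] (h : ℝ → E)
    {T θ : ℝ} (hθ : 0 ≤ θ) :
    ∫ t in Set.Ioo 0 T, (Set.Iio θ).indicator h t =
      ∫ t in (0 : ℝ)..θ, (Set.Ioo 0 T).indicator h t := by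
  rw [setIntegral_indicator measurableSet_Iio, intervalIntegral.integral_of_le hθ,
    integral_Ioc_eq_integral_Ioo, setIntegral_indicator measurableSet_Ioo]
  congr 2
  ext t
  simp only [Set.mem_inter_iff, Set.mem_Ioo, Set.mem_Iio]
  tauto

/-- The truncations `1_{(-∞, θ)} v` depend continuously on `θ` in `L²`. -/
theorem continuous_toLp_indicator (𝕜 : Type*) [RCLike 𝕜] {E : Type*} [NormedAddCommGroup E]
    [InnerProductSpace 𝕜 E] {ν : Measure ℝ} [NullSingletonClass ν] {v : ℝ → E} (hv : MemLp v 2 ν) :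
    Continuous fun θ : ℝ => (hv.indicator (measurableSet_Iio (a := θ))).toLp := by
  have hsq : Integrable (fun t => ‖v t‖ ^ 2) ν := (memLp_two_iff_integrable_sq_norm hv.1).1 hv
  have hF : Continuous fun θ => ∫ t in (0 : ℝ)..θ, ‖v t‖ ^ 2 ∂ν :=
    intervalIntegral.continuous_primitive (fun a b => hsq.intervalIntegrable) 0
  -- Two truncations differ by v restricted to [a, c), so the squared distance is an increment of
  -- the primitive of ‖v‖², which is continuous since points carry no mass.
  have key : ∀ a c : ℝ, a ≤ c →
      ‖(hv.indicator (measurableSet_Iio (a := c))).toLp -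
        (hv.indicator (measurableSet_Iio (a := a))).toLp‖ ^ 2 ≤
      |(∫ t in (0 : ℝ)..c, ‖v t‖ ^ 2 ∂ν) - ∫ t in (0 : ℝ)..a, ‖v t‖ ^ 2 ∂ν| := by
    intro a c hac
    rw [← MemLp.toLp_sub, ← inner_self_eq_norm_sq (𝕜 := 𝕜), L2.inner_def,
      intervalIntegral.integral_interval_sub_left hsq.intervalIntegrable hsq.intervalIntegrable]
    have e : ∫ t, (inner 𝕜 (MemLp.toLp _ ((hv.indicator (measurableSet_Iio (a := c))).sub
        (hv.indicator (measurableSet_Iio (a := a)))) t)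
        (MemLp.toLp _ ((hv.indicator (measurableSet_Iio (a := c))).sub
        (hv.indicator (measurableSet_Iio (a := a)))) t) : 𝕜) ∂ν =
        ((∫ t in a..c, ‖v t‖ ^ 2 ∂ν : ℝ) : 𝕜) := by
      rw [intervalIntegral.integral_of_le hac, ← integral_Ico_eq_integral_Ioc,
        ← integral_indicator measurableSet_Ico, ← integral_ofReal]
      refine integral_congr_ae ?_
      filter_upwards [((hv.indicator (measurableSet_Iio (a := c))).sub
        (hv.indicator (measurableSet_Iio (a := a)))).coeFn_toLp] with t ht
      rw [ht, inner_self_eq_norm_sq_to_K, Pi.sub_apply]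
      by_cases h1 : t < c
      · by_cases h2 : t < a
        · simp [Set.indicator, h1, h2, not_le.2 h2]
        · simp [Set.indicator, h1, h2, not_lt.1 h2]
      · have h2 : ¬ t < a := fun h => h1 (h.trans_le hac)
        simp [Set.indicator, h1, h2]
    rw [e, RCLike.ofReal_re]
    exact le_abs_self _
  have key' : ∀ a c : ℝ,
      dist ((hv.indicator (measurableSet_Iio (a := c))).toLp)
        ((hv.indicator (measurableSet_Iio (a := a))).toLp) ≤
      √|(∫ t in (0 : ℝ)..c, ‖v t‖ ^ 2 ∂ν) - ∫ t in (0 : ℝ)..a, ‖v t‖ ^ 2 ∂ν| := by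
    intro a c
    refine Real.le_sqrt_of_sq_le ?_
    rcases le_total a c with hac | hac
    · rw [dist_eq_norm]; exact key a c hac
    · rw [dist_comm, dist_eq_norm, abs_sub_comm]; exact key c a hac
  refine continuous_iff_continuousAt.2 fun a => tendsto_iff_dist_tendsto_zero.2 ?_
  have hlim : Filter.Tendsto (fun c =>
      √|(∫ t in (0 : ℝ)..c, ‖v t‖ ^ 2 ∂ν) - ∫ t in (0 : ℝ)..a, ‖v t‖ ^ 2 ∂ν|) (nhds a)
      (nhds 0) := by
    have h1 : Continuous fun c =>
        √|(∫ t in (0 : ℝ)..c, ‖v t‖ ^ 2 ∂ν) - ∫ t in (0 : ℝ)..a, ‖v t‖ ^ 2 ∂ν| :=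
      (hF.sub continuous_const).abs.sqrt
    have h2 := h1.tendsto a
    simpa using h2
  exact squeeze_zero (fun _ => dist_nonneg) (fun c => key' a c) hlim

/-- The Hilbert uniqueness method: if the observation map `Ψ` on `(0, T)` is bounded below, there
is a control `v` driving the initial data to `0`; the path `Z` is the state at time `θ`,
transported back to time `0`. -/
theorem exists_control_path {T : ℝ} (hT : 0 < T)
    (Ψ : V →L[𝕜] Lp G 2 (volume.restrict (Set.Ioo 0 T))) {c : ℝ} (hc : 0 < c)
    (h : ∀ W, c * ‖W‖ ≤ ‖Ψ W‖) (Y₀ : V) :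
    ∃ (v : ℝ → G) (Z : ℝ → V), L2On T v ∧ Continuous Z ∧ Z T = 0 ∧ ∀ θ, 0 ≤ θ → ∀ W,
      inner 𝕜 (Z θ) W = inner 𝕜 Y₀ W +
        ∫ t in (0 : ℝ)..θ, inner 𝕜 ((Set.Ioo 0 T).indicator v t) (Ψ W t) := by
  -- Ψ* v = -Y₀ is precisely the condition that the path `Z` below vanish at time T, where the
  -- truncation no longer removes anything from (0, T).
  obtain ⟨v, hv⟩ := exists_adjoint_apply_eq Ψ hc h (-Y₀)
  have hvm : MemLp v 2 (volume.restrict (Set.Ioo 0 T)) := Lp.memLp v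
  set Z : ℝ → V := fun θ =>
    Y₀ + Ψ.adjoint (hvm.indicator (measurableSet_Iio (a := θ))).toLp with hZ
  have hid : ∀ θ, 0 ≤ θ → ∀ W, inner 𝕜 (Z θ) W = inner 𝕜 Y₀ W +
        ∫ t in (0 : ℝ)..θ, inner 𝕜 ((Set.Ioo 0 T).indicator v t) (Ψ W t) := by
    intro θ hθ W
    rw [hZ, inner_add_left, ContinuousLinearMap.adjoint_inner_left, L2.inner_def]
    congr 1
    have e : ∀ s : Set ℝ, (fun t => (inner 𝕜 (s.indicator v t) (Ψ W t) : 𝕜)) =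
        s.indicator fun t => inner 𝕜 (v t) (Ψ W t) := fun s => by
      ext t
      by_cases ht : t ∈ s <;> simp [ht]
    rw [e (Set.Ioo 0 T), ← setIntegral_indicator_Iio _ hθ, ← e]
    refine integral_congr_ae ?_
    filter_upwards [(hvm.indicator (measurableSet_Iio (a := θ))).coeFn_toLp] with t ht
    rw [ht]
  refine ⟨v, Z, hvm, continuous_const.add
    (Ψ.adjoint.continuous.comp (continuous_toLp_indicator 𝕜 hvm)), ?_, hid⟩
  refine ext_inner_right 𝕜 fun W => ?_
  rw [hid T hT.le, inner_zero_left]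
  have e := hv W
  rw [L2.inner_def, inner_neg_left] at e
  rw [intervalIntegral.integral_of_le hT.le, integral_Ioc_eq_integral_Ioo,
    show (∫ t in Set.Ioo 0 T, (inner 𝕜 ((Set.Ioo 0 T).indicator v t) (Ψ W t) : 𝕜)) =
      ∫ t in Set.Ioo 0 T, inner 𝕜 (v t) (Ψ W t) from
      setIntegral_congr_fun measurableSet_Ioo fun t ht => by simp [ht], e]
  ring

end Duality

section Flow

variable {𝕜 H ι : Type*} [RCLike 𝕜] [NormedAddCommGroup H] [InnerProductSpace 𝕜 H]
  [CompleteSpace H] {b : HilbertBasis ι 𝕜 H} {μ : ι → ℝ} [NormedSpace ℝ H] (D : H →L[𝕜] H)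

/-- `(x₁, z₁, x₂, z₂)` solves the normalized dual system. -/
def IsCascade (b : HilbertBasis ι 𝕜 H) (μ : ι → ℝ) (D : H →L[𝕜] H) (T : ℝ)
    (x₁ z₁ x₂ z₂ : ℝ → H) : Prop :=
  IsRot b μ T 0 x₁ z₁ ∧ IsRot b μ T (fun t => -D (x₁ t)) x₂ z₂

/-- The duality bracket in normalized coordinates. -/
noncomputable def nbracket (ξ₁ ξ₂ ζ₁ ζ₂ x₁ z₁ x₂ z₂ : H) : 𝕜 :=
  inner 𝕜 ζ₁ x₁ - inner 𝕜 ξ₁ z₁ + inner 𝕜 ζ₂ x₂ - inner 𝕜 ξ₂ z₂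

variable {D}

/-- The bracket of a solution of the control system (without control) and of a solution of the
dual system is constant. -/
theorem nbracket_eq {T : ℝ} (hT : 0 ≤ T) {ξ₁ ξ₂ ζ₁ ζ₂ x₁ z₁ x₂ z₂ : ℝ → H}
    (hW : IsCascade b μ D T x₁ z₁ x₂ z₂) (h₂ : IsRot b μ T 0 ξ₂ ζ₂)
    (h₁ : IsRot b μ T (fun t => -D.adjoint (ξ₂ t)) ξ₁ ζ₁) :
    nbracket (𝕜 := 𝕜) (ξ₁ T) (ξ₂ T) (ζ₁ T) (ζ₂ T) (x₁ T) (z₁ T) (x₂ T) (z₂ T) =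
      nbracket (ξ₁ 0) (ξ₂ 0) (ζ₁ 0) (ζ₂ 0) (x₁ 0) (z₁ 0) (x₂ 0) (z₂ 0) := by
  obtain ⟨hW₁, hW₂⟩ := hW
  have cD : ContinuousOn (fun t => -D (x₁ t)) (Set.Icc 0 T) :=
    (D.continuous.comp_continuousOn hW₁.cont_fst).neg
  have cD' : ContinuousOn (fun t => -D.adjoint (ξ₂ t)) (Set.Icc 0 T) :=
    (D.adjoint.continuous.comp_continuousOn h₂.cont_fst).neg
  set X : ℝ → 𝕜 := fun t => (inner 𝕜 (ξ₁ t) (z₁ t) - inner 𝕜 (ζ₁ t) (x₁ t)) +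
    (inner 𝕜 (ξ₂ t) (z₂ t) - inner 𝕜 (ζ₂ t) (x₂ t)) with hX
  have hc : ContinuousOn X (Set.Icc 0 T) :=
    ((h₁.cont_fst.inner (𝕜 := 𝕜) hW₁.cont_snd).sub (h₁.cont_snd.inner (𝕜 := 𝕜) hW₁.cont_fst)).add
      ((h₂.cont_fst.inner (𝕜 := 𝕜) hW₂.cont_snd).sub (h₂.cont_snd.inner (𝕜 := 𝕜) hW₂.cont_fst))
  have hd : ∀ t ∈ Set.Ioo 0 T, HasDerivAt X 0 t := fun t ht => by
    have e := (h₁.hasDerivAt_symplectic hW₁ cD' continuousOn_const ht).add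
      (h₂.hasDerivAt_symplectic hW₂ continuousOn_const cD ht)
    convert! e using 1
    simp only [Pi.zero_apply, inner_zero_right, inner_zero_left, inner_neg_left, inner_neg_right,
      ContinuousLinearMap.adjoint_inner_left]
    ring
  have e := intervalIntegral.integral_eq_sub_of_hasDerivAt_of_le hT hc hd intervalIntegrable_const
  rw [intervalIntegral.integral_zero] at e
  simp only [hX] at e
  unfold nbracket
  linear_combination e

/-- Exact controllability of the normalized cascade system. -/
theorem exists_cascade_control {G : Type*} [NormedAddCommGroup G] [InnerProductSpace 𝕜 G]
    [CompleteSpace G] {T : ℝ} (hT : 0 < T)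
    (Ψ : PiLp 2 (fun _ : Fin 4 => H) →L[𝕜] Lp G 2 (volume.restrict (Set.Ioo 0 T))) {c : ℝ}
    (hc : 0 < c) (h : ∀ W, c * ‖W‖ ≤ ‖Ψ W‖) (η₁ η₂ κ₁ κ₂ : H) :
    ∃ (v : ℝ → G) (ξ₁ ξ₂ ζ₁ ζ₂ : ℝ → H), L2On T v ∧ Continuous ξ₁ ∧ Continuous ξ₂ ∧
      Continuous ζ₁ ∧ Continuous ζ₂ ∧
      (∀ x₁ z₁ x₂ z₂ : H, ∫ t in (0 : ℝ)..T, inner 𝕜 ((Set.Ioo 0 T).indicator v t)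
        (Ψ !₂[x₁, z₁, x₂, z₂] t) = -nbracket η₁ η₂ κ₁ κ₂ x₁ z₁ x₂ z₂) ∧
      ∀ θ, 0 ≤ θ → ∀ x₁ z₁ x₂ z₂ : ℝ → H, IsCascade b μ D θ x₁ z₁ x₂ z₂ →
        ∫ t in (0 : ℝ)..θ, inner 𝕜 ((Set.Ioo 0 T).indicator v t)
          (Ψ !₂[x₁ 0, z₁ 0, x₂ 0, z₂ 0] t) =
        nbracket (ξ₁ θ) (ξ₂ θ) (ζ₁ θ) (ζ₂ θ) (x₁ θ) (z₁ θ) (x₂ θ) (z₂ θ) -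
          nbracket η₁ η₂ κ₁ κ₂ (x₁ 0) (z₁ 0) (x₂ 0) (z₂ 0) := by
  -- The bracket is the inner product of H⁴ after a signed permutation: positions pair with
  -- velocities, and the y-positions acquire a minus sign.
  have hin : ∀ (p : PiLp 2 (fun _ : Fin 4 => H)) (x₁ z₁ x₂ z₂ : H),
      inner 𝕜 p !₂[x₁, z₁, x₂, z₂] = nbracket (-p 1) (-p 3) (p 0) (p 2) x₁ z₁ x₂ z₂ := by
    intro p x₁ z₁ x₂ z₂
    rw [PiLp.inner_apply, Fin.sum_univ_four]
    simp [nbracket]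
  obtain ⟨v, Z, hv, hZ, hZT, hid⟩ := exists_control_path hT Ψ hc h !₂[κ₁, -η₁, κ₂, -η₂]
  have hY0 : ∀ x₁ z₁ x₂ z₂ : H, inner 𝕜 (!₂[κ₁, -η₁, κ₂, -η₂] : PiLp 2 (fun _ : Fin 4 => H))
      !₂[x₁, z₁, x₂, z₂] = nbracket (𝕜 := 𝕜) η₁ η₂ κ₁ κ₂ x₁ z₁ x₂ z₂ := by
    intro x₁ z₁ x₂ z₂
    rw [hin]
    simp
  have hZi : ∀ i, Continuous fun θ => Z θ i := fun i =>
    (PiLp.continuous_apply 2 (fun _ : Fin 4 => H) i).comp hZ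
  -- the second component, at time `s`, of the solution which starts from `Z θ`
  set q : ℝ → ℝ → H := fun θ s => rotX b μ 0 (-Z θ 3) (Z θ 2) s with hq
  have hqc : Continuous q.uncurry :=
    (continuous_rot (Y := ℝ × ℝ) (b := b) (μ := μ) (f := fun _ => 0) (x₀ := fun p => -Z p.1 3)
      (z₀ := fun p => Z p.1 2) (τ := fun p => p.2) continuous_const
      ((hZi 3).comp continuous_fst).neg ((hZi 2).comp continuous_fst) continuous_snd).1
  have hg : Continuous (fun θ s => -D.adjoint (q θ s)).uncurry :=
    (D.adjoint.continuous.comp hqc).neg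
  have hq0 : ∀ θ, Continuous (q θ) := fun θ => continuous_rotX continuous_const _ _
  have hc2 := continuous_rot (Y := ℝ) (b := b) (μ := μ) (f := fun _ => 0) (x₀ := fun p => -Z p 3)
      (z₀ := fun p => Z p 2) (τ := fun p => p) continuous_const
      (hZi 3).neg (hZi 2) continuous_id
  have hc1 := continuous_rot (Y := ℝ) (b := b) (μ := μ) (f := fun θ s => -D.adjoint (q θ s))
      (x₀ := fun p => -Z p 1) (z₀ := fun p => Z p 0) (τ := fun p => p) hg
      (hZi 1).neg (hZi 0) continuous_id
  refine ⟨v, _, _, _, _, hv, hc1.1, hc2.1, hc1.2, hc2.2, fun x₁ z₁ x₂ z₂ => ?_, ?_⟩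
  · have e := hid T hT.le !₂[x₁, z₁, x₂, z₂]
    rw [hZT, inner_zero_left, hY0] at e
    linear_combination (-1 : 𝕜) * e
  · intro θ hθ x₁ z₁ x₂ z₂ hW
    -- The state at θ is the uncontrolled flow over time θ applied to the data coded by Z θ.
    -- Constancy of the bracket moves the pairing back to time 0, where the defining identity of Z
    -- applies.
    have e := nbracket_eq hθ hW (isRot_rot (b := b) (μ := μ) (f := 0) continuous_const
      (-Z θ 3) (Z θ 2) θ) (isRot_rot (f := fun s => -D.adjoint (q θ s))
      ((D.adjoint.continuous.comp (hq0 θ)).neg) (-Z θ 1) (Z θ 0) θ)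
    simp only [rotX_zero, rotZ_zero] at e
    have e2 := hid θ hθ !₂[x₁ 0, z₁ 0, x₂ 0, z₂ 0]
    rw [hY0, hin, ← e] at e2
    linear_combination -e2

end Flow

end Cascade

/-! ### The dual flow and the observation map -/

namespace Cascade

open MeasureTheory

section CascadeFlow

variable {𝕜 H ι : Type*} [RCLike 𝕜] [NormedAddCommGroup H] [InnerProductSpace 𝕜 H]
  [CompleteSpace H] (b : HilbertBasis ι 𝕜 H) (μ : ι → ℝ) [NormedSpace ℝ H] (D : H →L[𝕜] H)

/-- The source term of the second equation, for the initial data `W`. -/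
noncomputable def cascadeSource (W : PiLp 2 (fun _ : Fin 4 => H)) (t : ℝ) : H :=
  -D (rotX b μ 0 (W 0) (W 1) t)

/-- The component `x₂` of the solution of the normalized dual system with initial data `W`. -/
noncomputable def cascadeX (W : PiLp 2 (fun _ : Fin 4 => H)) (t : ℝ) : H :=
  rotX b μ (cascadeSource b μ D W) (W 2) (W 3) t

/-- The component `z₂` of the solution of the normalized dual system with initial data `W`. -/
noncomputable def cascadeZ (W : PiLp 2 (fun _ : Fin 4 => H)) (t : ℝ) : H :=
  rotZ b μ (cascadeSource b μ D W) (W 2) (W 3) t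

variable {b μ D}

theorem rot_add_smul {f f' : ℝ → H} (hf : Continuous f) (hf' : Continuous f') (x z x' z' : H)
    (c : 𝕜) (t : ℝ) :
    rotX b μ (fun t => f t + c • f' t) (x + c • x') (z + c • z') t =
        rotX b μ f x z t + c • rotX b μ f' x' z' t ∧
      rotZ b μ (fun t => f t + c • f' t) (x + c • x') (z + c • z') t =
        rotZ b μ f x z t + c • rotZ b μ f' x' z' t := by
  have aux : ∀ {L : ℝ → H →L[𝕜] H}, (∀ {g : ℝ → H}, Continuous g →
      IntervalIntegrable (fun s => L s (g s)) volume 0 t) →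
      ∫ s in (0 : ℝ)..t, L s (f s + c • f' s) =
        (∫ s in (0 : ℝ)..t, L s (f s)) + c • ∫ s in (0 : ℝ)..t, L s (f' s) := by
    intro L hL
    have e := (c • ContinuousLinearMap.id 𝕜 H).intervalIntegral_comp_comm (hL hf')
    simp only [smul_apply, ContinuousLinearMap.id_apply] at e
    have hi : IntervalIntegrable (fun s => c • L s (f' s)) volume 0 t := by
      have := hL (hf'.const_smul c)
      simpa only [Pi.smul_apply, map_smul] using this
    rw [← e, ← intervalIntegral.integral_add (hL hf) hi]
    simp only [map_add, map_smul]
  have hP : rotP b μ (fun t => f t + c • f' t) (x + c • x') t =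
      rotP b μ f x t + c • rotP b μ f' x' t := by
    rw [rotP, rotP, rotP, aux fun hg => intervalIntegrable_sinOp b μ (hg.intervalIntegrable _ _),
      smul_sub]
    abel
  have hQ : rotQ b μ (fun t => f t + c • f' t) (z + c • z') t =
      rotQ b μ f z t + c • rotQ b μ f' z' t := by
    rw [rotQ, rotQ, rotQ, aux fun hg => intervalIntegrable_cosOp b μ (hg.intervalIntegrable _ _),
      smul_add]
    abel
  constructor
  · rw [rotX, hP, hQ, map_add, map_add, map_smul, map_smul, rotX, rotX, smul_add]
    abel
  · rw [rotZ, hP, hQ, map_add, map_add, map_smul, map_smul, rotZ, rotZ, smul_sub]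
    abel

theorem rot_congr {f g : ℝ → H} {t : ℝ} (ht : 0 ≤ t) (h : ∀ s ∈ Set.Icc 0 t, f s = g s) (x z : H) :
    rotX b μ f x z t = rotX b μ g x z t ∧ rotZ b μ f x z t = rotZ b μ g x z t := by
  have hP : rotP b μ f x t = rotP b μ g x t := by
    unfold rotP
    congr 1
    refine intervalIntegral.integral_congr fun s hs => ?_
    rw [Set.uIcc_of_le ht] at hs
    simp only [h s hs]
  have hQ : rotQ b μ f z t = rotQ b μ g z t := by
    unfold rotQ
    congr 1
    refine intervalIntegral.integral_congr fun s hs => ?_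
    rw [Set.uIcc_of_le ht] at hs
    simp only [h s hs]
  exact ⟨by rw [rotX, rotX, hP, hQ], by rw [rotZ, rotZ, hP, hQ]⟩

theorem continuous_cascadeSource (W : PiLp 2 (fun _ : Fin 4 => H)) :
    Continuous (cascadeSource b μ D W) :=
  (D.continuous.comp (continuous_rotX continuous_const _ _)).neg

theorem cascadeSource_add_smul (W W' : PiLp 2 (fun _ : Fin 4 => H)) (c : 𝕜) :
    cascadeSource b μ D (W + c • W') =
      fun t => cascadeSource b μ D W t + c • cascadeSource b μ D W' t := by
  funext t
  have := (rot_add_smul (b := b) (μ := μ) (f := 0) (f' := 0) continuous_const continuous_const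
    (W 0) (W 1) (W' 0) (W' 1) c t).1
  simp only [Pi.zero_apply, smul_zero, add_zero] at this
  rw [cascadeSource, cascadeSource, cascadeSource, PiLp.add_apply, PiLp.add_apply, PiLp.smul_apply,
    PiLp.smul_apply]
  change -D (rotX b μ (fun _ => 0) _ _ t) = _
  rw [this, map_add, map_smul, neg_add, smul_neg]

theorem cascade_add_smul (W W' : PiLp 2 (fun _ : Fin 4 => H)) (c : 𝕜) (t : ℝ) :
    cascadeX b μ D (W + c • W') t = cascadeX b μ D W t + c • cascadeX b μ D W' t ∧
      cascadeZ b μ D (W + c • W') t = cascadeZ b μ D W t + c • cascadeZ b μ D W' t := by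
  rw [cascadeX, cascadeZ, cascadeSource_add_smul]
  exact rot_add_smul (continuous_cascadeSource W) (continuous_cascadeSource W') _ _ _ _ c t

theorem isCascade_cascade (W : PiLp 2 (fun _ : Fin 4 => H)) (T : ℝ) :
    IsCascade b μ D T (rotX b μ 0 (W 0) (W 1)) (rotZ b μ 0 (W 0) (W 1)) (cascadeX b μ D W)
      (cascadeZ b μ D W) :=
  ⟨isRot_rot continuous_const _ _ T, isRot_rot (continuous_cascadeSource W) _ _ T⟩

/-- Applying Duhamel's formula to the first pair identifies the source, and then to the second pair
gives the solution: everything is determined by the four initial values. -/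
theorem IsCascade.eq_cascade {T : ℝ} {x₁ z₁ x₂ z₂ : ℝ → H} (h : IsCascade b μ D T x₁ z₁ x₂ z₂)
    {t : ℝ} (ht : t ∈ Set.Icc 0 T) :
    x₂ t = cascadeX b μ D !₂[x₁ 0, z₁ 0, x₂ 0, z₂ 0] t ∧
      z₂ t = cascadeZ b μ D !₂[x₁ 0, z₁ 0, x₂ 0, z₂ 0] t := by
  obtain ⟨h₁, h₂⟩ := h
  have hT := ht.1.trans ht.2
  have hc : ContinuousOn (fun t => -D (x₁ t)) (Set.Icc 0 T) :=
    (D.continuous.comp_continuousOn h₁.cont_fst).neg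
  have e := h₂.eq_rot (intervalIntegrable_of_continuousOn hT hc) ht
  have e' := rot_congr (b := b) (μ := μ) (f := fun t => -D (x₁ t))
    (g := cascadeSource b μ D !₂[x₁ 0, z₁ 0, x₂ 0, z₂ 0]) ht.1 (fun s hs => by
      have hs' : s ∈ Set.Icc 0 T := ⟨hs.1, hs.2.trans ht.2⟩
      rw [(h₁.eq_rot intervalIntegrable_const hs').1]
      rfl) (x₂ 0) (z₂ 0)
  exact ⟨e.1.trans e'.1, e.2.trans e'.2⟩

theorem norm_cascadeSource_sq_le (W : PiLp 2 (fun _ : Fin 4 => H)) {T t : ℝ}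
    (ht : t ∈ Set.Icc 0 T) : ‖cascadeSource b μ D W t‖ ^ 2 ≤ ‖D‖ ^ 2 * ‖W‖ ^ 2 := by
  have h := (isRot_rot (b := b) (μ := μ) (f := 0) continuous_const (W 0) (W 1) T).norm_sq_eq ht
  simp only [rotX_zero, rotZ_zero] at h
  have hW : ‖W‖ ^ 2 = ‖W 0‖ ^ 2 + ‖W 1‖ ^ 2 + ‖W 2‖ ^ 2 + ‖W 3‖ ^ 2 := by
    rw [PiLp.norm_sq_eq_of_L2, Fin.sum_univ_four]
  have h1 : ‖rotX b μ 0 (W 0) (W 1) t‖ ^ 2 ≤ ‖W‖ ^ 2 := by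
    rw [hW]
    nlinarith [sq_nonneg ‖rotZ b μ 0 (W 0) (W 1) t‖, sq_nonneg ‖W 2‖, sq_nonneg ‖W 3‖]
  rw [cascadeSource, norm_neg]
  calc ‖D (rotX b μ 0 (W 0) (W 1) t)‖ ^ 2 ≤ (‖D‖ * ‖rotX b μ 0 (W 0) (W 1) t‖) ^ 2 :=
        pow_le_pow_left₀ (norm_nonneg _) (D.le_opNorm _) 2
    _ = ‖D‖ ^ 2 * ‖rotX b μ 0 (W 0) (W 1) t‖ ^ 2 := mul_pow _ _ _
    _ ≤ _ := by gcongr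

end CascadeFlow

section ObservationMap

variable {𝕜 H : Type*} [RCLike 𝕜] [NormedAddCommGroup H] [InnerProductSpace 𝕜 H] [CompleteSpace H]
  [NormedSpace ℝ H] {A : H →ₗ.[𝕜] H} {hA : WaveOperator A}
  {G : Type*} [NormedAddCommGroup G] [InnerProductSpace 𝕜 G] [CompleteSpace G]
  {k : ℤ} {BB : Hs hA (k + 2) × Hs hA k →L[𝕜] G} {T : ℝ}

/-- `φ` is the observation of the component `(x₂, z₂)` of a solution in normalized coordinates. -/
def IsNObs (BB : Hs hA (k + 2) × Hs hA k →L[𝕜] G) (T : ℝ) (x z : ℝ → H) (φ : ℝ → G) : Prop :=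
  IsObs BB T (fun t => ((Apow hA (k + 1)).symm (x t)).coeff)
    (fun t => ((Apow hA k).symm (z t)).coeff) φ

theorem norm_sq_toLp (𝕜 : Type*) [RCLike 𝕜] {E : Type*} [NormedAddCommGroup E]
    [InnerProductSpace 𝕜 E] {T : ℝ} (hT : 0 ≤ T) (g : Lp E 2 (volume.restrict (Set.Ioo 0 T))) :
    ‖g‖ ^ 2 = ∫ t in (0 : ℝ)..T, ‖g t‖ ^ 2 := by
  rw [← inner_self_eq_norm_sq (𝕜 := 𝕜), L2.inner_def, intervalIntegral.integral_of_le hT,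
    integral_Ioc_eq_integral_Ioo]
  simp only [inner_self_eq_norm_sq_to_K, ← RCLike.ofReal_pow]
  rw [integral_ofReal, RCLike.ofReal_re]

/-- On a bounded time interval every term on the right of the admissibility inequality, endpoint
energies and source included, is at most a constant times the squared norm of the initial data. -/
theorem exists_cascade_isNObs (hadm : Admissible BB) (hT : 0 < T) (D : H →L[𝕜] H) :
    ∃ K : ℝ, 0 ≤ K ∧ ∀ W : PiLp 2 (fun _ : Fin 4 => H), ∃ φ : ℝ → G,
      IsNObs BB T (cascadeX (eigenbasis hA) (weight hA 1) D W)
        (cascadeZ (eigenbasis hA) (weight hA 1) D W) φ ∧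
      ∫ t in (0 : ℝ)..T, ‖φ t‖ ^ 2 ≤ K * ‖W‖ ^ 2 := by
  obtain ⟨c, hc, hadm⟩ := hadm T hT
  set m := 1 + 2 * T ^ 2 * ‖D‖ ^ 2 with hm
  refine ⟨c * (m + m + T * m + T * ‖D‖ ^ 2), by positivity, fun W => ?_⟩
  have hw := isWave_of_isRot (k := k) (isCascade_cascade (b := eigenbasis hA) (μ := weight hA 1)
    (D := D) W T).2
  have hf : L2On T fun t =>
      (Apow hA k).symm (-D (rotX (eigenbasis hA) (weight hA 1) 0 (W 0) (W 1) t)) :=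
    ContinuousOn.l2On ((Apow hA k).symm.continuous.comp (continuous_cascadeSource W)).continuousOn
  obtain ⟨φ, hφ, hle⟩ := hadm _ _ _ _ _ hf hw
  refine ⟨φ, hφ, hle.trans ?_⟩
  have hsrc : ∫ t in (0 : ℝ)..T, ‖(Apow hA k).symm
      (-D (rotX (eigenbasis hA) (weight hA 1) 0 (W 0) (W 1) t))‖ ^ 2 ≤
      T * (‖D‖ ^ 2 * ‖W‖ ^ 2) := by
    have h1 := intervalIntegral.integral_mono_on hT.le (hf.intervalIntegrable_sq hT.le)
      (intervalIntegrable_const (c := ‖D‖ ^ 2 * ‖W‖ ^ 2)) fun t ht => by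
        rw [LinearIsometryEquiv.norm_map]
        exact norm_cascadeSource_sq_le W ht
    rwa [intervalIntegral.integral_const, smul_eq_mul, sub_zero] at h1
  have hW : ‖W‖ ^ 2 = ‖W 0‖ ^ 2 + ‖W 1‖ ^ 2 + ‖W 2‖ ^ 2 + ‖W 3‖ ^ 2 := by
    rw [PiLp.norm_sq_eq_of_L2, Fin.sum_univ_four]
  have he : ∀ t ∈ Set.Icc 0 T, energy
      ((Apow hA (k + 1)).symm (cascadeX (eigenbasis hA) (weight hA 1) D W t))
      ((Apow hA k).symm (cascadeZ (eigenbasis hA) (weight hA 1) D W t)) ≤ m * ‖W‖ ^ 2 := by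
    intro t ht
    have h1 := hw.energy_le hf hT ht
    have h2 : energy
        ((Apow hA (k + 1)).symm (cascadeX (eigenbasis hA) (weight hA 1) D W 0))
        ((Apow hA k).symm (cascadeZ (eigenbasis hA) (weight hA 1) D W 0)) ≤ ‖W‖ ^ 2 / 2 := by
      rw [energy, LinearIsometryEquiv.norm_map, LinearIsometryEquiv.norm_map, cascadeX, cascadeZ,
        rotX_zero, rotZ_zero, hW]
      nlinarith [sq_nonneg ‖W 0‖, sq_nonneg ‖W 1‖]
    refine h1.trans ?_
    calc _ ≤ 2 * (‖W‖ ^ 2 / 2) + 2 * T * (T * (‖D‖ ^ 2 * ‖W‖ ^ 2)) := by gcongr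
      _ = m * ‖W‖ ^ 2 := by rw [hm]; ring
  have hint : ∫ t in (0 : ℝ)..T, energy
      ((Apow hA (k + 1)).symm (cascadeX (eigenbasis hA) (weight hA 1) D W t))
      ((Apow hA k).symm (cascadeZ (eigenbasis hA) (weight hA 1) D W t)) ≤ T * (m * ‖W‖ ^ 2) := by
    have h1 := intervalIntegral.integral_mono_on hT.le
      (intervalIntegrable_of_continuousOn hT.le hw.continuousOn_energy)
      (intervalIntegrable_const (c := m * ‖W‖ ^ 2)) he
    rwa [intervalIntegral.integral_const, smul_eq_mul, sub_zero] at h1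
  calc _ ≤ c * (m * ‖W‖ ^ 2 + m * ‖W‖ ^ 2 + T * (m * ‖W‖ ^ 2) + T * (‖D‖ ^ 2 * ‖W‖ ^ 2)) := by
        have h0 := he 0 ⟨le_rfl, hT.le⟩
        have h1 := he T ⟨hT.le, le_rfl⟩
        gcongr
    _ = _ := by ring

theorem IsNObs.add_smul {x z x' z' : ℝ → H} {φ φ' : ℝ → G} (hT : 0 ≤ T) (h : IsNObs BB T x z φ)
    (h' : IsNObs BB T x' z' φ') (hx : ContinuousOn x (Set.Icc 0 T))
    (hz : ContinuousOn z (Set.Icc 0 T)) (hx' : ContinuousOn x' (Set.Icc 0 T))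
    (hz' : ContinuousOn z' (Set.Icc 0 T)) (c : 𝕜) :
    IsNObs BB T (fun t => x t + c • x' t) (fun t => z t + c • z' t) (fun t => φ t + c • φ' t) := by
  have aux : ∀ (s : ℤ) {u : ℝ → H}, ContinuousOn u (Set.Icc 0 T) → ∀ i,
      IntervalIntegrable (fun t => ((Apow hA s).symm (u t)).coeff i) volume 0 T := fun s u hu =>
    intervalIntegrable_coeff (intervalIntegrable_of_continuousOn hT
      ((Apow hA s).symm.continuous.comp_continuousOn hu))
  refine (IsObs.add_smul hT h h' (aux _ hx) (aux _ hz) (aux _ hx') (aux _ hz') c).congr hT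
    (fun t _ => ?_) (fun t _ => ?_)
  · funext i
    rw [map_add, map_smul, coeff_add, coeff_smul]
  · funext i
    rw [map_add, map_smul, coeff_add, coeff_smul]

/-- Observations are first chosen arbitrarily for each initial datum. Uniqueness almost everywhere
makes their classes in L² depend linearly on the datum, and the admissibility bound gives
continuity. -/
theorem exists_observationMap (hadm : Admissible BB) (hT : 0 < T) (D : H →L[𝕜] H) :
    ∃ Ψ : PiLp 2 (fun _ : Fin 4 => H) →L[𝕜] Lp G 2 (volume.restrict (Set.Ioo 0 T)), ∀ W,
      IsNObs BB T (cascadeX (eigenbasis hA) (weight hA 1) D W)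
        (cascadeZ (eigenbasis hA) (weight hA 1) D W) (Ψ W) := by
  obtain ⟨K, hK, h⟩ := exists_cascade_isNObs hadm hT D
  choose φ hφ hle using h
  have hae : ∀ W, ((hφ W).1.toLp : ℝ → G) =ᵐ[volume.restrict (Set.Ioo 0 T)] φ W := fun W =>
    (hφ W).1.coeFn_toLp
  have hlin : ∀ (W W' : PiLp 2 (fun _ : Fin 4 => H)) (c : 𝕜),
      (hφ (W + c • W')).1.toLp = (hφ W).1.toLp + c • (hφ W').1.toLp := by
    intro W W' c
    have hc := (isCascade_cascade (b := eigenbasis hA) (μ := weight hA 1) (D := D) W T).2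
    have hc' := (isCascade_cascade (b := eigenbasis hA) (μ := weight hA 1) (D := D) W' T).2
    have h1 := (hφ W).add_smul hT.le (hφ W') hc.cont_fst hc.cont_snd hc'.cont_fst hc'.cont_snd c
    have h2 : IsNObs BB T (fun t => cascadeX (eigenbasis hA) (weight hA 1) D W t +
          c • cascadeX (eigenbasis hA) (weight hA 1) D W' t)
        (fun t => cascadeZ (eigenbasis hA) (weight hA 1) D W t +
          c • cascadeZ (eigenbasis hA) (weight hA 1) D W' t) (φ (W + c • W')) := by
      have := hφ (W + c • W')
      rwa [show cascadeX (eigenbasis hA) (weight hA 1) D (W + c • W') = _ from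
        funext fun t => (cascade_add_smul W W' c t).1,
        show cascadeZ (eigenbasis hA) (weight hA 1) D (W + c • W') = _ from
        funext fun t => (cascade_add_smul W W' c t).2] at this
    refine Lp.ext ?_
    filter_upwards [hae (W + c • W'), hae W, hae W', IsObs.ae_eq hT.le h2 h1,
      Lp.coeFn_add (hφ W).1.toLp (c • (hφ W').1.toLp), Lp.coeFn_smul c (hφ W').1.toLp]
      with t e1 e2 e3 e4 e5 e6
    rw [e1, e4, e5, Pi.add_apply, e6, Pi.smul_apply, e2, e3]
  have h0 : (hφ 0).1.toLp = 0 := by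
    have := hlin 0 0 (-1)
    simpa using this
  let Ψ : PiLp 2 (fun _ : Fin 4 => H) →ₗ[𝕜] Lp G 2 (volume.restrict (Set.Ioo 0 T)) :=
    { toFun := fun W => (hφ W).1.toLp
      map_add' := fun W W' => by simpa using hlin W W' 1
      map_smul' := fun c W => by simpa [h0] using hlin 0 W c }
  have hbd : ∀ W, ‖Ψ W‖ ≤ √K * ‖W‖ := by
    intro W
    have h1 : ‖(hφ W).1.toLp‖ ^ 2 ≤ K * ‖W‖ ^ 2 := by
      rw [norm_sq_toLp 𝕜 hT.le]
      refine le_trans (le_of_eq ?_) (hle W)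
      refine intervalIntegral.integral_congr_ae ?_
      have := hae W
      rw [Filter.EventuallyEq, ae_restrict_iff' measurableSet_Ioo] at this
      -- Interval integrals live on (0, T], the L² space on (0, T); the endpoint is negligible.
      have hne : ∀ᵐ t : ℝ, t ≠ T := by simp [ae_iff]
      filter_upwards [this, hne] with t ht hne hm
      rw [Set.uIoc_of_le hT.le] at hm
      rw [ht ⟨hm.1, lt_of_le_of_ne hm.2 hne⟩]
    change ‖(hφ W).1.toLp‖ ≤ _
    refine le_of_sq_le_sq ?_ (by positivity)
    rwa [mul_pow, Real.sq_sqrt hK]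
  refine ⟨Ψ.mkContinuous (√K) hbd, fun W => ⟨Lp.memLp _, fun ψ hψ hc hs => ?_⟩⟩
  obtain ⟨x, y, hx, hy, hg⟩ := (hφ W).2 ψ hψ hc hs
  refine ⟨x, y, hx, hy, fun g => (hg g).trans ?_⟩
  rw [intervalIntegral.integral_of_le hT.le, intervalIntegral.integral_of_le hT.le,
    integral_Ioc_eq_integral_Ioo, integral_Ioc_eq_integral_Ioo]
  refine integral_congr_ae ?_
  have e : (Ψ.mkContinuous (√K) hbd W : ℝ → G) =ᵐ[volume.restrict (Set.Ioo 0 T)] φ W := hae W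
  filter_upwards [e] with t ht
  rw [ht]

/-- The observation of a solution of the dual system on `[0, θ]` is given by the observation map
on `(0, T)`, as far as both are defined. -/
theorem integral_observation_eq {D : H →L[𝕜] H} (hT : 0 < T)
    {Ψ : PiLp 2 (fun _ : Fin 4 => H) →L[𝕜] Lp G 2 (volume.restrict (Set.Ioo 0 T))}
    (hΨ : ∀ W, IsNObs BB T (cascadeX (eigenbasis hA) (weight hA 1) D W)
        (cascadeZ (eigenbasis hA) (weight hA 1) D W) (Ψ W)) {θ : ℝ} (hθ : 0 < θ)
    {x₁ z₁ x₂ z₂ : ℝ → H}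
    (hW : IsCascade (eigenbasis hA) (weight hA 1) D θ x₁ z₁ x₂ z₂) {φ : ℝ → G}
    (hφ : IsNObs BB θ x₂ z₂ φ) (v : ℝ → G) :
    ∫ t in (0 : ℝ)..θ, (inner 𝕜 ((Set.Ioo 0 T).indicator v t) (φ t) : 𝕜) =
      ∫ t in (0 : ℝ)..θ, inner 𝕜 ((Set.Ioo 0 T).indicator v t)
        (Ψ !₂[x₁ 0, z₁ 0, x₂ 0, z₂ 0] t) := by
  set W : PiLp 2 (fun _ : Fin 4 => H) := !₂[x₁ 0, z₁ 0, x₂ 0, z₂ 0]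
  -- The control vanishes outside (0, T), so the observations need only agree up to min θ T, where
  -- both are defined.
  have hS : 0 ≤ min θ T := le_min hθ.le hT.le
  have h1 := IsObs.comp_add hφ (a := 0) (S := min θ T) le_rfl (by simp)
  have h2 := IsObs.comp_add (hΨ W) (a := 0) (S := min θ T) le_rfl (by simp)
  simp only [zero_add] at h1 h2
  have h3 := IsObs.ae_eq hS h1 (h2.congr hS
    (fun t ht => by rw [(hW.eq_cascade ⟨ht.1, ht.2.trans (min_le_left _ _)⟩).1])
    (fun t ht => by rw [(hW.eq_cascade ⟨ht.1, ht.2.trans (min_le_left _ _)⟩).2]))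
  rw [Filter.EventuallyEq, ae_restrict_iff' measurableSet_Ioo] at h3
  refine intervalIntegral.integral_congr_ae ?_
  have hne : ∀ᵐ t : ℝ, t ≠ θ := by simp [ae_iff]
  filter_upwards [h3, hne] with t ht hne hm
  rw [Set.uIoc_of_le hθ.le] at hm
  by_cases hmem : t ∈ Set.Ioo 0 T
  · rw [ht ⟨hm.1, lt_min (lt_of_le_of_ne hm.2 hne) hmem.2⟩]
  · simp [hmem]

end ObservationMap

end Cascade

/-! ### Lower bound for the observation map, and control by transposition -/

namespace Cascade

open MeasureTheory

section ObservationMap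

variable {𝕜 H : Type*} [RCLike 𝕜] [NormedAddCommGroup H] [InnerProductSpace 𝕜 H] [CompleteSpace H]
  [NormedSpace ℝ H]

/-- The primitive of a free solution is a free solution. -/
theorem IsRot.primitive {ι : Type*} {b : HilbertBasis ι 𝕜 H} {μ : ι → ℝ} {T : ℝ} {x z : ℝ → H}
    (h : IsRot b μ T 0 x z) : IsRot b μ T 0 (fun t => -z t) x := by
  refine ⟨h.cont_snd.neg, h.cont_fst, fun t ht i => ?_, fun t ht i => ?_⟩
  · have e := h.eq_snd t ht i
    simp only [Pi.zero_apply, map_zero, lp.coeFn_zero, zero_sub, intervalIntegral.integral_neg] at e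
    simp only [map_neg, lp.coeFn_neg, Pi.neg_apply]
    rw [e]
    ring
  · have e := h.eq_fst t ht i
    simp only [map_neg, lp.coeFn_neg, Pi.neg_apply, Pi.zero_apply, map_zero, lp.coeFn_zero,
      zero_sub, mul_neg, neg_neg]
    exact e

variable {A : H →ₗ.[𝕜] H} {hA : WaveOperator A}
  {G : Type*} [NormedAddCommGroup G] [InnerProductSpace 𝕜 G] [CompleteSpace G]
  {k : ℤ} {BB : Hs hA (k + 2) × Hs hA k →L[𝕜] G} {T : ℝ}

/-- Normalized observability combined with the uniform constants: the coupling inequality is used at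
level 0 for the first pair, the observation inequality at level k for the second. -/
theorem observationMap_bounded_below {C : Hs hA k →L[𝕜] Hs hA k} {P : H →L[𝕜] H}
    {α β γ a₀ τ : ℝ} (hC : PartiallyCoercive C P α β) (hu : UniformConstants BB P τ γ a₀)
    (hT : minimalTime α β γ a₀ τ < T)
    {Ψ : PiLp 2 (fun _ : Fin 4 => H) →L[𝕜] Lp G 2 (volume.restrict (Set.Ioo 0 T))}
    (hΨ : ∀ W, IsNObs BB T (cascadeX (eigenbasis hA) (weight hA 1) (conjC C) W)
        (cascadeZ (eigenbasis hA) (weight hA 1) (conjC C) W) (Ψ W)) :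
    ∃ c : ℝ, 0 < c ∧ ∀ W, c * ‖W‖ ≤ ‖Ψ W‖ := by
  have hτT : τ < T := (le_max_left _ _).trans_lt hT
  have hT1 : √(2 * 128 * a₀) * β * γ / α < T :=
    ((le_max_left _ _).trans (le_max_right _ _)).trans_lt hT
  have hT0 : 0 < T := hu.T₀_pos.trans hτT
  obtain ⟨η, hη, hobs⟩ := hu.observation
  have hβ := hC.norm_eq
  obtain ⟨K, hK, key⟩ := cascade_observability (b := eigenbasis hA) (μ := weight hA 1) P hC.pos
    hu.γ_pos hu.a₀_pos hη hT0 (by rw [hβ]; exact hT1) (by rw [hβ]; exact hC.sq_le)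
    hC.partial_coercive
  refine ⟨1 / √K, by positivity, fun W => ?_⟩
  have hW : ‖W‖ ^ 2 = ‖W 0‖ ^ 2 + ‖W 1‖ ^ 2 + ‖W 2‖ ^ 2 + ‖W 3‖ ^ 2 := by
    rw [PiLp.norm_sq_eq_of_L2, Fin.sum_univ_four]
  obtain ⟨h₁, h₂⟩ := isCascade_cascade (b := eigenbasis hA) (μ := weight hA 1) (D := conjC C) W T
  have e := key _ _ _ _ (‖Ψ W‖ ^ 2) h₁ h₂ ?_ ?_
  · rw [cascadeX, cascadeZ, rotX_zero, rotZ_zero, rotX_zero, rotZ_zero, ← hW] at e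
    rw [one_div, inv_mul_le_iff₀ (by positivity)]
    refine le_of_sq_le_sq ?_ (by positivity)
    rwa [mul_pow, Real.sq_sqrt hK.le]
  -- The coupling inequality observes velocities, whereas the coupling acts on x₁. The primitive
  -- (-z₁, x₁) has x₁ as its velocity and the same energy.
  · have hw := isWave_of_isRot (hA := hA) (k := 0) h₁.primitive
    simp only [Pi.zero_apply, map_zero] at hw
    have h := hu.coupling T hτT _ _ _ _ hw
    simp only [LinearIsometryEquiv.apply_symm_apply, energy, LinearIsometryEquiv.norm_map,
      norm_neg] at h
    linarith
  · have hw := isWave_of_isRot (hA := hA) (k := k) h₂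
    have hf : L2On T fun t =>
        (Apow hA k).symm (-conjC C (rotX (eigenbasis hA) (weight hA 1) 0 (W 0) (W 1) t)) :=
      ContinuousOn.l2On
        ((Apow hA k).symm.continuous.comp (continuous_cascadeSource W)).continuousOn
    have h := hobs T hτT _ _ _ _ _ _ hf hw (hΨ W)
    simp only [energy, LinearIsometryEquiv.norm_map, norm_neg] at h
    rw [norm_sq_toLp 𝕜 hT0.le]
    exact h

end ObservationMap

section DualSystem

variable {𝕜 H : Type*} [RCLike 𝕜] [NormedAddCommGroup H] [InnerProductSpace 𝕜 H] [CompleteSpace H]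
  {A : H →ₗ.[𝕜] H} {hA : WaveOperator A}

theorem pairing_eq_inner_of_add_eq_zero {s r : ℤ} (h : s + r = 0) (x : Hs hA s) (y : Hs hA r) :
    pairing x.coeff y.coeff = inner 𝕜 (Apow hA s x) (Apow hA r y) := by
  obtain rfl : s = -r := by omega
  exact pairing_eq_inner hA r x y

theorem bracket_eq_nbracket {a b c d a' b' c' d' : ℤ} (hac : c' + a = 0) (hca : a' + c = 0)
    (hbd : d' + b = 0) (hdb : b' + d = 0) (Y : Hs hA a' × Hs hA b' × Hs hA c' × Hs hA d')
    (W : Hs hA a × Hs hA b × Hs hA c × Hs hA d) :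
    bracket Y W = nbracket (Apow hA a' Y.1) (Apow hA b' Y.2.1) (Apow hA c' Y.2.2.1)
      (Apow hA d' Y.2.2.2) (Apow hA a W.1) (Apow hA c W.2.2.1) (Apow hA b W.2.1)
      (Apow hA d W.2.2.2) := by
  rw [bracket, nbracket, pairing_eq_inner_of_add_eq_zero hac, pairing_eq_inner_of_add_eq_zero hca, pairing_eq_inner_of_add_eq_zero hbd,
    pairing_eq_inner_of_add_eq_zero hdb]

/-- The hypothesis `hD` says that D is A^{d/2} C A^{-a/2}, with C extended by transposition. Leaving
the levels free allows one proof for both X_{1,k} and X_{-1,k}. -/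
theorem isDual_iff_isCascade {k a b c d : ℤ} {C : Hs hA k →L[𝕜] Hs hA k} (hac : a = c + 1)
    (hbd : b = d + 1) {D : H →L[𝕜] H}
    (hD : ∀ (w : Hs hA a) i,
      (eigenbasis hA).repr (D (Apow hA a w)) i = (weight hA d i : 𝕜) * extC C w.coeff i)
    {T : ℝ} {W : ℝ → Hs hA a × Hs hA b × Hs hA c × Hs hA d} :
    IsDual C T W ↔ IsCascade (eigenbasis hA) (weight hA 1) D T (fun t => Apow hA a (W t).1)
      (fun t => Apow hA c (W t).2.2.1) (fun t => Apow hA b (W t).2.1)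
      (fun t => Apow hA d (W t).2.2.2) := by
  have e1 := isRot_iff_solvesWave hac (T := T) (w := fun t => (W t).1) (z := fun t => (W t).2.2.1)
    (f := 0) (F := 0) (fun t _ i => by simp)
  have e2 := isRot_iff_solvesWave hbd (T := T) (w := fun t => (W t).2.1)
    (z := fun t => (W t).2.2.2) (f := fun t => -D (Apow hA a (W t).1))
    (F := fun t => -extC C (W t).1.coeff) (fun t _ i => by
      rw [map_neg, lp.coeFn_neg, Pi.neg_apply, hD, Pi.neg_apply, mul_neg])
  constructor
  · intro h
    have hc := h.continuousOn
    exact ⟨e1.2 ⟨hc.fst, hc.snd.snd.fst, h.first⟩, e2.2 ⟨hc.snd.fst, hc.snd.snd.snd, h.second⟩⟩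
  · rintro ⟨h1, h2⟩
    obtain ⟨c1, c3, s1⟩ := e1.1 h1
    obtain ⟨c2, c4, s2⟩ := e2.1 h2
    exact ⟨c1.prodMk (c2.prodMk (c3.prodMk c4)), s1, s2⟩

/-- The solutions of the dual system with given final data. -/
theorem exists_isCascade_final [NormedSpace ℝ H] {ι : Type*} (b : HilbertBasis ι 𝕜 H) (μ : ι → ℝ)
    (D : H →L[𝕜] H) (T : ℝ) (X₁ Z₁ X₂ Z₂ : H) :
    ∃ x₁ z₁ x₂ z₂ : ℝ → H, IsCascade b μ D T x₁ z₁ x₂ z₂ ∧ x₁ T = X₁ ∧ z₁ T = Z₁ ∧ x₂ T = X₂ ∧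
      z₂ T = Z₂ := by
  -- The flow is defined for all real times, so the final data are taken as data at time 0 and the
  -- solution is translated by T.
  refine ⟨_, _, _, _, ⟨isRot_rot_shift (b := b) (μ := μ) (f := 0) continuous_const X₁ Z₁ T T,
    isRot_rot_shift (f := fun t => -D (rotX b μ 0 X₁ Z₁ t))
      (D.continuous.comp (continuous_rotX continuous_const _ _)).neg X₂ Z₂ T T⟩, ?_⟩
  simp

theorem nbracket_eq_zero {ξ₁ ξ₂ ζ₁ ζ₂ : H}
    (h : ∀ x₁ z₁ x₂ z₂ : H, nbracket (𝕜 := 𝕜) ξ₁ ξ₂ ζ₁ ζ₂ x₁ z₁ x₂ z₂ = 0) :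
    ξ₁ = 0 ∧ ξ₂ = 0 ∧ ζ₁ = 0 ∧ ζ₂ = 0 := by
  simp only [nbracket] at h
  refine ⟨?_, ?_, ?_, ?_⟩
  · simpa using h 0 ξ₁ 0 0
  · simpa using h 0 0 0 ξ₂
  · simpa using h ζ₁ 0 0 0
  · simpa using h 0 0 ζ₂ 0

/-- Exact controllability by transposition, for an observation map which is bounded below. -/
theorem exists_transposition_control {G : Type*} [NormedAddCommGroup G] [InnerProductSpace 𝕜 G]
    [CompleteSpace G] {k a b c d a' b' c' d' : ℤ} {C : Hs hA k →L[𝕜] Hs hA k} (hac : a = c + 1)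
    (hbd : b = d + 1) (hac' : c' + a = 0) (hca' : a' + c = 0) (hbd' : d' + b = 0)
    (hdb' : b' + d = 0) {D : H →L[𝕜] H}
    (hD : ∀ (w : Hs hA a) i,
      (eigenbasis hA).repr (D (Apow hA a w)) i = (weight hA d i : 𝕜) * extC C w.coeff i)
    {T : ℝ} (hT : 0 < T)
    (Ψ : PiLp 2 (fun _ : Fin 4 => H) →L[𝕜] Lp G 2 (volume.restrict (Set.Ioo 0 T))) {m : ℝ}
    (hm : 0 < m) (hΨ : ∀ W, m * ‖W‖ ≤ ‖Ψ W‖)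
    (Y₀ : Hs hA a' × Hs hA b' × Hs hA c' × Hs hA d') :
    ∃ v : ℝ → G, L2On T v ∧
      (∃ Y : ℝ → Hs hA a' × Hs hA b' × Hs hA c' × Hs hA d', Continuous Y ∧
        ∀ θ : ℝ, 0 < θ → ∀ W : ℝ → Hs hA a × Hs hA b × Hs hA c × Hs hA d, IsDual C θ W →
        ∫ t in (0 : ℝ)..θ, inner 𝕜 ((Set.Ioo 0 T).indicator v t)
          (Ψ !₂[Apow hA a (W 0).1, Apow hA c (W 0).2.2.1, Apow hA b (W 0).2.1,
            Apow hA d (W 0).2.2.2] t) = bracket (Y θ) (W θ) - bracket Y₀ (W 0)) ∧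
      ∀ y : Hs hA a' × Hs hA b' × Hs hA c' × Hs hA d',
        (∀ W : ℝ → Hs hA a × Hs hA b × Hs hA c × Hs hA d, IsDual C T W →
          ∫ t in (0 : ℝ)..T, inner 𝕜 ((Set.Ioo 0 T).indicator v t)
          (Ψ !₂[Apow hA a (W 0).1, Apow hA c (W 0).2.2.1, Apow hA b (W 0).2.1,
            Apow hA d (W 0).2.2.2] t) = bracket y (W T) - bracket Y₀ (W 0)) → y = 0 := by
  let _ : NormedSpace ℝ H := NormedSpace.restrictScalars ℝ 𝕜 H
  obtain ⟨v, ξ₁, ξ₂, ζ₁, ζ₂, hv, c1, c2, c3, c4, h0, hid⟩ :=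
    exists_cascade_control (b := eigenbasis hA) (μ := weight hA 1) (D := D) hT Ψ hm hΨ
      (Apow hA a' Y₀.1) (Apow hA b' Y₀.2.1) (Apow hA c' Y₀.2.2.1) (Apow hA d' Y₀.2.2.2)
  refine ⟨v, hv, ⟨fun θ => ((Apow hA a').symm (ξ₁ θ), (Apow hA b').symm (ξ₂ θ),
    (Apow hA c').symm (ζ₁ θ), (Apow hA d').symm (ζ₂ θ)), ?_, ?_⟩, ?_⟩
  · exact ((Apow hA a').symm.continuous.comp c1).prodMk
      (((Apow hA b').symm.continuous.comp c2).prodMk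
        (((Apow hA c').symm.continuous.comp c3).prodMk ((Apow hA d').symm.continuous.comp c4)))
  · intro θ hθ W hW
    rw [bracket_eq_nbracket hac' hca' hbd' hdb', bracket_eq_nbracket hac' hca' hbd' hdb']
    simp only [LinearIsometryEquiv.apply_symm_apply]
    exact hid θ hθ.le _ _ _ _ ((isDual_iff_isCascade hac hbd hD).1 hW)
  · intro y hy
    -- The control makes the observation integral equal to minus the bracket of the initial data, so
    -- the identity at T leaves only the bracket of y with the final data. These are arbitrary,
    -- which forces y = 0.
    have hz : ∀ X₁ Z₁ X₂ Z₂ : H, nbracket (𝕜 := 𝕜) (Apow hA a' y.1) (Apow hA b' y.2.1)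
        (Apow hA c' y.2.2.1) (Apow hA d' y.2.2.2) X₁ Z₁ X₂ Z₂ = 0 := by
      intro X₁ Z₁ X₂ Z₂
      obtain ⟨x₁, z₁, x₂, z₂, hW, rfl, rfl, rfl, rfl⟩ :=
        exists_isCascade_final (eigenbasis hA) (weight hA 1) D T X₁ Z₁ X₂ Z₂
      have e := hy (fun t => ((Apow hA a).symm (x₁ t), (Apow hA b).symm (x₂ t),
        (Apow hA c).symm (z₁ t), (Apow hA d).symm (z₂ t)))
        ((isDual_iff_isCascade hac hbd hD).2
          (by simpa only [LinearIsometryEquiv.apply_symm_apply] using hW))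
      rw [bracket_eq_nbracket hac' hca' hbd' hdb', bracket_eq_nbracket hac' hca' hbd' hdb'] at e
      simp only [LinearIsometryEquiv.apply_symm_apply] at e
      rw [h0] at e
      linear_combination (-1 : 𝕜) * e
    obtain ⟨e1, e2, e3, e4⟩ := nbracket_eq_zero hz
    simp only [LinearIsometryEquiv.map_eq_zero_iff] at e1 e2 e3 e4
    exact Prod.ext e1 (Prod.ext e2 (Prod.ext e3 e4))

/-- `C` extended by transposition is `C` on `H_k`. -/
theorem extC_coeff {k : ℤ} (C : Hs hA k →L[𝕜] Hs hA k) (x : Hs hA k) (i : Idx hA) :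
    extC C x.coeff i = (C x).coeff i := by
  classical
  -- In matrix terms C* is the conjugate transpose; transposing once more returns row i of C, to be
  -- summed against the eigenvector expansion of x.
  have h1 : ∀ j, adjC C (eigenvec hA (-k) i).coeff j =
      (starRingEnd 𝕜) ((C (eigenvec hA k j)).coeff i) := fun j => by
    rw [adjC, coeff_eigenvec, pairing, tsum_eq_single i fun m hm => by simp [hm]]
    simp
  have hs : HasSum (fun j => x.coeff j • eigenvec hA k j) x := by
    have h := ((eigenbasis hA).hasSum_repr (Apow hA k x)).mapL
      ((Apow hA k).symm.toContinuousLinearEquiv : H →L[𝕜] Hs hA k)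
    have e : ((Apow hA k).symm.toContinuousLinearEquiv : H →L[𝕜] Hs hA k) (Apow hA k x) = x :=
      (Apow hA k).symm_apply_apply x
    rw [e] at h
    convert! h using 1
    funext j
    have e2 : ((Apow hA k).symm.toContinuousLinearEquiv : H →L[𝕜] Hs hA k)
        ((eigenbasis hA).repr (Apow hA k x) j • eigenbasis hA j) =
        (Apow hA k).symm ((eigenbasis hA).repr (Apow hA k x) j • eigenbasis hA j) := rfl
    rw [e2, repr_Apow, eigenvec, ← map_smul, smul_smul, mul_comm]
  have h2 := hs.mapL (((coordL (eigenbasis hA) i) ∘L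
    ((Apow hA k).toContinuousLinearEquiv : Hs hA k →L[𝕜] H)) ∘L C)
  have e3 : ∀ y : Hs hA k, (((coordL (eigenbasis hA) i) ∘L
      ((Apow hA k).toContinuousLinearEquiv : Hs hA k →L[𝕜] H)) ∘L C) y =
      (weight hA k i : 𝕜) * (C y).coeff i := fun y => by
    rw [← repr_Apow, ← coordL_apply]
    rfl
  simp only [e3, map_smul, coeff_smul] at h2
  have h3 := h2.mul_left ((weight hA k i : 𝕜)⁻¹)
  rw [inv_mul_cancel_left₀ (weight_ne_zero hA k i)] at h3
  rw [← h3.tsum_eq, extC, pairing]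
  refine tsum_congr fun j => ?_
  rw [h1, inv_mul_cancel_left₀ (weight_ne_zero hA k i), RCLike.inner_apply, RCLike.conj_conj]

theorem repr_conjC {k : ℤ} (C : Hs hA k →L[𝕜] Hs hA k) (w : Hs hA k) (i : Idx hA) :
    (eigenbasis hA).repr (conjC C (Apow hA k w)) i = (weight hA k i : 𝕜) * extC C w.coeff i := by
  have e : conjC C (Apow hA k w) = Apow hA k (C w) := by
    change Apow hA k (C ((Apow hA k).symm (Apow hA k w))) = _
    rw [LinearIsometryEquiv.symm_apply_apply]
  rw [e, repr_Apow, extC_coeff]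

/-- The operator `A ^ ((k - 1) / 2) C A ^ ((1 - k) / 2)` of `H`. -/
theorem exists_conjC_pred {k : ℤ} {C : Hs hA k →L[𝕜] Hs hA k} (hC : BoundedOn (adjC C) (1 - k)) :
    ∃ D : H →L[𝕜] H, ∀ (w : Hs hA (k - 1)) i, (eigenbasis hA).repr (D (Apow hA (k - 1) w)) i =
      (weight hA (k - 1) i : 𝕜) * extC C w.coeff i := by
  classical
  obtain ⟨L, hL⟩ := hC
  set R : H →L[𝕜] H := ((Apow hA (1 - k)).toContinuousLinearEquiv : Hs hA (1 - k) →L[𝕜] H) ∘L L ∘L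
    ((Apow hA (1 - k)).symm.toContinuousLinearEquiv : H →L[𝕜] Hs hA (1 - k))
  -- `R` is A^{(1-k)/2} C* A^{(k-1)/2}, bounded because C* is bounded on H_{1-k}; its Hilbert
  -- adjoint is the conjugate of C at level k - 1.
  refine ⟨R.adjoint, fun w i => ?_⟩
  have e1 : (eigenvec hA (-k) i).coeff = (eigenvec hA (1 - k) i).coeff := by
    rw [coeff_eigenvec, coeff_eigenvec]
  have e2 : Apow hA (1 - k) (L (eigenvec hA (1 - k) i)) =
      R ((weight hA (1 - k) i : 𝕜) • eigenbasis hA i) := rfl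
  have e3 : (weight hA (k - 1) i : 𝕜) * (weight hA (1 - k) i : 𝕜) = 1 := by
    rw [← RCLike.ofReal_mul, show k - 1 = -(1 - k) by ring, weight_neg_mul, RCLike.ofReal_one]
  rw [extC, e1, ← hL, pairing_eq_inner_of_add_eq_zero (by ring), e2, ← ContinuousLinearMap.adjoint_inner_right,
    inner_smul_left, RCLike.conj_ofReal, ← mul_assoc, e3, one_mul, HilbertBasis.repr_apply_apply]

end DualSystem

end Cascade

/-! ### Case (i) by a primitive in time, and the two controllability results -/

namespace Cascade

open MeasureTheory

section Primitive

variable {𝕜 H ι : Type*} [RCLike 𝕜] [NormedAddCommGroup H] [InnerProductSpace 𝕜 H]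
  [CompleteSpace H] [NormedSpace ℝ H] {b : HilbertBasis ι 𝕜 H} {μ : ι → ℝ}

/-- A solution of the normalized dual system with coupling `E` is, up to a correction, the
derivative of a solution of the normalized dual system with coupling `D`, if
`E = Λ⁻¹ D Λ`. -/
theorem IsCascade.primitive {D E L : H →L[𝕜] H} (hμ : ∀ i, μ i ≠ 0)
    (hL : ∀ x i, b.repr (L x) i = ((μ i)⁻¹ : ℝ) * b.repr x i) (hcomm : ∀ y, E (L y) = L (D y))
    {T : ℝ} {x₁ z₁ x₂ z₂ : ℝ → H} (h : IsCascade b μ E T x₁ z₁ x₂ z₂) :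
    IsCascade b μ D T (fun t => -z₁ t) x₁ (fun t => -z₂ t + E (L (z₁ t))) x₂ := by
  obtain ⟨h₁, h₂⟩ := h
  have hμ' : ∀ i, (μ i : 𝕜) ≠ 0 := fun i => RCLike.ofReal_ne_zero.mpr (hμ i)
  refine ⟨h₁.primitive, h₂.cont_snd.neg.add
    ((E ∘L L).continuous.comp_continuousOn h₁.cont_snd), h₂.cont_fst, fun t ht i => ?_,
    fun t ht i => ?_⟩
  · have ht0 := ht.1
    have hsub : Set.Icc 0 t ⊆ Set.Icc 0 T := Set.Icc_subset_Icc_right ht.2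
    have hx₁ : IntervalIntegrable x₁ volume 0 t :=
      intervalIntegrable_of_continuousOn ht0 (h₁.cont_fst.mono hsub)
    have hx₂ : IntervalIntegrable (fun s => (μ i : 𝕜) * b.repr (x₂ s) i) volume 0 t :=
      intervalIntegrable_of_continuousOn ht0 (continuousOn_const.mul
        ((continuous_repr b i).comp_continuousOn (h₂.cont_fst.mono hsub)))
    have hE : IntervalIntegrable (fun s => b.repr (E (x₁ s)) i) volume 0 t :=
      intervalIntegrable_of_continuousOn ht0
        (((continuous_repr b i).comp E.continuous).comp_continuousOn (h₁.cont_fst.mono hsub))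
    -- Applying Λ⁻¹ to z₁' = -Λx₁ leaves an honest integral in H. Hence E L z₁ has derivative -E x₁,
    -- which cancels the source coming from -z₂.
    have e1 : L (z₁ t) = L (z₁ 0) - ∫ s in (0 : ℝ)..t, x₁ s := by
      refine repr_ext b fun j => ?_
      rw [map_sub, lp.coeFn_sub, Pi.sub_apply, repr_intervalIntegral b hx₁, hL, hL,
        h₁.eq_snd t ht j]
      simp only [Pi.zero_apply, map_zero, lp.coeFn_zero, zero_sub, intervalIntegral.integral_neg,
        intervalIntegral.integral_const_mul, RCLike.ofReal_inv]
      field_simp [hμ' j]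
      ring
    have e2 : b.repr (E (L (z₁ t))) i =
        b.repr (E (L (z₁ 0))) i - ∫ s in (0 : ℝ)..t, b.repr (E (x₁ s)) i := by
      have := (coordL b i ∘L E).intervalIntegral_comp_comm hx₁
      simp only [ContinuousLinearMap.comp_apply, coordL_apply] at this
      rw [this, e1, map_sub, map_sub, lp.coeFn_sub, Pi.sub_apply]
    have e3 := h₂.eq_snd t ht i
    simp only [map_neg, lp.coeFn_neg, Pi.neg_apply] at e3
    have e4 := intervalIntegral.integral_sub hE.neg hx₂
    simp only [Pi.neg_apply, intervalIntegral.integral_neg] at e4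
    rw [e4] at e3
    simp only [map_add, map_neg, lp.coeFn_add, lp.coeFn_neg, Pi.add_apply, Pi.neg_apply]
    rw [e2, e3]
    ring
  · rw [h₂.eq_fst t ht i]
    congr 1
    refine intervalIntegral.integral_congr fun s _ => ?_
    -- The relation reads ΛEL = D: the correction term reproduces exactly the source -D(-z₁)
    -- required of the primitive.
    have e := congrArg (fun y => (μ i : 𝕜) * b.repr y i) (hcomm (z₁ s))
    simp only [hL, RCLike.ofReal_inv, mul_inv_cancel_left₀ (hμ' i)] at e
    simp only [map_add, map_neg, lp.coeFn_add, lp.coeFn_neg, Pi.add_apply, Pi.neg_apply, neg_neg,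
      mul_add, mul_neg]
    rw [e]
    ring

/-- The passage to the primitive, on the initial data. -/
theorem exists_primitive_initial {E : H →L[𝕜] H} (L : H →L[𝕜] H) :
    ∃ (Q : PiLp 2 (fun _ : Fin 4 => H) →L[𝕜] PiLp 2 (fun _ : Fin 4 => H)) (m : ℝ), 0 < m ∧
      (∀ W, m * ‖W‖ ≤ ‖Q W‖) ∧
      ∀ x₁ z₁ x₂ z₂ : H, Q !₂[x₁, z₁, x₂, z₂] = !₂[-z₁, x₁, -z₂ + E (L z₁), x₂] := by
  let pr : Fin 4 → (PiLp 2 (fun _ : Fin 4 => H) →L[𝕜] H) := fun j =>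
    PiLp.proj 2 (fun _ : Fin 4 => H) j
  let mk : (Fin 4 → (PiLp 2 (fun _ : Fin 4 => H) →L[𝕜] H)) →
      (PiLp 2 (fun _ : Fin 4 => H) →L[𝕜] PiLp 2 (fun _ : Fin 4 => H)) := fun F =>
    ((PiLp.continuousLinearEquiv 2 𝕜 (fun _ : Fin 4 => H)).symm :
      (Fin 4 → H) →L[𝕜] PiLp 2 (fun _ : Fin 4 => H)) ∘L ContinuousLinearMap.pi F
  have hmk : ∀ F W j, mk F W j = F j W := fun F W j => rfl
  let Q := mk ![-pr 1, pr 0, -pr 3 + (E ∘L L) ∘L pr 1, pr 2]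
  -- An explicit bounded left inverse of Q, which gives the lower bound.
  let R := mk ![pr 1, -pr 0, pr 3, -pr 2 - (E ∘L L) ∘L pr 0]
  have hRQ : ∀ W, R (Q W) = W := fun W => by
    ext j
    fin_cases j <;> simp [R, Q, hmk, pr]
  refine ⟨Q, (‖R‖ + 1)⁻¹, by positivity, fun W => ?_, fun x₁ z₁ x₂ z₂ => ?_⟩
  · rw [inv_mul_le_iff₀ (by positivity)]
    calc ‖W‖ = ‖R (Q W)‖ := by rw [hRQ]
      _ ≤ ‖R‖ * ‖Q W‖ := R.le_opNorm _
      _ ≤ _ := by nlinarith [norm_nonneg (Q W)]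
  · ext j
    fin_cases j <;> simp [Q, hmk, pr]

end Primitive

section Coupling

variable {𝕜 H : Type*} [RCLike 𝕜] [NormedAddCommGroup H] [InnerProductSpace 𝕜 H] [CompleteSpace H]
  {A : H →ₗ.[𝕜] H} {hA : WaveOperator A}

variable (hA) in
/-- The operator `A ^ (-1 / 2)` of `H`. -/
theorem exists_inv_sqrt : ∃ L : H →L[𝕜] H, ∀ x i,
    (eigenbasis hA).repr (L x) i = ((weight hA 1 i)⁻¹ : ℝ) * (eigenbasis hA).repr x i := by
  obtain ⟨δ, hδ, hbd⟩ := hA.bounded_below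
  refine exists_diagonal (eigenbasis hA) (fun i => (weight hA 1 i)⁻¹) (M := (√δ)⁻¹) fun i => ?_
  rw [abs_of_pos (inv_pos.mpr (weight_pos hA 1 i))]
  refine inv_anti₀ (Real.sqrt_pos.mpr hδ) ?_
  obtain ⟨hl, h, e⟩ := eigenbasis_spec hA i
  have h1 := hbd ⟨_, h⟩
  rw [e, norm_smul, (eigenbasis hA).orthonormal.1 i, RCLike.norm_ofReal, abs_of_pos hl, mul_one,
    mul_one] at h1
  refine Real.sqrt_le_iff.mpr ⟨(weight_pos hA 1 i).le, ?_⟩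
  rw [sq, weight_one_mul_self]
  exact h1

/-- A^{(1-k)/2} Λ⁻¹ y and A^{-k/2} y are the same formal expansion, so both sides apply C to one
element and then normalize it at level k - 1, on the right through level k. -/
theorem inv_sqrt_conjC {k : ℤ} {C : Hs hA k →L[𝕜] Hs hA k} {E L : H →L[𝕜] H}
    (hE : ∀ (w : Hs hA (k - 1)) i, (eigenbasis hA).repr (E (Apow hA (k - 1) w)) i =
      (weight hA (k - 1) i : 𝕜) * extC C w.coeff i)
    (hL : ∀ x i,
      (eigenbasis hA).repr (L x) i = ((weight hA 1 i)⁻¹ : ℝ) * (eigenbasis hA).repr x i)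
    (y : H) : E (L y) = L (conjC C y) := by
  have hw : ∀ i, (weight hA k i : 𝕜) = (weight hA (k - 1) i : 𝕜) * (weight hA 1 i : 𝕜) := fun i => by
    rw [← RCLike.ofReal_mul, ← weight_add, sub_add_cancel]
  have e : ((Apow hA (k - 1)).symm (L y)).coeff = ((Apow hA k).symm y).coeff := by
    funext i
    rw [coeff_eq_repr, coeff_eq_repr, LinearIsometryEquiv.apply_symm_apply,
      LinearIsometryEquiv.apply_symm_apply, hL, hw, RCLike.ofReal_inv, mul_inv, mul_assoc]
  refine repr_ext (eigenbasis hA) fun i => ?_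
  have h1 := hE ((Apow hA (k - 1)).symm (L y)) i
  have h2 := repr_conjC C ((Apow hA k).symm y) i
  rw [LinearIsometryEquiv.apply_symm_apply, e] at h1
  rw [LinearIsometryEquiv.apply_symm_apply] at h2
  rw [h1, hL, h2, hw, RCLike.ofReal_inv, mul_comm (weight hA (k - 1) i : 𝕜) (weight hA 1 i : 𝕜),
    mul_assoc, inv_mul_cancel_left₀ (weight_ne_zero hA 1 i)]

end Coupling

section Control

variable {𝕜 H : Type*} [RCLike 𝕜] [NormedAddCommGroup H] [InnerProductSpace 𝕜 H] [CompleteSpace H]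
  {A : H →ₗ.[𝕜] H} {hA : WaveOperator A}
  {G : Type*} [NormedAddCommGroup G] [InnerProductSpace 𝕜 G] [CompleteSpace G] {k : ℤ}

/-- The observation `B* w'` of a solution is the function `B* w'`. -/
theorem isNObs_obsBounded [NormedSpace ℝ H] {B : G →L[𝕜] Hs hA (-k)}
    (hadm : Admissible (obsBounded hA k B)) {D : H →L[𝕜] H} {θ : ℝ} (hθ : 0 < θ)
    {x₁ z₁ x₂ z₂ : ℝ → H} (h : IsCascade (eigenbasis hA) (weight hA 1) D θ x₁ z₁ x₂ z₂) :
    IsNObs (obsBounded hA k B) θ x₂ z₂ fun t => adjB hA B ((Apow hA k).symm (z₂ t)) := by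
  have hB : Continuous fun y : H => adjB hA B ((Apow hA k).symm y) :=
    (adjB hA B).continuous.comp (Apow hA k).symm.continuous
  refine ⟨ContinuousOn.l2On (hB.comp_continuousOn h.2.cont_snd), fun ψ hψ hc hs => ?_⟩
  obtain ⟨Ψ, hΨ⟩ := exists_observationMap hadm hθ D
  have hΨ' := IsObs.congr hθ.le (hΨ !₂[x₁ 0, z₁ 0, x₂ 0, z₂ 0])
    (w' := fun t => ((Apow hA (k + 1)).symm (x₂ t)).coeff)
    (z' := fun t => ((Apow hA k).symm (z₂ t)).coeff)
    (fun t ht => by rw [(h.eq_cascade ht).1]) (fun t ht => by rw [(h.eq_cascade ht).2])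
  -- Admissibility is used only to place the averaged position in H_{k+2}. The averaged velocity is
  -- a Bochner integral, with which the bounded operator B* commutes.
  obtain ⟨x, y, hx, hy, -⟩ := hΨ'.2 ψ hψ hc hs
  refine ⟨x, y, hx, hy, fun g => ?_⟩
  have hint : IntervalIntegrable (fun t => (ψ t : 𝕜) • z₂ t) volume 0 θ :=
    intervalIntegrable_of_continuousOn hθ.le
      ((RCLike.continuous_ofReal.comp hψ.continuous).continuousOn.smul h.2.cont_snd)
  have ey : Apow hA k y = ∫ t in (0 : ℝ)..θ, (ψ t : 𝕜) • z₂ t := by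
    refine repr_ext (eigenbasis hA) fun i => ?_
    rw [repr_intervalIntegral _ hint, repr_Apow, hy, ← intervalIntegral.integral_const_mul]
    refine intervalIntegral.integral_congr fun t _ => ?_
    simp only [coeff_eq_repr, LinearIsometryEquiv.apply_symm_apply, map_smul, lp.coeFn_smul,
      Pi.smul_apply, smul_eq_mul]
    rw [mul_left_comm (ψ t : 𝕜), mul_inv_cancel_left₀ (weight_ne_zero hA k i)]
  let F : H →L[𝕜] 𝕜 := innerSL 𝕜 g ∘L adjB hA B ∘L
    ((Apow hA k).symm.toContinuousLinearEquiv : H →L[𝕜] Hs hA k)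
  have hF : ∀ u, F u = inner 𝕜 g (adjB hA B ((Apow hA k).symm u)) := fun u => rfl
  have e := F.intervalIntegral_comp_comm hint
  rw [← ey, hF, LinearIsometryEquiv.symm_apply_apply] at e
  simp only [map_smul, hF, inner_smul_right] at e
  exact e.symm

/-- Dual solutions in X_{-1,k} are passed to primitives, so their observation map is Ψ ∘ Q, where Q
sends the initial data to those of the primitive. Both factors are bounded below. -/
theorem exists_control_bounded {C : Hs hA k →L[𝕜] Hs hA k} {P : H →L[𝕜] H} {α β γ a₀ τ T : ℝ}
    (hC : PartiallyCoercive C P α β) {B : G →L[𝕜] Hs hA (-k)}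
    (hadm : Admissible (obsBounded hA k B))
    (hu : UniformConstants (obsBounded hA k B) P τ γ a₀) (hT : minimalTime α β γ a₀ τ < T)
    (Y₀ : XmStar hA k) :
    ∃ v : ℝ → G, L2On T v ∧
      (∃ Y, IsTranspositionBounded C B ((Set.Ioo 0 T).indicator v) Y₀ Y) ∧
      ∀ Y, IsTranspositionBounded C B ((Set.Ioo 0 T).indicator v) Y₀ Y → Y T = 0 := by
  let _ : NormedSpace ℝ H := NormedSpace.restrictScalars ℝ 𝕜 H
  have hT0 : 0 < T := hu.T₀_pos.trans ((le_max_left _ _).trans_lt hT)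
  obtain ⟨Ψ, hΨ⟩ := exists_observationMap hadm hT0 (conjC C)
  obtain ⟨c, hc, hcΨ⟩ := observationMap_bounded_below hC hu hT hΨ
  obtain ⟨E, hE⟩ := exists_conjC_pred hC.adjoint_bounded_one
  obtain ⟨L, hL⟩ := exists_inv_sqrt hA
  obtain ⟨Q, m, hm, hQm, hQ⟩ := exists_primitive_initial (E := E) L
  have hac : k - 1 = (k - 2) + 1 := by ring
  have hbd : k = (k - 1) + 1 := by ring
  have hid : ∀ (v : ℝ → G) (θ : ℝ), 0 < θ → ∀ W : ℝ → Xm hA k, IsDual C θ W →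
      ∫ t in (0 : ℝ)..θ, (inner 𝕜 ((Set.Ioo 0 T).indicator v t) (adjB hA B (W t).2.1) : 𝕜) =
        ∫ t in (0 : ℝ)..θ, inner 𝕜 ((Set.Ioo 0 T).indicator v t)
          ((Ψ ∘L Q) !₂[Apow hA (k - 1) (W 0).1, Apow hA (k - 2) (W 0).2.2.1, Apow hA k (W 0).2.1,
            Apow hA (k - 1) (W 0).2.2.2] t) := by
    intro v θ hθ W hW
    -- The primitive has A^{k/2} w₂ as its normalized second velocity, so observing it through B* of
    -- the velocity yields B* w₂.
    have h1 := ((isDual_iff_isCascade hac hbd hE).1 hW).primitive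
      (fun i => (weight_pos hA 1 i).ne') hL (inv_sqrt_conjC hE hL)
    have h2 := integral_observation_eq hT0 hΨ hθ h1 (isNObs_obsBounded hadm hθ h1) v
    simp only [LinearIsometryEquiv.symm_apply_apply] at h2
    rw [h2, ContinuousLinearMap.comp_apply, hQ]
  obtain ⟨v, hv, ⟨Y, hYc, hY⟩, huniq⟩ := exists_transposition_control (a' := 2 - k) (b' := 1 - k)
    (c' := 1 - k) (d' := -k) hac hbd (by ring) (by ring) (by ring) (by ring) hE hT0 (Ψ ∘L Q)
    (m := c * m) (by positivity) (fun W => by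
      rw [ContinuousLinearMap.comp_apply, mul_assoc]
      exact (mul_le_mul_of_nonneg_left (hQm W) hc.le).trans (hcΨ _)) Y₀
  refine ⟨v, hv, ⟨Y, hYc.continuousOn, fun θ hθ WT W hW hWT => ?_⟩, fun Y hY => huniq _
    fun W hW => ?_⟩
  · rw [← hWT, hid v θ hθ W hW, hY θ hθ W hW]
  · rw [← hid v T hT0 W hW]
    exact hY.identity T hT0 _ W hW rfl

theorem exists_control_unbounded {C : Hs hA k →L[𝕜] Hs hA k} {P : H →L[𝕜] H} {α β γ a₀ τ T : ℝ}
    (hC : PartiallyCoercive C P α β) {B : G →L[𝕜] Hs hA (-(k + 2))}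
    (hadm : Admissible (obsUnbounded hA k B))
    (hu : UniformConstants (obsUnbounded hA k B) P τ γ a₀) (hT : minimalTime α β γ a₀ τ < T)
    (Y₀ : XpStar hA k) :
    ∃ v : ℝ → G, L2On T v ∧
      (∃ Y, IsTranspositionUnbounded C B ((Set.Ioo 0 T).indicator v) Y₀ Y) ∧
      ∀ Y, IsTranspositionUnbounded C B ((Set.Ioo 0 T).indicator v) Y₀ Y → Y T = 0 := by
  let _ : NormedSpace ℝ H := NormedSpace.restrictScalars ℝ 𝕜 H
  have hT0 : 0 < T := hu.T₀_pos.trans ((le_max_left _ _).trans_lt hT)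
  obtain ⟨Ψ, hΨ⟩ := exists_observationMap hadm hT0 (conjC C)
  obtain ⟨c, hc, hcΨ⟩ := observationMap_bounded_below hC hu hT hΨ
  have hac : k = (k - 1) + 1 := by ring
  obtain ⟨v, hv, ⟨Y, hYc, hY⟩, huniq⟩ := exists_transposition_control (a' := 1 - k) (b' := -k)
    (c' := -k) (d' := -k - 1) hac (b := k + 1) (d := k) rfl (by ring) (by ring) (by ring) (by ring)
    (repr_conjC C) hT0 Ψ hc hcΨ Y₀
  refine ⟨v, hv, ⟨Y, hYc.continuousOn, fun θ hθ WT W hW hWT φ hφ => ?_⟩, fun Y hY => huniq _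
    fun W hW => ?_⟩
  · have h1 := (isDual_iff_isCascade hac rfl (repr_conjC C)).1 hW
    rw [← hWT, ← hY θ hθ W hW]
    refine integral_observation_eq hT0 hΨ hθ h1 ?_ v
    simpa only [IsNObs, LinearIsometryEquiv.symm_apply_apply] using hφ
  · have h1 := (isDual_iff_isCascade hac rfl (repr_conjC C)).1 hW
    -- The transposition identity is tested with the observation furnished by Ψ; only its instance
    -- at time T is needed for Y T = 0.
    refine hY.identity T hT0 _ W hW rfl _ (IsObs.congr hT0.le (hΨ _) (fun t ht => ?_)
      fun t ht => ?_)
    · rw [← (h1.eq_cascade ht).1, LinearIsometryEquiv.symm_apply_apply]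
    · rw [← (h1.eq_cascade ht).2, LinearIsometryEquiv.symm_apply_apply]

end Control

end Cascade

theorem theorem2p33 {𝕜 H G : Type*} [RCLike 𝕜]
    [NormedAddCommGroup H] [InnerProductSpace 𝕜 H] [CompleteSpace H]
    [NormedAddCommGroup G] [InnerProductSpace 𝕜 G] [CompleteSpace G]
    (A : H →ₗ.[𝕜] H) (hA : Cascade.WaveOperator A) (k : ℤ)
    (C : Cascade.Hs hA k →L[𝕜] Cascade.Hs hA k) (P : H →L[𝕜] H) (α β T₀ : ℝ)
    (hA2 : Cascade.PartiallyCoercive C P α β) (hT₀ : 0 < T₀) (hA3 : Cascade.CouplingObservable hA P T₀) :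
    (∀ B : G →L[𝕜] Cascade.Hs hA (-k),
      Cascade.Admissible (Cascade.obsBounded hA k B) →
      Cascade.Observable (Cascade.obsBounded hA k B) T₀ →
      (∀ τ : ℝ, T₀ < τ → ∃ γ a₀ : ℝ, Cascade.UniformConstants (Cascade.obsBounded hA k B) P τ γ a₀) ∧
      ∀ τ γ a₀ : ℝ, Cascade.UniformConstants (Cascade.obsBounded hA k B) P τ γ a₀ →
        ∀ T : ℝ, Cascade.minimalTime α β γ a₀ τ < T → ∀ Y₀ : Cascade.XmStar hA k,
          ∃ v : ℝ → G, Cascade.L2On T v ∧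
            (∃ Y, Cascade.IsTranspositionBounded C B ((Set.Ioo 0 T).indicator v) Y₀ Y) ∧
            ∀ Y, Cascade.IsTranspositionBounded C B ((Set.Ioo 0 T).indicator v) Y₀ Y →
              Y T = 0) ∧
    (∀ B : G →L[𝕜] Cascade.Hs hA (-(k + 2)),
      Cascade.Admissible (Cascade.obsUnbounded hA k B) →
      Cascade.Observable (Cascade.obsUnbounded hA k B) T₀ →
      (∀ τ : ℝ, T₀ < τ → ∃ γ a₀ : ℝ, Cascade.UniformConstants (Cascade.obsUnbounded hA k B) P τ γ a₀) ∧
      ∀ τ γ a₀ : ℝ, Cascade.UniformConstants (Cascade.obsUnbounded hA k B) P τ γ a₀ →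
        ∀ T : ℝ, Cascade.minimalTime α β γ a₀ τ < T → ∀ Y₀ : Cascade.XpStar hA k,
          ∃ v : ℝ → G, Cascade.L2On T v ∧
            (∃ Y, Cascade.IsTranspositionUnbounded C B ((Set.Ioo 0 T).indicator v) Y₀ Y) ∧
            ∀ Y, Cascade.IsTranspositionUnbounded C B ((Set.Ioo 0 T).indicator v) Y₀ Y →
              Y T = 0) := by
  refine ⟨fun B hadm hobs => ⟨fun τ hτ => ?_, fun τ γ a₀ hu T hT Y₀ => ?_⟩,
    fun B hadm hobs => ⟨fun τ hτ => ?_, fun τ γ a₀ hu T hT Y₀ => ?_⟩⟩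
  · exact Cascade.exists_uniformConstants hT₀ hA3 hadm hobs hτ
  · exact Cascade.exists_control_bounded hA2 hadm hu hT Y₀
  · exact Cascade.exists_uniformConstants hT₀ hA3 hadm hobs hτ
  · exact Cascade.exists_control_unbounded hA2 hadm hu hT Y₀
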